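/- Let $\lambda$ be a smooth contact form on $S^3$, with contact structure $\xi=\ker\lambda$, Reeb vector field $X$ and Reeb flow $\phi^t$; orient $S^3$ by $\lambda\wedge d\lambda$. Let $\gamma_0\subset S^3$ be an unknotted periodic Reeb orbit with self-linking number $-1$, and let $\Sigma\subset S^3$ be a $\partial$-strong disk-like global surface of section with $\partial\Sigma=\gamma_0$. This means that $\Sigma$ is a smoothly embedded closed disk whose interior is transverse to $X$, that for every $x\in S^3$ there are $t_-<0<t_+$ with $\phi^{t_\pm}(x)\in\Sigma$, and that the curve $\nu$ of outward pointing directions of $\Sigma$ along $\gamma_0$, taken modulo $\mathbb{R}X$, is a global surface of section for the flow $D\phi^t$ on the torus $\mathbb{T}_{\gamma_0}=(\xi|_{\gamma_0}\setminus 0)/\mathbb{R}_+$ (it is transverse to this flow, and every orbit on the torus meets it in positive and in negative time). For $x\in S^3\setminus\gamma_0$ put $t_+(x)=\inf\{t\ge 0\mid \phi^t(x)\in\Sigma\}$ and $t_-(x)=\sup\{t\le 0\mid \phi^t(x)\in\Sigma\}$. For $T>0$ let $k(T,x)$ be any loop obtained from the trajectory $\phi^{[t_-(x),\,T+t_+(\phi^T(x))]}(x)$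 by adding a path in the interior of $\Sigma$ from its end point to its initial point. Let $\mathrm{link}(k(T,x),\gamma_0)$ be the linking number, where $\gamma_0$ is oriented by the flow. For a global symplectic trivialisation $\sigma$ of $(\xi,d\lambda)$ and a non-zero $u\in\xi_x$, let $t\mapsto\widetilde\Theta_\sigma(t,u)\in\mathbb{R}$ be a continuous argument of $t\mapsto\sigma(D\phi^t u)\in\mathbb{R}^2\setminus 0=\mathbb{C}\setminus 0$. Define $$\kappa_\sigma(\gamma_0)=\liminf_{T\to+\infty}\ \inf_{x\in S^3\setminus\gamma_0,\ u\in\xi_x\setminus 0}\ \frac{\widetilde\Theta_\sigma(T,u)-\widetilde\Theta_\sigma(0,u)}{\mathrm{link}(k(T,x),\gamma_0)}\ \in[-\infty,+\infty].$$ Then $\kappa_\sigma(\gamma_0)$ does not depend on the choice of the global symplectic trivialisation: $\kappa_{\sigma_1}(\gamma_0)=\kappa_{\sigma_2}(\gamma_0)$ for all global symplectic trivialisations $\sigma_1,\sigma_2$ of $(\xi,d\lambda)$, whatever closing paths are used on either side. -/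

import Mathlib

open Set Filter Topology
open scoped ContDiff

noncomputable section

/-! ### The unit sphere of `ℝ⁴` and calculus on it

Maps on `S³` are written as maps on `ℝ⁴` of which only the values on `S³` are used. -/

abbrev E4 : Type := EuclideanSpace ℝ (Fin 4)

def S3 : Set E4 := Metric.sphere 0 1

/-- The radial retraction of `ℝ⁴ ∖ 0` onto `S³`. -/
def radial (x : E4) : E4 := ‖x‖⁻¹ • x

/-- The tangent space of `S³` at `p`. -/
def tangentS3 (p : E4) : Submodule ℝ E4 := (Submodule.span ℝ {p})ᗮ

/-- A map on `S³` is smooth iff its composition with the radial retraction is smooth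
on `ℝ⁴ ∖ 0`. -/
def SmoothOnS3 {F : Type*} [NormedAddCommGroup F] [NormedSpace ℝ F] (g : E4 → F) : Prop :=
  ContDiffOn ℝ ∞ (fun x => g (radial x)) {0}ᶜ

/-- The differential of a map on `S³`; only its values on tangent vectors of `S³` are used
(there the retraction has differential the identity). -/
def diffS3 {F : Type*} [NormedAddCommGroup F] [NormedSpace ℝ F] (g : E4 → F) (p : E4) :
    E4 →L[ℝ] F :=
  fderiv ℝ (fun x => g (radial x)) p

/-! ### Contact forms and Reeb flows -/

/-- The exterior derivative of the 1-form `lam` on `S³`, evaluated on tangent vectors. -/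
def extD (lam : E4 → E4 →L[ℝ] ℝ) (p v w : E4) : ℝ :=
  diffS3 lam p v w - diffS3 lam p w v

/-- `lam` restricts to a contact form on `S³`: it is smooth and `lam ∧ d lam` is a volume form. -/
structure IsContactForm (lam : E4 → E4 →L[ℝ] ℝ) : Prop where
  smooth : SmoothOnS3 lam
  volume : ∀ p ∈ S3, ∀ v₁ ∈ tangentS3 p, ∀ v₂ ∈ tangentS3 p, ∀ v₃ ∈ tangentS3 p,
    LinearIndependent ℝ ![v₁, v₂, v₃] →
      lam p v₁ * extD lam p v₂ v₃ + lam p v₂ * extD lam p v₃ v₁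
        + lam p v₃ * extD lam p v₁ v₂ ≠ 0

/-- The contact plane `ξ_p = ker lam_p ⊆ T_p S³`. -/
def contactPlane (lam : E4 → E4 →L[ℝ] ℝ) (p : E4) : Submodule ℝ E4 :=
  tangentS3 p ⊓ LinearMap.ker (lam p : E4 →ₗ[ℝ] ℝ)

/-- `R` is the Reeb vector field of `lam`. -/
structure IsReebField (lam : E4 → E4 →L[ℝ] ℝ) (R : E4 → E4) : Prop where
  tangent : ∀ p ∈ S3, R p ∈ tangentS3 p
  normalised : ∀ p ∈ S3, lam p (R p) = 1
  kernel : ∀ p ∈ S3, ∀ v ∈ tangentS3 p, extD lam p (R p) v = 0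

/-- `φ : ℝ × S³ → S³` is the (smooth) flow of the vector field `R`. -/
structure IsFlowOf (R : E4 → E4) (φ : ℝ → E4 → E4) : Prop where
  mapsTo : ∀ t, MapsTo (φ t) S3 S3
  zero : ∀ p ∈ S3, φ 0 p = p
  ode : ∀ p ∈ S3, ∀ t, HasDerivAt (fun s => φ s p) (R (φ t p)) t
  smooth : ContDiffOn ℝ ∞ (fun q : ℝ × E4 => φ q.1 (radial q.2)) (univ ×ˢ {0}ᶜ)

/-- The linearised flow `Dφᵗ(p) v`. -/
def linFlow (φ : ℝ → E4 → E4) (t : ℝ) (p v : E4) : E4 := diffS3 (φ t) p v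

def orbit (φ : ℝ → E4 → E4) (p : E4) : Set E4 := range fun t => φ t p

/-- The point `p` lies on a periodic orbit of primitive period `T`. -/
structure IsPeriodicOrbit (φ : ℝ → E4 → E4) (p : E4) (T : ℝ) : Prop where
  mem : p ∈ S3
  pos : 0 < T
  closes : φ T p = p
  primitive : ∀ t ∈ Ioo 0 T, φ t p ≠ p

/-! ### Variation of the argument and linking numbers -/

/-- `θ` is a continuous argument of the curve `g` on `[a, b]`. -/
def IsAngleLift (g : ℝ → ℂ) (a b : ℝ) (θ : ℝ → ℝ) : Prop :=
  ContinuousOn θ (Icc a b) ∧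
    ∀ s ∈ Icc a b, g s = (‖g s‖ : ℂ) * Complex.exp ((θ s : ℂ) * Complex.I)

open Classical in
/-- `θ b - θ a` for a continuous argument `θ` of the curve `g` in `ℂ ∖ 0`. -/
def angleVariation (g : ℝ → ℂ) (a b : ℝ) : ℝ :=
  if h : ∃ θ, IsAngleLift g a b θ then h.choose b - h.choose a else 0

/-- Let `K` be a periodic Reeb orbit of `lam`, oriented by the flow. The map
`f : S³ ∖ K → ℂ ∖ 0` represents the generator of `H¹(S³ ∖ K; ℤ) = [S³ ∖ K, ℂ ∖ 0]` that takes the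
value `1` on the positive meridians of `K`. The sphere is oriented by `lam ∧ d lam`, so that a
meridian `q + ε (cos s • e₁ + sin s • e₂)` with `e₁, e₂ ∈ ξ_q` is positive iff
`d lam (e₁, e₂) > 0`. -/
structure IsLinkingClass (lam : E4 → E4 →L[ℝ] ℝ) (K : Set E4) (f : E4 → ℂ) : Prop where
  continuousOn : ContinuousOn f (S3 \ K)
  ne_zero : ∀ x ∈ S3 \ K, f x ≠ 0
  meridian : ∀ q ∈ K, ∀ e₁ ∈ contactPlane lam q, ∀ e₂ ∈ contactPlane lam q,
    0 < extD lam q e₁ e₂ → ∀ᶠ ε in 𝓝[>] (0 : ℝ),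
      angleVariation (fun s => f (radial (q + ε • (Real.cos s • e₁ + Real.sin s • e₂))))
        0 (2 * Real.pi) = 2 * Real.pi

open Classical in
/-- The linking number with the periodic Reeb orbit `K` of the loop `β : [a, b] → S³ ∖ K`: the
value on `β` of the generator of `H¹(S³ ∖ K; ℤ)` that is `1` on positive meridians. -/
def linkingNumber (lam : E4 → E4 →L[ℝ] ℝ) (K : Set E4) (β : ℝ → E4) (a b : ℝ) : ℝ :=
  if h : ∃ f, IsLinkingClass lam K f then
    angleVariation (fun s => h.choose (β s)) a b / (2 * Real.pi)
  else 0

/-- The periodic Reeb orbit through `p`, of primitive period `T`, has self-linking number `n`: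
`n` is the linking number with the orbit of the loop obtained by pushing the orbit slightly in the
direction of a global nowhere vanishing section `Z` of the contact structure. -/
def HasSelfLinkingNumber (lam : E4 → E4 →L[ℝ] ℝ) (φ : ℝ → E4 → E4) (p : E4) (T : ℝ) (n : ℤ) :
    Prop :=
  ∃ Z : E4 → E4, SmoothOnS3 Z ∧ (∀ q ∈ S3, Z q ∈ contactPlane lam q ∧ Z q ≠ 0) ∧
    ∀ᶠ ε in 𝓝[>] (0 : ℝ),
      linkingNumber lam (orbit φ p) (fun s => radial (φ s p + ε • Z (φ s p))) 0 T = n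

/-! ### Disk-like global surfaces of section -/

/-- `u` restricts to a smooth embedding of the closed unit disk into `S³`. -/
structure IsEmbeddedDisk (u : ℂ → E4) : Prop where
  smooth : ContDiff ℝ ∞ u
  mapsTo : MapsTo u (Metric.closedBall 0 1) S3
  injOn : InjOn u (Metric.closedBall 0 1)
  immersion : ∀ z ∈ Metric.closedBall (0 : ℂ) 1, Function.Injective (fderiv ℝ u z)

/-- The knot `K` bounds a smoothly embedded disk. -/
def IsUnknotted (K : Set E4) : Prop :=
  ∃ u : ℂ → E4, IsEmbeddedDisk u ∧ u '' Metric.sphere 0 1 = K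

/-- The disk parametrised by `u`. -/
def disk (u : ℂ → E4) : Set E4 := u '' Metric.closedBall 0 1

/-- The interior of the disk parametrised by `u`. -/
def diskInterior (u : ℂ → E4) : Set E4 := u '' Metric.ball 0 1

/-- The disk parametrised by `u` is a global surface of section, spanned by the periodic
orbit `K`, for the flow `φ` of `R`. -/
structure IsDiskGSS (R : E4 → E4) (φ : ℝ → E4 → E4) (K : Set E4) (u : ℂ → E4) : Prop where
  embedded : IsEmbeddedDisk u
  boundary : u '' Metric.sphere 0 1 = K
  transverse : ∀ z ∈ Metric.ball (0 : ℂ) 1, R (u z) ∉ range (fderiv ℝ u z)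
  hits_pos : ∀ x ∈ S3, ∃ t > 0, φ t x ∈ disk u
  hits_neg : ∀ x ∈ S3, ∃ t < 0, φ t x ∈ disk u

/-- For `‖z‖ = 1`, the projection to `ξ` along `R` of the outward pointing vector `du(z) z`. All
outward pointing vectors of the disk at `u z` have the same direction modulo `ℝ R`, so this
represents the outward direction in `(ξ ∖ 0) / ℝ₊`. -/
def outward (lam : E4 → E4 →L[ℝ] ℝ) (R : E4 → E4) (u : ℂ → E4) (z : ℂ) : E4 :=
  fderiv ℝ u z z - lam (u z) (fderiv ℝ u z z) • R (u z)

/-- The disk is `∂`-strong: the curve of outward directions is a global surface of section for the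
flow `Dφᵗ` on the torus `(ξ ∖ 0) / ℝ₊` over the boundary orbit. In `transverse`, the curve `c`
is the boundary parametrised by the flow; the curve of outward directions
`t ↦ ℝ₊ (outward (c t))` and the flow line `t ↦ ℝ₊ (Dφᵗ (outward (c 0)))` lie over the same curve
`t ↦ φᵗ(u (c 0))`, agree at `t = 0`, and are transverse there iff the symplectic area that they
span has nonzero derivative. -/
structure IsBoundaryStrong (lam : E4 → E4 →L[ℝ] ℝ) (R : E4 → E4) (φ : ℝ → E4 → E4)
    (u : ℂ → E4) : Prop where
  transverse : ∀ c : ℝ → ℂ, (∀ t, ‖c t‖ = 1 ∧ u (c t) = φ t (u (c 0))) →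
    deriv (fun t => extD lam (u (c t)) (outward lam R u (c t))
      (linFlow φ t (u (c 0)) (outward lam R u (c 0)))) 0 ≠ 0
  hits_pos : ∀ z : ℂ, ‖z‖ = 1 → ∀ v ∈ contactPlane lam (u z), v ≠ 0 →
    ∃ t > 0, ∃ z' : ℂ, ‖z'‖ = 1 ∧ φ t (u z) = u z' ∧
      ∃ r > (0 : ℝ), linFlow φ t (u z) v = r • outward lam R u z'
  hits_neg : ∀ z : ℂ, ‖z‖ = 1 → ∀ v ∈ contactPlane lam (u z), v ≠ 0 →
    ∃ t < 0, ∃ z' : ℂ, ‖z'‖ = 1 ∧ φ t (u z) = u z' ∧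
      ∃ r > (0 : ℝ), linFlow φ t (u z) v = r • outward lam R u z'

def tPlus (φ : ℝ → E4 → E4) (u : ℂ → E4) (x : E4) : ℝ := sInf {t | 0 ≤ t ∧ φ t x ∈ disk u}

def tMinus (φ : ℝ → E4 → E4) (u : ℂ → E4) (x : E4) : ℝ := sSup {t | t ≤ 0 ∧ φ t x ∈ disk u}

/-- The right end point of the interval `I(T, x)`; the left one is `tMinus φ u x`. -/
def tEnd (φ : ℝ → E4 → E4) (u : ℂ → E4) (T : ℝ) (x : E4) : ℝ := T + tPlus φ u (φ T x)

/-- `c : [0, 1] → S³` is a path in the interior of the disk from the end point to the initial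
point of the piece of trajectory `φ^{I(T, x)}(x)`. -/
structure IsClosingPath (φ : ℝ → E4 → E4) (u : ℂ → E4) (T : ℝ) (x : E4) (c : ℝ → E4) : Prop where
  continuousOn : ContinuousOn c (Icc 0 1)
  mapsTo : MapsTo c (Icc 0 1) (diskInterior u)
  source : c 0 = φ (tEnd φ u T x) x
  target : c 1 = φ (tMinus φ u x) x

/-- The loop `k(T, x)`, parametrised by `[tMinus φ u x, tEnd φ u T x + 1]`: first the trajectory
of `x`, then the closing path `c`. -/
def closedTrajectory (φ : ℝ → E4 → E4) (u : ℂ → E4) (T : ℝ) (x : E4) (c : ℝ → E4) : ℝ → E4 :=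
  fun s => if s ≤ tEnd φ u T x then φ s x else c (s - tEnd φ u T x)

/-! ### Trivialisations and the invariant `κ` -/

/-- `σ` restricts to a global symplectic trivialisation `ξ → S³ × ℂ`, where `ℂ = ℝ²` carries the
standard area form `(a, b) ↦ Im (conj a * b)`. -/
structure IsSymplecticTrivialisation (lam : E4 → E4 →L[ℝ] ℝ) (σ : E4 → E4 →L[ℝ] ℂ) : Prop where
  smooth : SmoothOnS3 σ
  symplectic : ∀ p ∈ S3, ∀ v ∈ contactPlane lam p, ∀ w ∈ contactPlane lam p,
    ((starRingEnd ℂ) (σ p v) * σ p w).im = extD lam p v w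

/-- `κ`, computed with the surface parametrised by `u`, the trivialisation `σ`, and the
closing paths `c T x`. It is an extended real number. -/
def kappa (lam : E4 → E4 →L[ℝ] ℝ) (φ : ℝ → E4 → E4) (K : Set E4) (u : ℂ → E4)
    (σ : E4 → E4 →L[ℝ] ℂ) (c : ℝ → E4 → ℝ → E4) : EReal :=
  liminf (fun T : ℝ => ⨅ x ∈ S3 \ K, ⨅ v ∈ contactPlane lam x, ⨅ _ : v ≠ 0,
    ((angleVariation (fun t => σ (φ t x) (linFlow φ t x v)) 0 T /
      linkingNumber lam K (closedTrajectory φ u T x (c T x))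
        (tMinus φ u x) (tEnd φ u T x + 1) : ℝ) : EReal)) atTop

end

noncomputable section

/-! ### Continuous arguments and logarithms -/

/-! The numerators of the two quotients differ by a bounded amount, while the denominators grow at
least linearly in `T`, so the quotients differ by `O(1/T)` uniformly in the point and the vector.

Numerators: on the contact planes the change of trivialisation has the form `σ₂ v = a * σ₁ v + b *
conj (σ₁ v)`, and preservation of area gives `|a|² - |b|² = 1`. Hence the argument of `σ₂ v` is that
of `σ₁ v`, plus that of `a`, plus that of `1 + (b / a) * conj (σ₁ v) / σ₁ v`, which lies in the disk
of radius one about `1` and has argument in `(-π, π)`. The nonvanishing function `a` has a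
continuous logarithm on the three-sphere (`exists_log_S3`), bounded by compactness. This gives
`exists_angleVariation_sub_le`.

Denominators: pull a linking class `f` back by `(z, t) ↦ φ t (u z)` to the convex set `ball × ℝ`,
where it has a logarithm `L`. The jump of `L` from the disk to its first return lies in `2πiℤ` and
depends continuously on the starting point, so it is a constant `k` (`exists_log_increment`), and
the linking number of a closed trajectory is a number of returns times `k / 2πi`. If `k` vanished,
`L` would descend to a logarithm of `f` on the complement of the orbit, which meridians forbid
(`exists_log_of_increment_zero`, `not_exists_log`). Closing paths are irrelevant because `L (·, 0)`
is a logarithm of `f` on the whole open disk.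

Linear growth then amounts to a uniform bound on return times (`exists_hit_bound`). By compactness
it is a local question, delicate only at the boundary orbit. There the linearised flow, together
with the `∂`-strong condition, turns the direction of approach to the orbit into the inward
direction of the disk and makes the height above the disk change sign, which forces a hit
(`eventually_hit_of_direction`). -/

theorem IsAngleLift.of_exp {g F : ℝ → ℂ} {a b : ℝ} (hF : ContinuousOn F (Icc a b))
    (h : ∀ s ∈ Icc a b, g s = Complex.exp (F s)) :
    IsAngleLift g a b (fun s => (F s).im) := by
  refine ⟨Complex.continuous_im.comp_continuousOn hF, fun s hs => ?_⟩
  rw [h s hs, Complex.norm_exp, Complex.ofReal_exp, ← Complex.exp_add, Complex.re_add_im]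

/-- Uniqueness of lifts for the covering `exp`: a continuous logarithm of `1` takes values in the
discrete set `2πiℤ`. Every later claim that two logarithms differ by a constant rests on this. -/
theorem IsPreconnected.exp_eq_one_const {X : Type*} [TopologicalSpace X] {s : Set X}
    (hs : IsPreconnected s) {F : X → ℂ} (hF : ContinuousOn F s)
    (h : ∀ x ∈ s, Complex.exp (F x) = 1) {x y : X} (hx : x ∈ s) (hy : y ∈ s) : F x = F y := by
  refine Complex.isCoveringMap_exp.constOn_of_comp hs hF ?_ hx hy
  intro x hx y hy
  simp [h x hx, h y hy]

theorem IsAngleLift.sub_eq {g : ℝ → ℂ} {a b : ℝ} {θ θ' : ℝ → ℝ} (hab : a ≤ b)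
    (h0 : ∀ s ∈ Icc a b, g s ≠ 0) (h : IsAngleLift g a b θ) (h' : IsAngleLift g a b θ') :
    θ b - θ a = θ' b - θ' a := by
  have key := isPreconnected_Icc.exp_eq_one_const (s := Icc a b)
    (F := fun s => ((θ s - θ' s : ℝ) : ℂ) * Complex.I)
    ((Complex.continuous_ofReal.comp_continuousOn (h.1.sub h'.1)).mul continuousOn_const)
    (fun s hs => by
      have h1 := h.2 s hs
      rw [h'.2 s hs] at h1
      have h2 : ((‖g s‖ : ℝ) : ℂ) ≠ 0 := by simpa using h0 s hs
      have hn : ‖g s‖ = ‖((‖g s‖ : ℝ) : ℂ) * Complex.exp ((θ' s : ℂ) * Complex.I)‖ := by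
        simp [Complex.norm_exp]
      rw [← hn] at h1
      have h3 := mul_left_cancel₀ h2 h1
      push_cast
      rw [sub_mul, Complex.exp_sub, h3, div_self (Complex.exp_ne_zero _)])
    (left_mem_Icc.2 hab) (right_mem_Icc.2 hab)
  have := mul_right_cancel₀ Complex.I_ne_zero key
  have := Complex.ofReal_injective this
  linarith

/-- Makes the arbitrary choice in `angleVariation` harmless. Nonvanishing is needed, since at a zero
of `g` an angle lift is unconstrained. -/
theorem IsAngleLift.angleVariation_eq {g : ℝ → ℂ} {a b : ℝ} {θ : ℝ → ℝ} (hab : a ≤ b)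
    (h0 : ∀ s ∈ Icc a b, g s ≠ 0) (h : IsAngleLift g a b θ) :
    angleVariation g a b = θ b - θ a := by
  have hex : ∃ θ, IsAngleLift g a b θ := ⟨θ, h⟩
  rw [angleVariation, dif_pos hex]
  exact hex.choose_spec.sub_eq hab h0 h

theorem angleVariation_eq_of_exp {g F : ℝ → ℂ} {a b : ℝ} (hab : a ≤ b)
    (hF : ContinuousOn F (Icc a b)) (h : ∀ s ∈ Icc a b, g s = Complex.exp (F s)) :
    angleVariation g a b = (F b).im - (F a).im :=
  (IsAngleLift.of_exp hF h).angleVariation_eq hab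
    (fun s hs => by rw [h s hs]; exact Complex.exp_ne_zero _)

/-- Star convex sets are contractible, hence simply connected, so maps to `ℂ ∖ 0` lift through
`exp`. -/
theorem exists_log_of_starConvex {E : Type*} [NormedAddCommGroup E] [NormedSpace ℝ E] {U : Set E}
    {x : E} (hU : IsOpen U) (hx : x ∈ U) (hs : StarConvex ℝ x U) {g : E → ℂ}
    (hg : ContinuousOn g U) (h0 : ∀ y ∈ U, g y ≠ 0) :
    ∃ F : E → ℂ, ContinuousOn F U ∧ ∀ y ∈ U, g y = Complex.exp (F y) := by
  have := hs.contractibleSpace ⟨x, hx⟩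
  have hsc : IsSimplyConnected U := (inferInstance : SimplyConnectedSpace U)
  obtain ⟨F, hF, h⟩ := Complex.exists_continuousOn_eqOn_exp_comp hsc hU hg
    (by rintro ⟨y, hy, h⟩; exact h0 y hy h)
  exact ⟨F, hF, fun y hy => (h hy).symm⟩

theorem exists_log_Icc {g : ℝ → ℂ} {a b : ℝ} (hab : a ≤ b) (hg : ContinuousOn g (Icc a b))
    (h0 : ∀ s ∈ Icc a b, g s ≠ 0) :
    ∃ F : ℝ → ℂ, ContinuousOn F (Icc a b) ∧ ∀ s ∈ Icc a b, g s = Complex.exp (F s) := by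
  -- The curve is extended by constants beyond the end points, because the logarithm lemma asks for
  -- an open domain.
  obtain ⟨F, hF, h⟩ := exists_log_of_starConvex (U := univ) (x := (0 : ℝ))
    (g := IccExtend hab (fun s : Icc a b => g s))
    isOpen_univ (mem_univ _) (convex_univ.starConvex (mem_univ _))
    (continuousOn_iff_continuous_domRestrict.1 hg).Icc_extend'.continuousOn
    (fun y _ => h0 _ (projIcc a b hab y).2)
  refine ⟨F, hF.mono (subset_univ _), fun s hs => ?_⟩
  rw [← h s (mem_univ _), IccExtend_of_mem _ _ hs]

/-! ### Continuous nonvanishing functions on the three-sphere have a continuous logarithm -/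

theorem mem_S3 {p : E4} : p ∈ S3 ↔ ‖p‖ = 1 := by simp [S3]

theorem S3_ne_zero {p : E4} (hp : p ∈ S3) : p ≠ 0 := by
  rintro rfl; simp [mem_S3] at hp

theorem isCompact_S3 : IsCompact S3 := isCompact_sphere _ _

theorem radial_of_mem {p : E4} (hp : p ∈ S3) : radial p = p := by
  simp [radial, mem_S3.1 hp]

theorem radial_mem {x : E4} (hx : x ≠ 0) : radial x ∈ S3 := by
  rw [mem_S3, radial, norm_smul, norm_inv, norm_norm, inv_mul_cancel₀ (norm_ne_zero_iff.2 hx)]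

theorem continuousOn_radial : ContinuousOn radial {0}ᶜ := by
  apply ContinuousOn.smul (ContinuousOn.inv₀ continuous_norm.continuousOn _) continuousOn_id
  intro x hx
  exact norm_ne_zero_iff.2 hx

/-- The complement of the closed ray spanned by `-v`. -/
def slit (v : E4) : Set E4 := ((fun r : ℝ => r • v) '' Iic 0)ᶜ

theorem isOpen_slit {v : E4} (hv : v ≠ 0) : IsOpen (slit v) :=
  ((isClosedEmbedding_smul_left hv).isClosedMap _ isClosed_Iic).isOpen_compl

theorem self_mem_slit {v : E4} (hv : v ≠ 0) : v ∈ slit v := by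
  rintro ⟨r, hr, h⟩
  have h' : (r - 1) • v = 0 := by rw [sub_smul, one_smul, sub_eq_zero]; exact h
  rcases smul_eq_zero.1 h' with h | h
  · have : r ≤ 0 := hr
    linarith
  · exact hv h

theorem starConvex_slit {v : E4} (hv : v ≠ 0) : StarConvex ℝ v (slit v) := by
  rintro x hx a b ha hb hab ⟨r, hr, h⟩
  have hr : r ≤ 0 := hr
  rcases hb.eq_or_lt with rfl | hb
  · exact self_mem_slit hv ⟨r, hr, by simpa [show a = 1 by linarith] using h⟩
  · refine hx ⟨b⁻¹ * (r - a), ?_, ?_⟩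
    · exact mul_nonpos_of_nonneg_of_nonpos (inv_nonneg.2 hb.le) (by linarith)
    · have h2 : b • x = (r - a) • v := by
        rw [sub_smul, eq_sub_iff_add_eq, add_comm]; exact h.symm
      simp only [mul_smul]
      rw [← h2, smul_smul, inv_mul_cancel₀ hb.ne', one_smul]

theorem slit_inter_slit_neg (v : E4) :
    slit v ∩ slit (-v) = ((Submodule.span ℝ {v} : Submodule ℝ E4) : Set E4)ᶜ := by
  ext x
  simp only [slit, mem_inter_iff, mem_compl_iff, mem_image, mem_Iic, SetLike.mem_coe,
    Submodule.mem_span_singleton]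
  constructor
  · rintro ⟨h1, h2⟩ ⟨r, rfl⟩
    rcases le_total r 0 with h | h
    · exact h1 ⟨r, h, rfl⟩
    · exact h2 ⟨-r, by linarith, by simp⟩
  · intro h
    exact ⟨fun ⟨r, _, e⟩ => h ⟨r, e⟩, fun ⟨r, _, e⟩ => h ⟨-r, by simpa using e⟩⟩

/-- The intersection is the complement of a line, and a line has codimension three in `ℝ⁴`. -/
theorem isPreconnected_slit_inter {v : E4} (hv : v ≠ 0) : IsPreconnected (slit v ∩ slit (-v)) := by
  rw [slit_inter_slit_neg]
  refine (isConnected_compl_of_one_lt_codim ?_).isPreconnected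
  have h1 := Submodule.finrank_quotient_add_finrank (Submodule.span ℝ {v} : Submodule ℝ E4)
  rw [finrank_span_singleton hv, finrank_euclideanSpace_fin] at h1
  rw [← Module.finrank_eq_rank]
  have : Module.finrank ℝ (E4 ⧸ (Submodule.span ℝ {v} : Submodule ℝ E4)) = 3 := by omega
  rw [this]
  norm_num

/-- A direct substitute for the simple connectedness of the sphere: two opposite star-shaped slit
domains cover `ℝ⁴ ∖ 0`, and their overlap is connected, so the logarithms on them differ there by a
constant and can be glued. -/
theorem exists_log_S3 {a : E4 → ℂ} (ha : ContinuousOn a S3) (h0 : ∀ p ∈ S3, a p ≠ 0) :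
    ∃ α : E4 → ℂ, ContinuousOn α S3 ∧ ∀ p ∈ S3, a p = Complex.exp (α p) := by
  classical
  obtain ⟨v, hv⟩ : ∃ v : E4, v ≠ 0 := exists_ne 0
  have hv' : -v ≠ 0 := neg_ne_zero.2 hv
  have hz : ∀ w : E4, slit w ⊆ {0}ᶜ := by
    rintro w x hx rfl
    exact hx ⟨0, mem_Iic.2 le_rfl, by simp⟩
  have hg : ContinuousOn (fun x => a (radial x)) {0}ᶜ :=
    ha.comp continuousOn_radial (fun x hx => radial_mem hx)
  obtain ⟨F, hF, hFe⟩ := exists_log_of_starConvex (isOpen_slit hv) (self_mem_slit hv)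
    (starConvex_slit hv) (hg.mono (hz _)) (fun x hx => h0 _ (radial_mem (hz _ hx)))
  obtain ⟨G, hG, hGe⟩ := exists_log_of_starConvex (isOpen_slit hv') (self_mem_slit hv')
    (starConvex_slit hv') (hg.mono (hz _)) (fun x hx => h0 _ (radial_mem (hz _ hx)))
  have hexp : ∀ x ∈ slit v ∩ slit (-v), Complex.exp (F x - G x) = 1 := fun x hx => by
    rw [Complex.exp_sub, ← hFe x hx.1, ← hGe x hx.2, div_self (h0 _ (radial_mem (hz _ hx.1)))]
  have hconst : ∃ c, Complex.exp c = 1 ∧ ∀ x ∈ slit v ∩ slit (-v), F x = G x + c := by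
    by_cases hne : (slit v ∩ slit (-v)).Nonempty
    · obtain ⟨y, hy⟩ := hne
      refine ⟨F y - G y, hexp y hy, fun x hx => ?_⟩
      have := (isPreconnected_slit_inter hv).exp_eq_one_const (F := fun x => F x - G x)
        ((hF.mono inter_subset_left).sub (hG.mono inter_subset_right)) hexp hx hy
      linear_combination this
    · exact ⟨0, by simp, fun x hx => (hne ⟨x, hx⟩).elim⟩
  obtain ⟨c, hc, hFG⟩ := hconst
  have hcov : ∀ x : E4, x ≠ 0 → x ∉ slit v → x ∈ slit (-v) := by
    intro x hx h1
    by_contra h2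
    simp only [slit, mem_compl_iff, not_not] at h1 h2
    obtain ⟨r, hr, rfl⟩ := h1
    obtain ⟨s, hs, e⟩ := h2
    have hr : r ≤ 0 := hr
    have hs : s ≤ 0 := hs
    have : (s + r) • v = 0 := by
      rw [add_smul]; simp only [smul_neg] at e; rw [← e]; abel
    rcases smul_eq_zero.1 this with h | h
    · have : r = 0 := by linarith
      exact hx (by simp [this])
    · exact hv h
  have hα : ∀ x ∈ slit (-v), (if x ∈ slit v then F x else G x + c) = G x + c := by
    intro x hx
    split_ifs with h
    · exact hFG x ⟨h, hx⟩
    · rfl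
  refine ⟨fun x => if x ∈ slit v then F x else G x + c, fun p hp => ?_, fun p hp => ?_⟩
  · apply ContinuousAt.continuousWithinAt
    by_cases h : p ∈ slit v
    · have hn := (isOpen_slit hv).mem_nhds h
      refine (hF.continuousAt hn).congr ?_
      filter_upwards [hn] with x hx
      simp [hx]
    · have h' := hcov p (S3_ne_zero hp) h
      have hn := (isOpen_slit hv').mem_nhds h'
      refine ((hG.continuousAt hn).add (continuousAt_const (y := c))).congr ?_
      filter_upwards [hn] with x hx
      exact (hα x hx).symm
  · rw [← radial_of_mem hp]
    by_cases h : radial p ∈ slit v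
    · have := hFe _ h
      rw [radial_of_mem (radial_mem (S3_ne_zero hp))] at this
      simp only [h, if_true]; exact this
    · have h' := hcov _ (S3_ne_zero (radial_mem (S3_ne_zero hp))) h
      have := hGe _ h'
      rw [radial_of_mem (radial_mem (S3_ne_zero hp))] at this
      simp only [h, if_false]; rw [Complex.exp_add, hc, mul_one]; exact this

end

noncomputable section

/-! ### The extended flow -/

theorem mem_tangentS3 {p v : E4} : v ∈ tangentS3 p ↔ inner ℝ p v = 0 := by
  rw [tangentS3, Submodule.mem_orthogonal_singleton_iff_inner_right]

/-- The derivative of the norm at `p` is the inner product with `p`, which vanishes on tangent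
vectors. -/
theorem fderiv_radial {p v : E4} (hp : p ∈ S3) (hv : v ∈ tangentS3 p) :
    fderiv ℝ radial p v = v := by
  have h1 : ‖p‖ = 1 := mem_S3.1 hp
  have hd : DifferentiableAt ℝ (fun x : E4 => ‖x‖⁻¹) p :=
    (((contDiffAt_norm ℝ (S3_ne_zero hp)).inv
      (norm_ne_zero_iff.2 (S3_ne_zero hp)) : ContDiffAt ℝ ∞ _ p)).differentiableAt (by simp)
  have h0 : fderiv ℝ (fun x : E4 => ‖x‖⁻¹) p v = 0 := by
    have h2 := (hasDerivAt_inv (x := √(‖p‖ ^ 2)) (by simp [h1])).comp_hasFDerivAt p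
      ((hasStrictFDerivAt_norm_sq p).hasFDerivAt.sqrt (by simp [h1]))
    have h3 : (fun x : E4 => ‖x‖⁻¹) = Inv.inv ∘ fun x : E4 => √(‖x‖ ^ 2) := by
      ext x; rw [Function.comp_apply, Real.sqrt_sq (norm_nonneg _)]
    rw [h3, h2.fderiv]
    simp [mem_tangentS3.1 hv]
  have h4 := hd.hasFDerivAt.smul (hasFDerivAt_id p)
  have h5 : fderiv ℝ radial p = _ := HasFDerivAt.fderiv h4
  rw [h5]
  simp [h0, h1]

theorem SmoothOnS3.contDiffAt {F : Type*} [NormedAddCommGroup F] [NormedSpace ℝ F] {g : E4 → F}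
    (hg : SmoothOnS3 g) {x : E4} (hx : x ≠ 0) : ContDiffAt ℝ ∞ (fun x => g (radial x)) x :=
  ContDiffOn.contDiffAt hg (isOpen_compl_singleton.mem_nhds hx)

theorem SmoothOnS3.continuousOn {F : Type*} [NormedAddCommGroup F] [NormedSpace ℝ F] {g : E4 → F}
    (hg : SmoothOnS3 g) : ContinuousOn g S3 :=
  (ContDiffOn.continuousOn hg |>.mono fun _ hx => S3_ne_zero hx).congr
    fun x hx => by simp only [radial_of_mem hx]

theorem SmoothOnS3.continuousOn_diffS3 {F : Type*} [NormedAddCommGroup F] [NormedSpace ℝ F]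
    {g : E4 → F} (hg : SmoothOnS3 g) : ContinuousOn (diffS3 g) S3 := fun _ hx =>
  ((hg.contDiffAt (S3_ne_zero hx)).fderiv_right (m := 0) (by simp)).continuousAt.continuousWithinAt

/-- The flow, extended to `ℝ × ℝ⁴` by the radial retraction. -/
def flowExt (φ : ℝ → E4 → E4) (q : ℝ × E4) : E4 := φ q.1 (radial q.2)

section Flow

variable {lam : E4 → E4 →L[ℝ] ℝ} {R : E4 → E4} {φ : ℝ → E4 → E4}

theorem flowExt_of_mem {t : ℝ} {p : E4} (hp : p ∈ S3) : flowExt φ (t, p) = φ t p := by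
  simp [flowExt, radial_of_mem hp]

theorem IsFlowOf.flowExt_mem (hφ : IsFlowOf R φ) {q : ℝ × E4} (hq : q.2 ≠ 0) :
    flowExt φ q ∈ S3 := hφ.mapsTo _ (radial_mem hq)

theorem IsFlowOf.contDiffAt (hφ : IsFlowOf R φ) {q : ℝ × E4} (hq : q.2 ≠ 0) :
    ContDiffAt ℝ ∞ (flowExt φ) q :=
  hφ.smooth.contDiffAt ((isOpen_univ.prod isOpen_compl_singleton).mem_nhds ⟨mem_univ _, hq⟩)

theorem IsFlowOf.hasFDerivAt (hφ : IsFlowOf R φ) {q : ℝ × E4} (hq : q.2 ≠ 0) :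
    HasFDerivAt (flowExt φ) (fderiv ℝ (flowExt φ) q) q :=
  ((hφ.contDiffAt hq).differentiableAt (by simp)).hasFDerivAt

theorem IsFlowOf.continuousOn (hφ : IsFlowOf R φ) :
    ContinuousOn (fun q : ℝ × E4 => φ q.1 q.2) (univ ×ˢ S3) := by
  refine (hφ.smooth.continuousOn.mono (prod_mono le_rfl fun _ hx => S3_ne_zero hx)).congr ?_
  intro q hq
  simp [radial_of_mem hq.2]

theorem IsFlowOf.continuous_left (hφ : IsFlowOf R φ) {p : E4} (hp : p ∈ S3) :
    Continuous fun t => φ t p :=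
  continuous_iff_continuousAt.2 fun t => (hφ.ode p hp t).continuousAt

theorem IsFlowOf.fderiv_time (hφ : IsFlowOf R φ) {q : ℝ × E4} (hq : q.2 ≠ 0) :
    fderiv ℝ (flowExt φ) q (1, 0) = R (flowExt φ q) := by
  have h1 : HasDerivAt (fun s => flowExt φ (s, q.2)) (fderiv ℝ (flowExt φ) q (1, 0)) q.1 :=
    (hφ.hasFDerivAt hq).comp_hasDerivAt (f := fun s => (s, q.2)) q.1
      ((hasDerivAt_id q.1).prodMk (hasDerivAt_const q.1 q.2))
  exact h1.unique (hφ.ode _ (radial_mem hq) q.1)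

theorem IsFlowOf.linFlow_eq (hφ : IsFlowOf R φ) {t : ℝ} {p : E4} (hp : p ≠ 0) (v : E4) :
    linFlow φ t p v = fderiv ℝ (flowExt φ) (t, p) (0, v) := by
  have h1 : HasFDerivAt (fun x => flowExt φ (t, x)) _ p :=
    HasFDerivAt.comp p (f := fun x => (t, x)) (hφ.hasFDerivAt (q := (t, p)) hp)
      ((hasFDerivAt_const t p).prodMk (hasFDerivAt_id p))
  have h2 : linFlow φ t p v = fderiv ℝ (fun x => flowExt φ (t, x)) p v := rfl
  rw [h2, h1.fderiv]
  rfl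

/-- Smoothness of `R` is inherited from the flow, as its time derivative at zero. It supplies the
Lipschitz bound used for the group law. -/
theorem IsFlowOf.smooth_field (hφ : IsFlowOf R φ) : SmoothOnS3 R := by
  intro x hx
  have h1 : ContDiffAt ℝ ∞ (fun y : E4 => fderiv ℝ (flowExt φ) (0, y) (1, 0)) x := by
    have h2 : ContDiffAt ℝ ∞ (fderiv ℝ (flowExt φ)) (0, x) :=
      (hφ.contDiffAt (q := (0, x)) hx).fderiv_right (by simp)
    exact (h2.comp x (f := fun y : E4 => ((0 : ℝ), y)) (by fun_prop)).clm_apply contDiffAt_const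
  refine (h1.congr_of_eventuallyEq ?_).contDiffWithinAt
  filter_upwards [isOpen_compl_singleton.mem_nhds hx] with y hy
  rw [hφ.fderiv_time (q := (0, y)) hy, flowExt, hφ.zero _ (radial_mem hy)]

theorem SmoothOnS3.exists_lipschitzOnWith {F : Type*} [NormedAddCommGroup F] [NormedSpace ℝ F]
    {g : E4 → F} (hg : SmoothOnS3 g) : ∃ K, LipschitzOnWith K g S3 := by
  apply LocallyLipschitzOn.exists_lipschitzOnWith_of_compact isCompact_S3
  intro x hx
  obtain ⟨K, t, ht, h⟩ := ((hg.contDiffAt (S3_ne_zero hx)).of_le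
    (by exact_mod_cast le_top : (1 : WithTop ℕ∞) ≤ ∞)).exists_lipschitzOnWith
  refine ⟨K, t ∩ S3, inter_mem (mem_nhdsWithin_of_mem_nhds ht) self_mem_nhdsWithin, ?_⟩
  intro y hy z hz
  simpa only [radial_of_mem hy.2, radial_of_mem hz.2] using h hy.1 hz.1

/-- Both sides solve the same initial value problem in `s`, and `R` is Lipschitz on the compact
sphere. -/
theorem IsFlowOf.add (hφ : IsFlowOf R φ) {p : E4} (hp : p ∈ S3) (s t : ℝ) :
    φ (s + t) p = φ s (φ t p) := by
  obtain ⟨K, hK⟩ := hφ.smooth_field.exists_lipschitzOnWith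
  have := ODE_solution_unique_univ (v := fun _ => R) (s := fun _ => S3) (t₀ := 0)
    (f := fun s => φ (s + t) p) (g := fun s => φ s (φ t p)) (fun _ => hK)
    (fun s => ⟨(hφ.ode p hp (s + t)).comp_add_const s t, hφ.mapsTo _ hp⟩)
    (fun s => ⟨hφ.ode _ (hφ.mapsTo t hp) s, hφ.mapsTo _ (hφ.mapsTo t hp)⟩)
    (by simp [hφ.zero _ (hφ.mapsTo t hp)])
  exact congrFun this s

theorem IsFlowOf.neg_cancel (hφ : IsFlowOf R φ) {p : E4} (hp : p ∈ S3) (t : ℝ) :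
    φ (-t) (φ t p) = p := by
  rw [← hφ.add hp, neg_add_cancel, hφ.zero p hp]

theorem IsFlowOf.cancel_neg (hφ : IsFlowOf R φ) {p : E4} (hp : p ∈ S3) (t : ℝ) :
    φ t (φ (-t) p) = p := by
  rw [← hφ.add hp, add_neg_cancel, hφ.zero p hp]

theorem IsFlowOf.linFlow_add (hφ : IsFlowOf R φ) {p : E4} (hp : p ∈ S3) (s t : ℝ) (v : E4) :
    linFlow φ (s + t) p v = linFlow φ s (φ t p) (linFlow φ t p v) := by
  have hd : ∀ (t : ℝ) (x : E4), x ∈ S3 → DifferentiableAt ℝ (fun x => φ t (radial x)) x := by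
    intro t x hx
    exact (hφ.hasFDerivAt (q := (t, x)) (S3_ne_zero hx)).differentiableAt.comp x
      (f := fun x => (t, x)) (by fun_prop)
  have h0 : φ t (radial p) = φ t p := by rw [radial_of_mem hp]
  have h1 : (fun x => φ (s + t) (radial x)) =ᶠ[𝓝 p]
      (fun x => φ s (radial x)) ∘ (fun x => φ t (radial x)) := by
    filter_upwards [isOpen_compl_singleton.mem_nhds (S3_ne_zero hp)] with x hx
    simp only [Function.comp]
    rw [radial_of_mem (hφ.mapsTo _ (radial_mem hx)), hφ.add (radial_mem hx)]
  rw [linFlow, diffS3, h1.fderiv_eq, fderiv_comp _ (by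
    rw [h0]; exact hd _ _ (hφ.mapsTo _ hp)) (hd _ _ hp), h0]
  rfl

theorem IsFlowOf.linFlow_zero (hφ : IsFlowOf R φ) {p v : E4} (hp : p ∈ S3)
    (hv : v ∈ tangentS3 p) : linFlow φ 0 p v = v := by
  have h1 : (fun x => φ 0 (radial x)) =ᶠ[𝓝 p] radial := by
    filter_upwards [isOpen_compl_singleton.mem_nhds (S3_ne_zero hp)] with x hx
    exact hφ.zero _ (radial_mem hx)
  rw [linFlow, diffS3, h1.fderiv_eq, fderiv_radial hp hv]

theorem inner_eq_zero_of_hasDerivAt {γ : ℝ → E4} {γ' : E4} {t : ℝ} (h : HasDerivAt γ γ' t)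
    (hs : ∀ᶠ s in 𝓝 t, γ s ∈ S3) : inner ℝ (γ t) γ' = 0 := by
  have h1 := h.norm_sq
  have h2 : (fun s => ‖γ s‖ ^ 2) =ᶠ[𝓝 t] fun _ => 1 := by
    filter_upwards [hs] with s hs
    simp [mem_S3.1 hs]
  have h3 := (h1.congr_of_eventuallyEq h2.symm).unique (hasDerivAt_const t (1 : ℝ))
  linarith

theorem IsFlowOf.linFlow_mem_tangentS3 (hφ : IsFlowOf R φ) {p : E4} (hp : p ∈ S3) (t : ℝ)
    (v : E4) : linFlow φ t p v ∈ tangentS3 (φ t p) := by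
  rw [mem_tangentS3, hφ.linFlow_eq (S3_ne_zero hp)]
  have h1 : HasDerivAt (fun s : ℝ => ((t, p + s • v) : ℝ × E4)) (0, v) 0 := by
    have := ((hasDerivAt_id (0 : ℝ)).smul_const v).const_add p
    simp only [id, one_smul] at this
    exact (hasDerivAt_const (0 : ℝ) t).prodMk this
  have h2 : HasDerivAt (fun s : ℝ => flowExt φ (t, p + s • v))
      (fderiv ℝ (flowExt φ) (t, p) (0, v)) 0 := by
    have h3 := hφ.hasFDerivAt (q := (t, p)) (S3_ne_zero hp)
    refine HasFDerivAt.comp_hasDerivAt (l := flowExt φ)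
      (f := fun s : ℝ => ((t, p + s • v) : ℝ × E4)) 0 ?_ h1
    simpa using h3
  have h4 := inner_eq_zero_of_hasDerivAt h2 ?_
  · simpa [flowExt_of_mem hp] using h4
  · have h5 : ∀ᶠ s : ℝ in 𝓝 0, p + s • v ≠ 0 := by
      have : ContinuousAt (fun s : ℝ => p + s • v) 0 := by fun_prop
      exact this.eventually_ne (by simpa using S3_ne_zero hp)
    filter_upwards [h5] with s hs
    exact hφ.flowExt_mem hs

theorem IsFlowOf.linFlow_neg_cancel (hφ : IsFlowOf R φ) {p v : E4} (hp : p ∈ S3)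
    (hv : v ∈ tangentS3 p) (t : ℝ) : linFlow φ (-t) (φ t p) (linFlow φ t p v) = v := by
  rw [← hφ.linFlow_add hp, neg_add_cancel, hφ.linFlow_zero hp hv]

theorem IsFlowOf.continuous_linFlow (hφ : IsFlowOf R φ) {p : E4} (hp : p ∈ S3) (v : E4) :
    Continuous fun t => linFlow φ t p v := by
  simp only [hφ.linFlow_eq (S3_ne_zero hp)]
  refine continuous_iff_continuousAt.2 fun t => ?_
  have h2 : ContDiffAt ℝ 0 (fderiv ℝ (flowExt φ)) (t, p) :=
      (hφ.contDiffAt (q := (t, p)) (S3_ne_zero hp)).fderiv_right (by simp)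
  exact (ContinuousAt.comp (f := fun s : ℝ => (s, p)) h2.continuousAt
    (by fun_prop)).clm_apply continuousAt_const

/-- Differentiate `φ t (φ s p) = φ (s + t) p` at `s = 0` on both sides. -/
theorem IsFlowOf.linFlow_field (hφ : IsFlowOf R φ) {p : E4} (hp : p ∈ S3) (t : ℝ) :
    linFlow φ t p (R p) = R (φ t p) := by
  have h1 : HasDerivAt (fun s => φ t (radial (φ s p))) (linFlow φ t p (R p)) 0 := by
    have h0 : φ 0 p = p := hφ.zero p hp
    have hd : DifferentiableAt ℝ (fun x => φ t (radial x)) (φ 0 p) := by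
      rw [h0]
      exact (hφ.hasFDerivAt (q := (t, p)) (S3_ne_zero hp)).differentiableAt.comp p
        (f := fun x => (t, x)) (by fun_prop)
    have := hd.hasFDerivAt.comp_hasDerivAt (0 : ℝ) (hφ.ode p hp 0)
    rw [h0] at this
    exact this
  have h2 : HasDerivAt (fun s => φ (s + t) p) (R (φ t p)) 0 := by
    have h := hφ.ode p hp (0 + t)
    rw [zero_add] at h
    exact HasDerivAt.comp_add_const 0 t (by simpa using h)
  refine h1.unique (h2.congr_of_eventuallyEq (Eventually.of_forall fun s => ?_))
  simp only
  rw [radial_of_mem (hφ.mapsTo _ hp), ← hφ.add hp, add_comm]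

/-- The Reeb flow preserves `lam`; this is Cartan's formula done by hand. Differentiate `lam (∂ₜφ) =
1` in the direction `v`, and `lam (Dφᵗ v)` in time. By symmetry of second derivatives the difference
is `d lam (R, Dφᵗ v)`, which is zero. -/
theorem IsFlowOf.lam_linFlow (hφ : IsFlowOf R φ) (hlam : IsContactForm lam)
    (hR : IsReebField lam R) {p v : E4} (hp : p ∈ S3) (hv : v ∈ tangentS3 p) (t : ℝ) :
    lam (φ t p) (linFlow φ t p v) = lam p v := by
  set F := flowExt φ with hF
  set Λ : E4 → E4 →L[ℝ] ℝ := fun x => lam (radial x) with hΛ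
  have hp0 := S3_ne_zero hp
  have hFt : ∀ t, F (t, p) = φ t p := fun t => flowExt_of_mem hp
  have key : ∀ (t : ℝ) (w : ℝ × E4), HasFDerivAt (fun q => Λ (F q) (fderiv ℝ F q w))
      ((Λ (F (t, p))).comp ((fderiv ℝ (fderiv ℝ F) (t, p)).flip w) +
        ((fderiv ℝ Λ (F (t, p))).comp (fderiv ℝ F (t, p))).flip (fderiv ℝ F (t, p) w)) (t, p) := by
    intro t w
    have h1 : HasFDerivAt (fun q => Λ (F q)) ((fderiv ℝ Λ (F (t, p))).comp (fderiv ℝ F (t, p)))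
        (t, p) := by
      refine HasFDerivAt.comp (g := Λ) (t, p) ?_ (hφ.hasFDerivAt (q := (t, p)) hp0)
      exact ((hlam.smooth.contDiffAt (S3_ne_zero
        (hφ.flowExt_mem (q := (t, p)) hp0))).differentiableAt (by simp)).hasFDerivAt
    have h2 : HasFDerivAt (fderiv ℝ F) (fderiv ℝ (fderiv ℝ F) (t, p)) (t, p) :=
      (((hφ.contDiffAt (q := (t, p)) hp0).fderiv_right (m := 1)
        (by norm_num; exact WithTop.coe_le_coe.2 le_top)).differentiableAt (by simp)).hasFDerivAt
    have h3 := h2.clm_apply (hasFDerivAt_const w (t, p))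
    have h4 := h1.clm_apply h3
    simpa using h4
  have hconst : ∀ t, fderiv ℝ (fun q => Λ (F q) (fderiv ℝ F q (1, 0))) (t, p) = 0 := by
    intro t
    have : (fun q => Λ (F q) (fderiv ℝ F q (1, 0))) =ᶠ[𝓝 (t, p)] fun _ => (1 : ℝ) := by
      filter_upwards [(isOpen_univ.prod isOpen_compl_singleton).mem_nhds
        (show ((t, p) : ℝ × E4) ∈ univ ×ˢ {0}ᶜ from ⟨mem_univ _, hp0⟩)] with q hq
      have hq' := hφ.flowExt_mem hq.2
      rw [hF, hφ.fderiv_time hq.2, hΛ]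
      simp only [radial_of_mem hq']
      exact hR.normalised _ hq'
    rw [this.fderiv_eq]
    simp
  have hder : ∀ t, HasDerivAt (fun s => Λ (F (s, p)) (fderiv ℝ F (s, p) (0, v))) 0 t := by
    intro t
    have h1 := (key t (0, v)).comp_hasDerivAt (f := fun s : ℝ => (s, p)) t
      ((hasDerivAt_id t).prodMk (hasDerivAt_const t p))
    have h2 := (key t (1, 0)).fderiv
    rw [hconst] at h2
    have h3 := congrArg (fun L => L (0, v)) h2
    have hsymm : fderiv ℝ (fderiv ℝ F) (t, p) (1, 0) (0, v) =
        fderiv ℝ (fderiv ℝ F) (t, p) (0, v) (1, 0) := by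
      refine ((hφ.contDiffAt (q := (t, p)) hp0).isSymmSndFDerivAt ?_) _ _
      simp only [minSmoothness_of_isRCLikeNormedField]
      exact WithTop.coe_le_coe.2 le_top
    have hker := hR.kernel (φ t p) (hφ.mapsTo t hp) _ (hφ.linFlow_mem_tangentS3 hp t v)
    rw [hφ.linFlow_eq hp0, extD] at hker
    have hT : fderiv ℝ F (t, p) (1, 0) = R (φ t p) := by
      rw [hF, hφ.fderiv_time (q := (t, p)) hp0, flowExt_of_mem hp]
    simp only [zero_apply, add_apply, ContinuousLinearMap.comp_apply,
      ContinuousLinearMap.flip_apply, hT] at h1 h3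
    rw [hsymm] at h1
    have aux : ∀ a b c : ℝ, 0 = a + c → b - c = 0 → a + b = 0 := by intros; linarith
    refine h1.congr_deriv (aux _ _ _ h3 ?_)
    rw [hFt]
    exact hker
  have hcst := is_const_of_deriv_eq_zero (fun t => (hder t).differentiableAt)
    (fun t => (hder t).deriv) t 0
  have hΛ' : ∀ t, Λ (F (t, p)) (fderiv ℝ F (t, p) (0, v)) = lam (φ t p) (linFlow φ t p v) := by
    intro t
    rw [hFt, hφ.linFlow_eq hp0, hΛ]
    simp only [radial_of_mem (hφ.mapsTo t hp)]
    rfl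
  simp only [hΛ'] at hcst
  rw [hcst, hφ.zero p hp, hφ.linFlow_zero hp hv]

theorem IsFlowOf.linFlow_mem_contactPlane (hφ : IsFlowOf R φ) (hlam : IsContactForm lam)
    (hR : IsReebField lam R) {p v : E4} (hp : p ∈ S3) (hv : v ∈ contactPlane lam p) (t : ℝ) :
    linFlow φ t p v ∈ contactPlane lam (φ t p) := by
  refine ⟨hφ.linFlow_mem_tangentS3 hp t v, ?_⟩
  have h := hφ.lam_linFlow hlam hR hp hv.1 t
  have h2 : lam p v = 0 := hv.2
  rw [h2] at h
  exact h

theorem IsFlowOf.linFlow_ne_zero (hφ : IsFlowOf R φ) {p v : E4} (hp : p ∈ S3)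
    (hv : v ∈ tangentS3 p) (h0 : v ≠ 0) (t : ℝ) : linFlow φ t p v ≠ 0 := by
  intro h
  have := hφ.linFlow_neg_cancel hp hv t
  rw [h, linFlow, map_zero] at this
  exact h0 this.symm

end Flow

end

noncomputable section

/-! ### The contact structure and its trivialisations -/

section Contact

variable {lam : E4 → E4 →L[ℝ] ℝ} {R : E4 → E4} {φ : ℝ → E4 → E4}

theorem mem_contactPlane {p v : E4} :
    v ∈ contactPlane lam p ↔ inner ℝ p v = 0 ∧ lam p v = 0 := by
  rw [contactPlane, Submodule.mem_inf, mem_tangentS3]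
  rfl

theorem extD_swap (p v w : E4) : extD lam p v w = -extD lam p w v := by
  simp [extD]

theorem extD_self (p v : E4) : extD lam p v v = 0 := by simp [extD]

theorem extD_add_right (p v w w' : E4) :
    extD lam p v (w + w') = extD lam p v w + extD lam p v w' := by
  simp [extD]; ring

theorem extD_smul_right (p v w : E4) (r : ℝ) : extD lam p v (r • w) = r * extD lam p v w := by
  simp [extD]; ring

theorem linearIndependent_three {M : Type*} [AddCommGroup M] [Module ℝ M] {u v w : M}
    (h : ∀ a b c : ℝ, a • u + b • v + c • w = 0 → a = 0 ∧ b = 0 ∧ c = 0) :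
    LinearIndependent ℝ ![u, v, w] := by
  rw [Fintype.linearIndependent_iff]
  intro g hg
  simp only [Fin.sum_univ_three, Matrix.cons_val_zero, Matrix.cons_val_one,
    Matrix.cons_val_two, Matrix.tail_cons, Matrix.head_cons] at hg
  obtain ⟨h0, h1, h2⟩ := h _ _ _ hg
  intro i
  fin_cases i <;> assumption

/-- In the volume form evaluated on `R p, o, e` the other two terms vanish, leaving exactly `d lam
(o, e)`. -/
theorem IsContactForm.extD_ne_zero (hlam : IsContactForm lam) (hR : IsReebField lam R) {p o e : E4}
    (hp : p ∈ S3) (ho : o ∈ contactPlane lam p) (he : e ∈ tangentS3 p)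
    (hli : LinearIndependent ℝ ![R p, o, e]) : extD lam p o e ≠ 0 := by
  have h := hlam.volume p hp _ (hR.tangent p hp) _ ho.1 _ he hli
  have h1 : lam p o = 0 := ho.2
  rwa [hR.normalised p hp, h1, hR.kernel p hp _ ho.1, zero_mul, mul_zero, add_zero, add_zero,
    one_mul] at h

theorem IsContactForm.exists_extD_ne_zero (hlam : IsContactForm lam) (hR : IsReebField lam R)
    {p v : E4} (hp : p ∈ S3) (hv : v ∈ contactPlane lam p) (h0 : v ≠ 0) :
    ∃ w ∈ contactPlane lam p, extD lam p v w ≠ 0 := by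
  -- Three linear conditions on `ℝ⁴` leave a nonzero vector that is tangent, in the kernel of `lam`,
  -- and orthogonal to `v`, so `R p, v, w` are independent.
  let N : E4 →ₗ[ℝ] (Fin 3 → ℝ) := LinearMap.pi
    ![(innerSL ℝ p : E4 →ₗ[ℝ] ℝ), (lam p : E4 →ₗ[ℝ] ℝ), (innerSL ℝ v : E4 →ₗ[ℝ] ℝ)]
  have hN := LinearMap.ker_ne_bot_of_finrank_lt (f := N) (by simp)
  obtain ⟨w, hw, hw0⟩ := Submodule.exists_mem_ne_zero_of_ne_bot hN
  have hw' : N w = 0 := hw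
  have e0 : inner ℝ p w = 0 := congrFun hw' 0
  have e1 : lam p w = 0 := congrFun hw' 1
  have e2 : inner ℝ v w = 0 := congrFun hw' 2
  have hwξ : w ∈ contactPlane lam p := mem_contactPlane.2 ⟨e0, e1⟩
  refine ⟨w, hwξ, hlam.extD_ne_zero hR hp hv hwξ.1 (linearIndependent_three ?_)⟩
  intro a b c h
  have ha : a = 0 := by
    have := congrArg (lam p) h
    simpa [hR.normalised p hp, (mem_contactPlane.1 hv).2, e1] using this
  subst ha
  have hb : b = 0 := by
    have := congrArg (inner ℝ v) h
    simpa [inner_add_right, inner_smul_right, e2, h0] using this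
  subst hb
  exact ⟨rfl, rfl, by simpa [hw0] using h⟩

variable {σ σ' : E4 → E4 →L[ℝ] ℂ}

theorem IsSymplecticTrivialisation.ne_zero (hσ : IsSymplecticTrivialisation lam σ)
    (hlam : IsContactForm lam) (hR : IsReebField lam R) {p v : E4} (hp : p ∈ S3)
    (hv : v ∈ contactPlane lam p) (h0 : v ≠ 0) : σ p v ≠ 0 := by
  intro h
  obtain ⟨w, hw, hne⟩ := hlam.exists_extD_ne_zero hR hp hv h0
  exact hne (by rw [← hσ.symplectic p hp v hv w hw, h]; simp)

/-- The trivialisation `σ p`, extended to an isomorphism defined on all of `ℝ⁴`. -/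
def fullTriv (lam : E4 → E4 →L[ℝ] ℝ) (σ : E4 → E4 →L[ℝ] ℂ) (p : E4) : E4 →L[ℝ] ℂ × ℝ × ℝ :=
  (σ p).prod ((lam p).prod (innerSL ℝ p))

theorem IsSymplecticTrivialisation.isInvertible (hσ : IsSymplecticTrivialisation lam σ)
    (hlam : IsContactForm lam) (hR : IsReebField lam R) {p : E4} (hp : p ∈ S3) :
    (fullTriv lam σ p).IsInvertible := by
  have hinj : Function.Injective (fullTriv lam σ p : E4 →ₗ[ℝ] ℂ × ℝ × ℝ) := by
    rw [← LinearMap.ker_eq_bot, LinearMap.ker_eq_bot']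
    intro w hw
    have h1 : σ p w = 0 := congrArg Prod.fst hw
    have h2 : lam p w = 0 := congrArg (fun q => q.2.1) hw
    have h3 : inner ℝ p w = 0 := congrArg (fun q => q.2.2) hw
    by_contra h0
    exact hσ.ne_zero hlam hR hp (mem_contactPlane.2 ⟨h3, h2⟩) h0 h1
  exact ⟨(LinearEquiv.ofInjectiveOfFinrankEq _ hinj
    (by simp [Complex.finrank_real_complex])).toContinuousLinearEquiv, by ext1 x; rfl⟩

/-- The vector of the contact plane with coordinate `z` in the trivialisation `σ`. -/
def trivInv (lam : E4 → E4 →L[ℝ] ℝ) (σ : E4 → E4 →L[ℝ] ℂ) (p : E4) (z : ℂ) : E4 :=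
  (fullTriv lam σ p).inverse (z, 0, 0)

theorem IsSymplecticTrivialisation.trivInv_spec (hσ : IsSymplecticTrivialisation lam σ)
    (hlam : IsContactForm lam) (hR : IsReebField lam R) {p : E4} (hp : p ∈ S3) (z : ℂ) :
    trivInv lam σ p z ∈ contactPlane lam p ∧ σ p (trivInv lam σ p z) = z := by
  have h : fullTriv lam σ p (trivInv lam σ p z) = (z, 0, 0) :=
    (hσ.isInvertible hlam hR hp).self_apply_inverse _
  exact ⟨mem_contactPlane.2 ⟨congrArg (fun q => q.2.2) h, congrArg (fun q => q.2.1) h⟩,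
    congrArg Prod.fst h⟩

theorem IsSymplecticTrivialisation.continuousOn_trivInv (hσ : IsSymplecticTrivialisation lam σ)
    (hlam : IsContactForm lam) (hR : IsReebField lam R) (z : ℂ) :
    ContinuousOn (fun p => trivInv lam σ p z) S3 := by
  have h1 : ContinuousOn (fullTriv lam σ) S3 := by
    have a1 := hσ.smooth.continuousOn
    have a2 := hlam.smooth.continuousOn
    have a3 : ContinuousOn (fun p : E4 => innerSL ℝ p) S3 := (innerSL ℝ).continuous.continuousOn
    have c1 : Continuous fun q : (E4 →L[ℝ] ℝ) × (E4 →L[ℝ] ℝ) => q.1.prod q.2 :=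
      (ContinuousLinearMap.prodₗᵢ (𝕜 := ℝ) (E := E4) (F := ℝ) (G := ℝ) ℝ).continuous
    have c2 : Continuous fun q : (E4 →L[ℝ] ℂ) × (E4 →L[ℝ] ℝ × ℝ) => q.1.prod q.2 :=
      (ContinuousLinearMap.prodₗᵢ (𝕜 := ℝ) (E := E4) (F := ℂ) (G := ℝ × ℝ) ℝ).continuous
    exact c2.comp_continuousOn (a1.prodMk (c1.comp_continuousOn (a2.prodMk a3)))
  intro p hp
  have h2 : ContinuousAt ContinuousLinearMap.inverse (fullTriv lam σ p) :=
    ((hσ.isInvertible hlam hR hp).contDiffAt_map_inverse (n := 0)).continuousAt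
  exact (h2.comp_continuousWithinAt (h1 p hp)).clm_apply continuousWithinAt_const

/-- The complex linear part of the change of trivialisation from `σ` to `σ'`. -/
def transition (lam : E4 → E4 →L[ℝ] ℝ) (σ σ' : E4 → E4 →L[ℝ] ℂ) (p : E4) : ℂ :=
  (σ' p (trivInv lam σ p 1) - Complex.I * σ' p (trivInv lam σ p Complex.I)) / 2

/-- The complex antilinear part of the change of trivialisation from `σ` to `σ'`. -/
def transitionConj (lam : E4 → E4 →L[ℝ] ℝ) (σ σ' : E4 → E4 →L[ℝ] ℂ) (p : E4) : ℂ :=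
  (σ' p (trivInv lam σ p 1) + Complex.I * σ' p (trivInv lam σ p Complex.I)) / 2

/-- Every real linear map `ℂ → ℂ` is a complex linear map plus an antilinear one. -/
theorem apply_eq_transition (hσ : IsSymplecticTrivialisation lam σ)
    (hlam : IsContactForm lam) (hR : IsReebField lam R) {p v : E4} (hp : p ∈ S3)
    (hv : v ∈ contactPlane lam p) :
    σ' p v = transition lam σ σ' p * σ p v
      + transitionConj lam σ σ' p * (starRingEnd ℂ) (σ p v) := by
  obtain ⟨m1, s1⟩ := hσ.trivInv_spec hlam hR hp 1
  obtain ⟨mI, sI⟩ := hσ.trivInv_spec hlam hR hp Complex.I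
  set x := (σ p v).re
  set y := (σ p v).im
  have hz : σ p v = x + y * Complex.I := (Complex.re_add_im _).symm
  have hvv : v = x • trivInv lam σ p 1 + y • trivInv lam σ p Complex.I := by
    by_contra hne
    refine hσ.ne_zero hlam hR hp (Submodule.sub_mem _ hv (Submodule.add_mem _
      (Submodule.smul_mem _ x m1) (Submodule.smul_mem _ y mI))) (sub_ne_zero.2 hne) ?_
    rw [map_sub, map_add, map_smul, map_smul, s1, sI, hz]
    simp
  have h1 : σ' p v = x * σ' p (trivInv lam σ p 1) + y * σ' p (trivInv lam σ p Complex.I) := by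
    conv_lhs => rw [hvv]
    simp
  rw [h1, hz, transition, transitionConj]
  simp only [map_add, map_mul, Complex.conj_ofReal, Complex.conj_I]
  linear_combination ((y : ℂ) * σ' p (trivInv lam σ p Complex.I)) * Complex.I_sq

/-- The difference of the squared norms is the determinant of the change of trivialisation, which is
one because both trivialisations are symplectic. -/
theorem transition_lt (hσ : IsSymplecticTrivialisation lam σ)
    (hσ' : IsSymplecticTrivialisation lam σ')
    (hlam : IsContactForm lam) (hR : IsReebField lam R) {p : E4} (hp : p ∈ S3) :
    ‖transitionConj lam σ σ' p‖ < ‖transition lam σ σ' p‖ := by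
  obtain ⟨m1, s1⟩ := hσ.trivInv_spec hlam hR hp 1
  obtain ⟨mI, sI⟩ := hσ.trivInv_spec hlam hR hp Complex.I
  have h := (hσ'.symplectic p hp _ m1 _ mI).trans (hσ.symplectic p hp _ m1 _ mI).symm
  rw [s1, sI] at h
  rw [← sq_lt_sq₀ (norm_nonneg _) (norm_nonneg _), ← Complex.normSq_eq_norm_sq,
    ← Complex.normSq_eq_norm_sq, transition, transitionConj]
  simp only [Complex.normSq_apply, Complex.div_ofNat_re, Complex.div_ofNat_im, Complex.add_re,
    Complex.add_im, Complex.sub_re, Complex.sub_im, Complex.mul_re, Complex.mul_im, Complex.I_re,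
    Complex.I_im, Complex.conj_re, Complex.conj_im, map_one, Complex.one_re, Complex.one_im] at h ⊢
  nlinarith

theorem continuousOn_transition (hσ : IsSymplecticTrivialisation lam σ)
    (hσ' : IsSymplecticTrivialisation lam σ')
    (hlam : IsContactForm lam) (hR : IsReebField lam R) :
    ContinuousOn (transition lam σ σ') S3 := by
  have h1 := hσ'.smooth.continuousOn.clm_apply (hσ.continuousOn_trivInv hlam hR 1)
  have h2 := hσ'.smooth.continuousOn.clm_apply (hσ.continuousOn_trivInv hlam hR Complex.I)
  exact (h1.sub (continuousOn_const.mul h2)).div_const 2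

/-- Factor `σ'` along the trajectory as `transition * σ * w`. The first factor has a bounded
logarithm on the sphere, and `w` stays within distance less than one of `1`, so the principal
logarithm is continuous along it. -/
theorem exists_angleVariation_sub_le (hlam : IsContactForm lam) (hR : IsReebField lam R)
    (hφ : IsFlowOf R φ) (hσ : IsSymplecticTrivialisation lam σ)
    (hσ' : IsSymplecticTrivialisation lam σ') :
    ∃ C : ℝ, ∀ T, 0 ≤ T → ∀ x ∈ S3, ∀ v ∈ contactPlane lam x, v ≠ 0 →
      |angleVariation (fun t => σ (φ t x) (linFlow φ t x v)) 0 T -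
        angleVariation (fun t => σ' (φ t x) (linFlow φ t x v)) 0 T| ≤ C := by
  have hne : ∀ p ∈ S3, transition lam σ σ' p ≠ 0 := fun p hp => norm_pos_iff.1
    ((norm_nonneg _).trans_lt (transition_lt hσ hσ' hlam hR hp))
  obtain ⟨α, hα, hαe⟩ := exists_log_S3 (continuousOn_transition hσ hσ' hlam hR) hne
  obtain ⟨C, hC⟩ := isCompact_S3.exists_bound_of_continuousOn hα
  -- Each end point contributes at most `C` from the logarithm of `transition` and at most `π` from
  -- the argument of `w`.
  refine ⟨2 * C + 2 * Real.pi, fun T hT x hx v hv h0 => ?_⟩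
  have hmem : ∀ t, φ t x ∈ S3 := fun t => hφ.mapsTo t hx
  have hξ : ∀ t, linFlow φ t x v ∈ contactPlane lam (φ t x) := fun t =>
    hφ.linFlow_mem_contactPlane hlam hR hx hv t
  have hcont : ∀ τ : E4 → E4 →L[ℝ] ℂ, SmoothOnS3 τ →
      Continuous fun t => τ (φ t x) (linFlow φ t x v) := fun τ hτ =>
    (hτ.continuousOn.comp_continuous (hφ.continuous_left hx) hmem).clm_apply
      (hφ.continuous_linFlow hx v)
  have hz0 : ∀ t, σ (φ t x) (linFlow φ t x v) ≠ 0 := fun t =>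
    hσ.ne_zero hlam hR (hmem t) (hξ t) (hφ.linFlow_ne_zero hx hv.1 h0 t)
  obtain ⟨Z, hZ, hZe⟩ := exists_log_Icc hT (hcont σ hσ.smooth).continuousOn (fun t _ => hz0 t)
  set w : ℝ → ℂ := fun t => σ' (φ t x) (linFlow φ t x v) /
    (transition lam σ σ' (φ t x) * σ (φ t x) (linFlow φ t x v)) with hw
  have hwc : Continuous w := (hcont σ' hσ'.smooth).div
    (((continuousOn_transition hσ hσ' hlam hR).comp_continuous (hφ.continuous_left hx) hmem).mul
      (hcont σ hσ.smooth)) (fun t => mul_ne_zero (hne _ (hmem t)) (hz0 t))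
  have hwre : ∀ t, w t ∈ Complex.slitPlane := by
    intro t
    have h1 : w t = 1 + transitionConj lam σ σ' (φ t x) *
        (starRingEnd ℂ) (σ (φ t x) (linFlow φ t x v)) /
        (transition lam σ σ' (φ t x) * σ (φ t x) (linFlow φ t x v)) := by
      simp only [hw]
      rw [apply_eq_transition hσ hlam hR (hmem t) (hξ t), add_div, div_self
        (mul_ne_zero (hne _ (hmem t)) (hz0 t))]
    rw [h1]
    apply Complex.mem_slitPlane_of_norm_lt_one
    rw [norm_div, norm_mul, norm_mul, RCLike.norm_conj, mul_div_mul_right _ _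
      (norm_ne_zero_iff.2 (hz0 t)), div_lt_one (norm_pos_iff.2 (hne _ (hmem t)))]
    exact transition_lt hσ hσ' hlam hR (hmem t)
  rw [angleVariation_eq_of_exp hT hZ hZe, angleVariation_eq_of_exp
    (F := fun t => α (φ t x) + Z t + Complex.log (w t)) hT]
  · have b1 := (Complex.abs_im_le_norm _).trans (hC _ (hmem 0))
    have b2 := (Complex.abs_im_le_norm _).trans (hC _ (hmem T))
    have b3 := Complex.abs_arg_le_pi (w 0)
    have b4 := Complex.abs_arg_le_pi (w T)
    simp only [Complex.add_im, Complex.log_im]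
    rw [abs_le] at *
    constructor <;> linarith
  · exact ((hα.comp_continuous (hφ.continuous_left hx) hmem).continuousOn.add hZ).add
      (hwc.clog hwre).continuousOn
  · intro t ht
    rw [Complex.exp_add, Complex.exp_add, ← hαe _ (hmem t), ← hZe t ht, Complex.exp_log
      (Complex.slitPlane_ne_zero (hwre t)), hw]
    exact (mul_div_cancel₀ _ (mul_ne_zero (hne _ (hmem t)) (hz0 t))).symm

end Contact

end

noncomputable section

/-! ### Embedded disks -/

section Disk

variable {lam : E4 → E4 →L[ℝ] ℝ} {R : E4 → E4} {φ : ℝ → E4 → E4} {u : ℂ → E4} {K : Set E4}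

theorem IsEmbeddedDisk.mem_S3 (hu : IsEmbeddedDisk u) {z : ℂ} (hz : z ∈ Metric.closedBall (0 : ℂ) 1) :
    u z ∈ S3 := hu.mapsTo hz

theorem IsEmbeddedDisk.hasFDerivAt (hu : IsEmbeddedDisk u) (z : ℂ) :
    HasFDerivAt u (fderiv ℝ u z) z :=
  (hu.smooth.contDiffAt.differentiableAt (by simp)).hasFDerivAt

theorem IsEmbeddedDisk.isCompact_disk (hu : IsEmbeddedDisk u) : IsCompact (disk u) :=
  (isCompact_closedBall 0 1).image hu.smooth.continuous

/-- A continuous injection from a compact space to a Hausdorff one is a closed embedding, so the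
topology of the closed disk is induced by `u`. -/
theorem IsEmbeddedDisk.tendsto_of_apply (hu : IsEmbeddedDisk u) {z : ℂ}
    (hz : z ∈ Metric.closedBall (0 : ℂ) 1) :
    comap u (𝓝 (u z)) ⊓ 𝓟 (Metric.closedBall 0 1) ≤ 𝓝 z := by
  have : CompactSpace (Metric.closedBall (0 : ℂ) 1) :=
    isCompact_iff_compactSpace.1 (isCompact_closedBall 0 1)
  have h1 : Topology.IsClosedEmbedding (fun w : Metric.closedBall (0 : ℂ) 1 => u w) :=
    (hu.smooth.continuous.comp continuous_subtype_val).isClosedEmbedding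
      (injOn_iff_injective.1 hu.injOn)
  have h2 := h1.isInducing.nhds_eq_comap ⟨z, hz⟩
  have h3 : map Subtype.val (𝓝 (⟨z, hz⟩ : Metric.closedBall (0 : ℂ) 1)) ≤ 𝓝 z :=
    continuous_subtype_val.tendsto (⟨z, hz⟩ : Metric.closedBall (0 : ℂ) 1)
  refine le_trans ?_ h3
  rw [h2, ← Function.comp_def u Subtype.val, ← comap_comap, Filter.map_comap, Subtype.range_coe]

/-- If a point of the disk is close to `u z`, then its coordinate is close to `z`. -/
theorem IsEmbeddedDisk.eventually_of_apply (hu : IsEmbeddedDisk u) {z : ℂ}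
    (hz : z ∈ Metric.closedBall (0 : ℂ) 1) {P : ℂ → Prop} (hP : ∀ᶠ w in 𝓝 z, P w) :
    ∀ᶠ y in 𝓝 (u z), ∀ w ∈ Metric.closedBall (0 : ℂ) 1, u w = y → P w := by
  have h1 := hu.tendsto_of_apply hz hP
  rw [mem_inf_principal, mem_comap] at h1
  obtain ⟨V, hV, h⟩ := h1
  filter_upwards [hV] with y hy w hw e
  exact h (show u w ∈ V by rwa [e]) hw

/-- At interior points differentiate `‖u‖ = 1`. On the boundary circle only one side of `u` lies in
the sphere, so the relation is extended by continuity. -/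
theorem IsEmbeddedDisk.fderiv_mem_tangentS3 (hu : IsEmbeddedDisk u) {z : ℂ}
    (hz : z ∈ Metric.closedBall (0 : ℂ) 1) (a : ℂ) : fderiv ℝ u z a ∈ tangentS3 (u z) := by
  rw [mem_tangentS3]
  have hc : Continuous fun z => inner ℝ (u z) (fderiv ℝ u z a) :=
    hu.smooth.continuous.inner ((hu.smooth.continuous_fderiv (by simp)).clm_apply continuous_const)
  have hball : ∀ w ∈ Metric.ball (0 : ℂ) 1, inner ℝ (u w) (fderiv ℝ u w a) = 0 := by
    intro w hw
    have h1 : HasDerivAt (fun s : ℝ => w + s • a) a 0 := by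
      have := ((hasDerivAt_id (0 : ℝ)).smul_const a).const_add w
      simpa using this
    have h2 : HasDerivAt (fun s : ℝ => u (w + s • a)) (fderiv ℝ u w a) 0 :=
      HasFDerivAt.comp_hasDerivAt (l := u) (f := fun s : ℝ => w + s • a) 0
        (by simpa using hu.hasFDerivAt w) h1
    have h3 := inner_eq_zero_of_hasDerivAt h2 ?_
    · simpa using h3
    · have h4 : ∀ᶠ s : ℝ in 𝓝 0, w + s • a ∈ Metric.ball (0 : ℂ) 1 :=
        h1.continuousAt.eventually_mem (Metric.isOpen_ball.mem_nhds (by simpa using hw))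
      filter_upwards [h4] with s hs
      exact hu.mapsTo (Metric.ball_subset_closedBall hs)
  have hcl : IsClosed {w : ℂ | inner ℝ (u w) (fderiv ℝ u w a) = 0} :=
    isClosed_eq hc continuous_const
  rw [← closure_ball (0 : ℂ) one_ne_zero] at hz
  exact closure_minimal hball hcl hz

/-- A linear map `(a, s, r) ↦ A a + s e + r q`, with `q` normal to `e` and to the range of `A`, and
`e` not in the range of `A`, is an isomorphism. -/
theorem exists_equiv_of_normal {A : ℂ →L[ℝ] E4} {e q : E4} (hA : Function.Injective A)
    (hq : q ≠ 0) (hAq : ∀ a, inner ℝ q (A a) = 0) (heq : inner ℝ q e = 0) (he : e ∉ range A) :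
    ∃ D : (ℂ × ℝ × ℝ) ≃L[ℝ] E4, ∀ x, D x = A x.1 + x.2.1 • e + x.2.2 • q := by
  let N : (ℂ × ℝ × ℝ) →ₗ[ℝ] E4 :=
    (A : ℂ →ₗ[ℝ] E4).coprod ((LinearMap.toSpanSingleton ℝ E4 e).coprod
      (LinearMap.toSpanSingleton ℝ E4 q))
  have hN : ∀ x, N x = A x.1 + x.2.1 • e + x.2.2 • q := by
    intro x
    simp [N, add_assoc]
  have hinj : Function.Injective N := by
    rw [← LinearMap.ker_eq_bot, LinearMap.ker_eq_bot']
    rintro ⟨a, s, r⟩ h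
    rw [hN] at h
    simp only at h
    have hr : r = 0 := by
      have := congrArg (inner ℝ q) h
      simpa [inner_add_right, inner_smul_right, hAq, heq, hq] using this
    subst hr
    have hs : s = 0 := by
      by_contra hs
      refine he ⟨-s⁻¹ • a, ?_⟩
      have h2 : A a = -(s • e) := by
        rw [eq_neg_iff_add_eq_zero]; simpa using h
      rw [map_smul, h2, smul_neg, neg_smul, neg_neg, smul_smul, inv_mul_cancel₀ hs, one_smul]
    subst hs
    have ha : a = 0 := hA (by simpa using h)
    simp [ha]
  exact ⟨(LinearEquiv.ofInjectiveOfFinrankEq N hinj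
    (by simp [Complex.finrank_real_complex])).toContinuousLinearEquiv, hN⟩

/-- Removes the auxiliary radial coordinate of the charts below: at points of the sphere it
vanishes. -/
theorem eq_of_norm_smul {y y' : E4} {r : ℝ} (hy : y ∈ S3) (hy' : y' ∈ S3) (hr : -1 < r)
    (h : (1 + r) • y' = y) : y' = y := by
  have h1 := congrArg norm h
  rw [norm_smul, mem_S3.1 hy, mem_S3.1 hy', mul_one, Real.norm_eq_abs,
    abs_of_pos (by linarith)] at h1
  rwa [h1, one_smul] at h

/-- Near an interior point of the disk, the flow gives coordinates on the sphere. -/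
theorem IsDiskGSS.exists_section (hφ : IsFlowOf R φ) (hR : ∀ p ∈ S3, R p ∈ tangentS3 p)
    (hu : IsDiskGSS R φ K u) {z₁ : ℂ} (hz₁ : z₁ ∈ Metric.ball (0 : ℂ) 1) :
    ∃ (Z : E4 → ℂ) (T : E4 → ℝ), ContinuousAt Z (u z₁) ∧ ContinuousAt T (u z₁) ∧
      Z (u z₁) = z₁ ∧ T (u z₁) = 0 ∧
      (∀ᶠ y in 𝓝 (u z₁), y ∈ S3 → φ (T y) (u (Z y)) = y) ∧
      ∀ᶠ q : ℂ × ℝ in 𝓝 (z₁, 0), Z (φ q.2 (u q.1)) = q.1 ∧ T (φ q.2 (u q.1)) = q.2 := by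
  have hcb := Metric.ball_subset_closedBall hz₁
  have hS : u z₁ ∈ S3 := hu.embedded.mapsTo hcb
  have hS0 := S3_ne_zero hS
  obtain ⟨D, hD⟩ := exists_equiv_of_normal (hu.embedded.immersion z₁ hcb) hS0
    (fun a => mem_tangentS3.1 (hu.embedded.fderiv_mem_tangentS3 hcb a))
    (mem_tangentS3.1 (hR _ hS)) (hu.transverse z₁ hz₁)
  -- The radial factor makes this a map between spaces of dimension four, so that the inverse
  -- function theorem applies; its derivative is invertible because `R` is transverse to the disk.
  let G : ℂ × ℝ × ℝ → E4 := fun x => (1 + x.2.2) • flowExt φ (x.2.1, u x.1)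
  have hG0 : G (z₁, 0, 0) = u z₁ := by
    simp [G, flowExt_of_mem hS, hφ.zero _ hS]
  have hin : ContDiffAt ℝ ∞ (fun x : ℂ × ℝ × ℝ => (x.2.1, u x.1)) (z₁, 0, 0) := by
    have := hu.embedded.smooth
    fun_prop
  have hGc : ContDiffAt ℝ ∞ G (z₁, 0, 0) := by
    have h1 : ContDiffAt ℝ ∞ (fun x : ℂ × ℝ × ℝ => flowExt φ (x.2.1, u x.1)) (z₁, 0, 0) :=
      ContDiffAt.comp (g := flowExt φ) (f := fun x : ℂ × ℝ × ℝ => (x.2.1, u x.1)) _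
        (hφ.contDiffAt (q := (0, u z₁)) hS0) hin
    exact ContDiffAt.smul (contDiffAt_const.add contDiffAt_snd.snd) h1
  have hGd : HasFDerivAt G (D : (ℂ × ℝ × ℝ) →L[ℝ] E4) (z₁, 0, 0) := by
    have h1 : HasFDerivAt (fun x : ℂ × ℝ × ℝ => ((x.2.1, u x.1) : ℝ × E4)) _ (z₁, 0, 0) :=
      (((ContinuousLinearMap.fst ℝ ℝ ℝ).comp (ContinuousLinearMap.snd ℝ ℂ (ℝ × ℝ))).hasFDerivAt
        (x := (z₁, 0, 0))).prodMk ((hu.embedded.hasFDerivAt z₁).comp (z₁, (0 : ℝ), (0 : ℝ))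
          (ContinuousLinearMap.fst ℝ ℂ (ℝ × ℝ)).hasFDerivAt)
    have h2 := (hφ.hasFDerivAt (q := (0, u z₁)) hS0).comp
      (f := fun x : ℂ × ℝ × ℝ => ((x.2.1, u x.1) : ℝ × E4)) (z₁, (0 : ℝ), (0 : ℝ)) h1
    have h3 := ((((ContinuousLinearMap.snd ℝ ℝ ℝ).comp
      (ContinuousLinearMap.snd ℝ ℂ (ℝ × ℝ))).hasFDerivAt (x := (z₁, 0, 0))).const_add 1).smul h2
    refine h3.congr_fderiv (ContinuousLinearMap.ext fun x => ?_)
    rw [ContinuousLinearEquiv.coe_coe, hD]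
    have e1 : fderiv ℝ (flowExt φ) (0, u z₁) (x.2.1, fderiv ℝ u z₁ x.1) =
        x.2.1 • R (u z₁) + fderiv ℝ u z₁ x.1 := by
      have : ((x.2.1, fderiv ℝ u z₁ x.1) : ℝ × E4) =
          x.2.1 • ((1 : ℝ), (0 : E4)) + (0, fderiv ℝ u z₁ x.1) := by simp
      rw [this, map_add, map_smul, hφ.fderiv_time (q := (0, u z₁)) hS0, ← hφ.linFlow_eq hS0,
        hφ.linFlow_zero hS (hu.embedded.fderiv_mem_tangentS3 hcb _), flowExt_of_mem hS,
        hφ.zero _ hS]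
    simp [flowExt_of_mem hS, hφ.zero _ hS, e1]
    abel
  have hs : HasStrictFDerivAt G (D : (ℂ × ℝ × ℝ) →L[ℝ] E4) (z₁, 0, 0) :=
    hGc.hasStrictFDerivAt' hGd (by simp)
  have hgc := hs.localInverse_continuousAt
  have hga : hs.localInverse G D (z₁, 0, 0) (u z₁) = (z₁, 0, 0) := by
    rw [← hG0]; exact hs.localInverse_apply_image
  have hr := hs.eventually_right_inverse
  have hl := hs.eventually_left_inverse
  set g := hs.localInverse G D (z₁, 0, 0)
  rw [hG0] at hgc hr
  have c1 : ContinuousAt (fun y => (g y).1) (u z₁) := hgc.fst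
  refine ⟨fun y => (g y).1, fun y => (g y).2.1, c1, hgc.snd.fst, by simp [hga], by simp [hga],
    ?_, ?_⟩
  · have c3 : ContinuousAt (fun y => (g y).2.2) (u z₁) := hgc.snd.snd
    have e1 : ∀ᶠ y in 𝓝 (u z₁), (g y).1 ∈ Metric.ball (0 : ℂ) 1 :=
      c1.eventually_mem (Metric.isOpen_ball.mem_nhds (by simpa [hga] using hz₁))
    have e2 : ∀ᶠ y in 𝓝 (u z₁), (g y).2.2 ∈ Ioi (-1 : ℝ) :=
      c3.eventually_mem (isOpen_Ioi.mem_nhds (by simp [hga]))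
    filter_upwards [e1, e2, hr] with y h1 h2 h3 hy
    have hm := hu.embedded.mapsTo (Metric.ball_subset_closedBall h1)
    have h4 : (1 + (g y).2.2) • φ (g y).2.1 (u (g y).1) = y := by
      rw [← flowExt_of_mem (φ := φ) (t := (g y).2.1) hm]; exact h3
    exact eq_of_norm_smul hy (hφ.mapsTo _ hm) h2 h4
  · have ht : Tendsto (fun q : ℂ × ℝ => ((q.1, q.2, 0) : ℂ × ℝ × ℝ)) (𝓝 (z₁, 0))
        (𝓝 (z₁, 0, 0)) := Continuous.tendsto (by fun_prop) (z₁, (0 : ℝ))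
    have e1 : ∀ᶠ q : ℂ × ℝ in 𝓝 (z₁, 0), q.1 ∈ Metric.ball (0 : ℂ) 1 :=
      continuousAt_fst.eventually_mem (Metric.isOpen_ball.mem_nhds hz₁)
    filter_upwards [ht.eventually hl, e1] with q h1 h2
    have hm := hu.embedded.mapsTo (Metric.ball_subset_closedBall h2)
    have h3 : G (q.1, q.2, 0) = φ q.2 (u q.1) := by
      simp [G, flowExt_of_mem hm]
    rw [h3] at h1
    simp [h1]

/-! ### Hitting times of the disk -/

theorem IsDiskGSS.continuousAt_flow (hφ : IsFlowOf R φ) (hu : IsDiskGSS R φ K u) {q : ℂ × ℝ}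
    (hq : q.1 ∈ Metric.ball (0 : ℂ) 1) : ContinuousAt (fun q : ℂ × ℝ => φ q.2 (u q.1)) q := by
  have h1 : ContinuousOn (fun q : ℂ × ℝ => φ q.2 (u q.1)) (Metric.ball 0 1 ×ˢ univ) :=
    hφ.continuousOn.comp (f := fun q : ℂ × ℝ => (q.2, u q.1))
      (by have := hu.embedded.smooth.continuous; fun_prop)
      (fun q hq => ⟨mem_univ _, hu.embedded.mapsTo (Metric.ball_subset_closedBall hq.1)⟩)
  exact h1.continuousAt ((Metric.isOpen_ball.prod isOpen_univ).mem_nhds ⟨hq, mem_univ _⟩)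

/-- Near a hitting time of the interior of the disk, the hitting times form a graph. -/
theorem IsDiskGSS.exists_hitting (hφ : IsFlowOf R φ) (hR : ∀ p ∈ S3, R p ∈ tangentS3 p)
    (hu : IsDiskGSS R φ K u) {z z₁ : ℂ} {t₀ : ℝ} (hz : z ∈ Metric.ball (0 : ℂ) 1)
    (hz₁ : z₁ ∈ Metric.ball (0 : ℂ) 1) (h : φ t₀ (u z) = u z₁) :
    ∃ (s : ℂ → ℝ) (ψ : ℂ → ℂ), ContinuousAt s z ∧ s z = t₀ ∧ ContinuousAt ψ z ∧ ψ z = z₁ ∧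
      (∀ᶠ w in 𝓝 z, φ (s w) (u w) = u (ψ w)) ∧
      ∀ᶠ q : ℂ × ℝ in 𝓝 (z, t₀), φ q.2 (u q.1) ∈ disk u → q.2 = s q.1 := by
  obtain ⟨Z, T, hZ, hT, hZ1, hT1, hr, hl⟩ := hu.exists_section hφ hR hz₁
  have hc : ContinuousAt (fun w => φ t₀ (u w)) z :=
    ContinuousAt.comp (f := fun w => (w, t₀)) (hu.continuousAt_flow hφ (q := (z, t₀)) hz)
      (by fun_prop)
  have hc' : Tendsto (fun w => φ t₀ (u w)) (𝓝 z) (𝓝 (u z₁)) := by rw [← h]; exact hc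
  have hbz : ∀ᶠ w in 𝓝 z, w ∈ Metric.ball (0 : ℂ) 1 := Metric.isOpen_ball.mem_nhds hz
  have hZc : ContinuousAt (fun w => Z (φ t₀ (u w))) z :=
    ContinuousAt.comp (g := Z) (f := fun w => φ t₀ (u w)) (by rw [h]; exact hZ) hc
  have hTc : ContinuousAt (fun w => T (φ t₀ (u w))) z :=
    ContinuousAt.comp (g := T) (f := fun w => φ t₀ (u w)) (by rw [h]; exact hT) hc
  -- In the flow chart, `φ t₀ (u w)` lies at time `T` past the disk, so the hit occurs `T` earlier
  -- than `t₀`.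
  refine ⟨fun w => t₀ - T (φ t₀ (u w)), fun w => Z (φ t₀ (u w)), continuousAt_const.sub hTc,
    by simp [h, hT1], hZc, by simp [h, hZ1], ?_, ?_⟩
  · have e1 : ∀ᶠ w in 𝓝 z, Z (φ t₀ (u w)) ∈ Metric.ball (0 : ℂ) 1 :=
      hZc.eventually_mem (Metric.isOpen_ball.mem_nhds (by simpa [h, hZ1] using hz₁))
    filter_upwards [hc'.eventually hr, e1, hbz] with w h1 h2 h3
    have hm := hu.embedded.mapsTo (Metric.ball_subset_closedBall h3)
    have hm2 := hu.embedded.mapsTo (Metric.ball_subset_closedBall h2)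
    have h4 := h1 (hφ.mapsTo _ hm)
    rw [sub_eq_neg_add, hφ.add hm]
    have h5 := hφ.neg_cancel hm2 (T (φ t₀ (u w)))
    rwa [h4] at h5
  · have hc2 : Tendsto (fun q : ℂ × ℝ => φ q.2 (u q.1)) (𝓝 (z, t₀)) (𝓝 (u z₁)) := by
      rw [← h]; exact hu.continuousAt_flow hφ (q := (z, t₀)) hz
    rw [nhds_prod_eq, eventually_prod_iff] at hl
    obtain ⟨P, hP, Q, hQ, hPQ⟩ := hl
    -- Embeddedness enters here: a hit close to `u z₁` has its disk coordinate close to `z₁`, so no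
    -- other sheet of the disk interferes.
    have e1 := hc2.eventually (hu.embedded.eventually_of_apply
      (Metric.ball_subset_closedBall hz₁) hP)
    have e2 : ∀ᶠ q : ℂ × ℝ in 𝓝 (z, t₀), Q (t₀ - q.2) := by
      have : Tendsto (fun q : ℂ × ℝ => t₀ - q.2) (𝓝 (z, t₀)) (𝓝 0) :=
        Continuous.tendsto' (by fun_prop) _ _ (by simp)
      exact this.eventually hQ
    have e3 : ∀ᶠ q : ℂ × ℝ in 𝓝 (z, t₀), q.1 ∈ Metric.ball (0 : ℂ) 1 :=
      continuousAt_fst.eventually_mem (Metric.isOpen_ball.mem_nhds hz)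
    filter_upwards [e1, e2, e3] with q h1 h2 h3
    rintro ⟨w, hw, e⟩
    have hm := hu.embedded.mapsTo (Metric.ball_subset_closedBall h3)
    have h4 := (hPQ (h1 w hw e) h2).2
    simp only at h4
    rw [e, ← hφ.add hm, sub_add_cancel] at h4
    linarith

/-- The hitting times near zero form a graph, and time zero itself is a hitting time, so that graph
is zero. -/
theorem IsDiskGSS.eventually_hit_eq_zero (hφ : IsFlowOf R φ) (hR : ∀ p ∈ S3, R p ∈ tangentS3 p)
    (hu : IsDiskGSS R φ K u) {z : ℂ} (hz : z ∈ Metric.ball (0 : ℂ) 1) :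
    ∀ᶠ q : ℂ × ℝ in 𝓝 (z, 0), φ q.2 (u q.1) ∈ disk u → q.2 = 0 := by
  obtain ⟨s, ψ, -, -, -, -, -, h⟩ := hu.exists_hitting hφ hR hz hz
    (hφ.zero _ (hu.embedded.mapsTo (Metric.ball_subset_closedBall hz)))
  have ht : Tendsto (fun q : ℂ × ℝ => (q.1, (0 : ℝ))) (𝓝 (z, 0)) (𝓝 (z, 0)) :=
    Continuous.tendsto (by fun_prop) (z, (0 : ℝ))
  have e3 : ∀ᶠ q : ℂ × ℝ in 𝓝 (z, 0), q.1 ∈ Metric.ball (0 : ℂ) 1 :=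
      continuousAt_fst.eventually_mem (Metric.isOpen_ball.mem_nhds hz)
  filter_upwards [h, ht.eventually h, e3] with q h1 h2 h3 h4
  have hm := Metric.ball_subset_closedBall h3
  rw [h1 h4]
  exact (h2 (by rw [hφ.zero _ (hu.embedded.mapsTo hm)]; exact mem_image_of_mem u hm)).symm

end Disk

end

noncomputable section

/-! ### The first return map -/

section Return

variable {lam : E4 → E4 →L[ℝ] ℝ} {R : E4 → E4} {φ : ℝ → E4 → E4} {u : ℂ → E4} {p₀ : E4}

theorem orbit_subset_S3 (hφ : IsFlowOf R φ) (hp : p₀ ∈ S3) : orbit φ p₀ ⊆ S3 := by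
  rintro _ ⟨t, rfl⟩
  exact hφ.mapsTo t hp

theorem flow_mem_orbit (hφ : IsFlowOf R φ) (hp : p₀ ∈ S3) {x : E4} (hx : x ∈ orbit φ p₀) (t : ℝ) :
    φ t x ∈ orbit φ p₀ := by
  obtain ⟨s, rfl⟩ := hx
  exact ⟨t + s, hφ.add hp t s⟩

theorem flow_mem_compl_orbit (hφ : IsFlowOf R φ) (hp : p₀ ∈ S3) {x : E4}
    (hx : x ∈ S3 \ orbit φ p₀) (t : ℝ) : φ t x ∈ S3 \ orbit φ p₀ := by
  refine ⟨hφ.mapsTo t hx.1, fun h => hx.2 ?_⟩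
  rw [← hφ.neg_cancel hx.1 t]
  exact flow_mem_orbit hφ hp h _

theorem IsDiskGSS.apply_mem_compl {K : Set E4} (hu : IsDiskGSS R φ K u) {z : ℂ}
    (hz : z ∈ Metric.ball (0 : ℂ) 1) : u z ∈ S3 \ K := by
  have hm := Metric.ball_subset_closedBall hz
  refine ⟨hu.embedded.mapsTo hm, fun h => ?_⟩
  rw [← hu.boundary] at h
  obtain ⟨w, hw, e⟩ := h
  have := hu.embedded.injOn (Metric.sphere_subset_closedBall hw) hm e
  subst this
  rw [mem_sphere_iff_norm] at hw
  rw [mem_ball_iff_norm] at hz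
  linarith

theorem IsDiskGSS.mem_diskInterior {K : Set E4} (hu : IsDiskGSS R φ K u) {x : E4} (hx : x ∉ K)
    (h : x ∈ disk u) : x ∈ diskInterior u := by
  obtain ⟨z, hz, rfl⟩ := h
  refine ⟨z, ?_, rfl⟩
  rw [mem_closedBall_iff_norm] at hz
  rw [mem_ball_iff_norm]
  refine lt_of_le_of_ne hz fun h => hx ?_
  rw [← hu.boundary]
  exact ⟨z, by rwa [mem_sphere_iff_norm], rfl⟩

/-- The trajectory of `u z` returns to the disk for the first time at time `t`, at the point
`u w`. -/
structure IsFirstReturn (φ : ℝ → E4 → E4) (u : ℂ → E4) (z : ℂ) (t : ℝ) (w : ℂ) : Prop where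
  pos : 0 < t
  mem : w ∈ Metric.ball (0 : ℂ) 1
  apply_eq : φ t (u z) = u w
  not_mem : ∀ s ∈ Ioo 0 t, φ s (u z) ∉ disk u

theorem IsFirstReturn.unique (hu : IsEmbeddedDisk u) {z w w' : ℂ} {t t' : ℝ}
    (h : IsFirstReturn φ u z t w) (h' : IsFirstReturn φ u z t' w') : t = t' ∧ w = w' := by
  have d : φ t (u z) ∈ disk u := by
    rw [h.apply_eq]; exact mem_image_of_mem u (Metric.ball_subset_closedBall h.mem)
  have d' : φ t' (u z) ∈ disk u := by
    rw [h'.apply_eq]; exact mem_image_of_mem u (Metric.ball_subset_closedBall h'.mem)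
  have ht : t = t' := by
    rcases lt_trichotomy t t' with hlt | he | hlt
    · exact (h'.not_mem t ⟨h.pos, hlt⟩ d).elim
    · exact he
    · exact (h.not_mem t' ⟨h'.pos, hlt⟩ d').elim
  subst ht
  exact ⟨rfl, hu.injOn (Metric.ball_subset_closedBall h.mem)
    (Metric.ball_subset_closedBall h'.mem) (h.apply_eq.symm.trans h'.apply_eq)⟩

variable (hφ : IsFlowOf R φ) (hR : ∀ p ∈ S3, R p ∈ tangentS3 p) (hp₀ : p₀ ∈ S3)
  (hu : IsDiskGSS R φ (orbit φ p₀) u)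

include hφ hR hp₀ hu

/-- The hitting times form a closed set and, by transversality, zero is isolated among them, so
there is a least positive one. The hit is in the interior because the trajectory never meets the
boundary orbit. -/
theorem exists_isFirstReturn {z : ℂ} (hz : z ∈ Metric.ball (0 : ℂ) 1) :
    ∃ t w, IsFirstReturn φ u z t w := by
  have hm := hu.apply_mem_compl hz
  have h0 := hu.eventually_hit_eq_zero hφ hR hz
  have h1 : ∀ᶠ t : ℝ in 𝓝 0, φ t (u z) ∈ disk u → t = 0 :=
    (Continuous.tendsto' (f := fun t : ℝ => (z, t)) (by fun_prop) _ _ rfl).eventually h0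
  obtain ⟨ε, hε, h2⟩ := Metric.eventually_nhds_iff.1 h1
  obtain ⟨t₁, ht₁, hd⟩ := hu.hits_pos (u z) hm.1
  have hcl : IsClosed {t : ℝ | φ t (u z) ∈ disk u} :=
    hu.embedded.isCompact_disk.isClosed.preimage (hφ.continuous_left hm.1)
  have hεle : ∀ t > 0, φ t (u z) ∈ disk u → ε ≤ t := by
    intro t ht h
    by_contra! hlt
    exact ht.ne' (h2 (by rw [Real.dist_eq, sub_zero, abs_of_pos ht]; exact hlt) h)
  obtain ⟨t, ⟨ht, ht'⟩, hmin⟩ := (isCompact_Icc.inter_right hcl).exists_isLeast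
    (s := Icc ε t₁ ∩ {t : ℝ | φ t (u z) ∈ disk u}) ⟨t₁, ⟨hεle t₁ ht₁ hd, le_rfl⟩, hd⟩
  obtain ⟨w, hw, e⟩ := hu.mem_diskInterior (flow_mem_compl_orbit hφ hp₀ hm t).2 ht'
  refine ⟨t, w, hε.trans_le ht.1, hw, e.symm, fun s hs hsd => ?_⟩
  exact absurd (hmin ⟨⟨hεle s hs.1 hsd, hs.2.le.trans ht.2⟩, hsd⟩) (not_le.2 hs.2)

omit hp₀ in
-- The nearby hit persists by transversality. That no earlier hit appears is a compactness argument
-- over the elapsed fraction of the return time.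
theorem eventually_isFirstReturn {z w : ℂ} {t : ℝ} (hz : z ∈ Metric.ball (0 : ℂ) 1)
    (h : IsFirstReturn φ u z t w) :
    ∃ (s : ℂ → ℝ) (ψ : ℂ → ℂ), ContinuousAt s z ∧ ContinuousAt ψ z ∧
      ∀ᶠ z' in 𝓝 z, IsFirstReturn φ u z' (s z') (ψ z') := by
  obtain ⟨s, ψ, hs, hsz, hψ, hψz, he, hg⟩ := hu.exists_hitting hφ hR hz h.mem h.apply_eq
  refine ⟨s, ψ, hs, hψ, ?_⟩
  have e1 : ∀ᶠ z' in 𝓝 z, s z' ∈ Ioi (0 : ℝ) :=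
    hs.eventually_mem (isOpen_Ioi.mem_nhds (by rw [hsz]; exact h.pos))
  have e2 : ∀ᶠ z' in 𝓝 z, ψ z' ∈ Metric.ball (0 : ℂ) 1 :=
    hψ.eventually_mem (Metric.isOpen_ball.mem_nhds (by rw [hψz]; exact h.mem))
  -- Time is rescaled by `s`, so that the interval is the same for all starting points. The end
  -- points use the two graph descriptions of hitting times, the interior uses that the disk is
  -- closed.
  have key : ∀ r ∈ Icc (0 : ℝ) 1, ∀ᶠ q : ℂ × ℝ in 𝓝 (z, r),
      φ (q.2 * s q.1) (u q.1) ∈ disk u → q.2 * s q.1 = 0 ∨ q.2 * s q.1 = s q.1 := by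
    intro r hr
    have hc : Tendsto (fun q : ℂ × ℝ => (q.1, q.2 * s q.1)) (𝓝 (z, r)) (𝓝 (z, r * t)) := by
      have h1 : ContinuousAt (fun q : ℂ × ℝ => s q.1) (z, r) :=
        ContinuousAt.comp (g := s) (f := Prod.fst) hs continuousAt_fst
      have h2 := (continuousAt_fst (p := (z, r))).prodMk
        ((continuousAt_snd (p := (z, r))).mul h1)
      rw [← hsz]
      exact h2
    rcases hr.1.eq_or_lt with rfl | hr0
    · rw [zero_mul] at hc
      filter_upwards [hc.eventually (hu.eventually_hit_eq_zero hφ hR hz)] with q hq hd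
      exact Or.inl (hq hd)
    rcases hr.2.eq_or_lt with rfl | hr1
    · rw [one_mul] at hc
      filter_upwards [hc.eventually hg] with q hq hd
      exact Or.inr (hq hd)
    · have h3 := h.not_mem (r * t) ⟨mul_pos hr0 h.pos, by nlinarith [h.pos]⟩
      have h4 : ∀ᶠ q : ℂ × ℝ in 𝓝 (z, r * t), φ q.2 (u q.1) ∈ (disk u)ᶜ :=
        (hu.continuousAt_flow hφ (q := (z, r * t)) hz).eventually_mem
          (hu.embedded.isCompact_disk.isClosed.isOpen_compl.mem_nhds h3)
      filter_upwards [hc.eventually h4] with q hq hd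
      exact (hq hd).elim
  have e3 := (isCompact_Icc (a := (0 : ℝ)) (b := 1)).eventually_forall_of_forall_eventually
    (x₀ := z) (P := fun z' r =>
      φ (r * s z') (u z') ∈ disk u → r * s z' = 0 ∨ r * s z' = s z') key
  filter_upwards [e1, e2, e3, he] with z' h1 h2 h3 h4
  have h1' : 0 < s z' := h1
  refine ⟨h1', h2, h4, fun r hr hd => ?_⟩
  have hrs : r / s z' * s z' = r := div_mul_cancel₀ _ h1'.ne'
  have h5 := h3 (r / s z') ⟨div_nonneg hr.1.le h1'.le, (div_le_one h1').2 hr.2.le⟩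
  simp only [hrs] at h5
  rcases h5 hd with h | h
  · exact hr.1.ne' h
  · exact hr.2.ne h

/-- Hits are isolated and the time interval is compact. Finiteness allows induction on the number of
hits. -/
theorem finite_hits {z : ℂ} (hz : z ∈ Metric.ball (0 : ℂ) 1) (s : ℝ) :
    {t | t ∈ Ioc 0 s ∧ φ t (u z) ∈ disk u}.Finite := by
  have hm := hu.apply_mem_compl hz
  have : (Icc 0 s ∩ {t | φ t (u z) ∈ disk u}).Finite := by
    refine isCompact_Icc.induction_on
      (p := fun A => (A ∩ {t | φ t (u z) ∈ disk u}).Finite) (by simp)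
      (fun A B hAB hB => hB.subset (inter_subset_inter_left _ hAB))
      (fun A B hA hB => by rw [union_inter_distrib_right]; exact hA.union hB) ?_
    intro t _
    by_cases hd : φ t (u z) ∈ disk u
    · obtain ⟨w, hw, e⟩ := hu.mem_diskInterior (flow_mem_compl_orbit hφ hp₀ hm t).2 hd
      obtain ⟨σ, ψ, -, -, -, -, -, h⟩ := hu.exists_hitting hφ hR hz hw e.symm
      have h1 : ∀ᶠ r : ℝ in 𝓝 t, φ r (u z) ∈ disk u → r = σ z :=
        (Continuous.tendsto' (f := fun t : ℝ => (z, t)) (by fun_prop) _ _ rfl).eventually h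
      exact ⟨_, mem_nhdsWithin_of_mem_nhds h1, (finite_singleton (σ z)).subset
        (fun r hr => hr.1 hr.2)⟩
    · refine ⟨_, mem_nhdsWithin_of_mem_nhds ((hφ.continuous_left hm.1).continuousAt.eventually_mem
        (hu.embedded.isCompact_disk.isClosed.isOpen_compl.mem_nhds hd)), ?_⟩
      exact finite_empty.subset (fun r hr => hr.1 hr.2)
  exact this.subset fun t ht => ⟨⟨ht.1.1.le, ht.1.2⟩, ht.2⟩

/-! ### The logarithm of a linking class along trajectories -/

omit hR in
-- The product `ball × ℝ` is convex, whereas the complement of the orbit itself admits no logarithm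
-- of a linking class.
theorem exists_log_flow {f : E4 → ℂ} (hf : ContinuousOn f (S3 \ orbit φ p₀))
    (h0 : ∀ x ∈ S3 \ orbit φ p₀, f x ≠ 0) :
    ∃ L : ℂ × ℝ → ℂ, ContinuousOn L (Metric.ball 0 1 ×ˢ univ) ∧
      ∀ z ∈ Metric.ball (0 : ℂ) 1, ∀ t, f (φ t (u z)) = Complex.exp (L (z, t)) := by
  have hmem : ∀ q ∈ Metric.ball (0 : ℂ) 1 ×ˢ (univ : Set ℝ),
      φ q.2 (u q.1) ∈ S3 \ orbit φ p₀ := fun q hq =>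
    flow_mem_compl_orbit hφ hp₀ (hu.apply_mem_compl hq.1) _
  have hc : Convex ℝ (Metric.ball (0 : ℂ) 1 ×ˢ (univ : Set ℝ)) :=
    (convex_ball _ _).prod convex_univ
  have hx : ((0 : ℂ), (0 : ℝ)) ∈ Metric.ball (0 : ℂ) 1 ×ˢ (univ : Set ℝ) := by simp
  obtain ⟨L, hL, hLe⟩ := exists_log_of_starConvex (Metric.isOpen_ball.prod isOpen_univ) hx
    (hc.starConvex hx) (g := fun q => f (φ q.2 (u q.1)))
    (hf.comp (fun q hq => (hu.continuousAt_flow hφ hq.1).continuousWithinAt) hmem)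
    (fun q hq => h0 _ (hmem q hq))
  exact ⟨L, hL, fun z hz t => hLe (z, t) ⟨hz, mem_univ _⟩⟩

variable {f : E4 → ℂ} {L : ℂ × ℝ → ℂ} (hL : ContinuousOn L (Metric.ball 0 1 ×ˢ univ))
  (hLe : ∀ z ∈ Metric.ball (0 : ℂ) 1, ∀ t, f (φ t (u z)) = Complex.exp (L (z, t)))

include hL hLe

omit hφ hR hp₀ hu hLe in
theorem continuous_log_left {z : ℂ} (hz : z ∈ Metric.ball (0 : ℂ) 1) :
    Continuous fun t => L (z, t) :=
  hL.comp_continuous (f := fun t : ℝ => (z, t)) (by fun_prop) fun _ => ⟨hz, mem_univ _⟩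

omit hR hp₀ in
/-- Two logarithms of the linking class along the same trajectory differ by a constant. -/
theorem log_sub_log {z w : ℂ} (hz : z ∈ Metric.ball (0 : ℂ) 1) (hw : w ∈ Metric.ball (0 : ℂ) 1)
    {s : ℝ} (h : φ s (u z) = u w) (t : ℝ) :
    L (z, t + s) - L (w, t) = L (z, s) - L (w, 0) := by
  have h1 : ContinuousOn (fun t => L (z, t + s) - L (w, t)) univ :=
    (((continuous_log_left hL hz).comp (continuous_add_const s)).sub
      (continuous_log_left hL hw)).continuousOn
  have h2 := isPreconnected_univ.exp_eq_one_const h1 (fun t _ => by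
    rw [Complex.exp_sub, ← hLe z hz, ← hLe w hw, hφ.add (hu.apply_mem_compl hz).1, h, div_self]
    rw [hLe w hw]
    exact Complex.exp_ne_zero _) (mem_univ t) (mem_univ 0)
  simpa using h2

/-- The logarithm of the linking class increases by the same amount at each return. -/
theorem exists_log_increment : ∃ c : ℂ, Complex.exp c = 1 ∧ ∀ z ∈ Metric.ball (0 : ℂ) 1,
    ∀ t w, IsFirstReturn φ u z t w → L (z, t) - L (w, 0) = c := by
  have hex : ∀ z : ℂ, ∃ q : ℝ × ℂ, z ∈ Metric.ball (0 : ℂ) 1 → IsFirstReturn φ u z q.1 q.2 := by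
    intro z
    by_cases hz : z ∈ Metric.ball (0 : ℂ) 1
    · obtain ⟨t, w, h⟩ := exists_isFirstReturn hφ hR hp₀ hu hz
      exact ⟨(t, w), fun _ => h⟩
    · exact ⟨(0, 0), fun h => (hz h).elim⟩
  choose q hq using hex
  -- The chosen returns `q` agree locally with the continuous families from
  -- `eventually_isFirstReturn`, by uniqueness of first returns.
  have hcont : ContinuousOn (fun z => L (z, (q z).1) - L ((q z).2, 0)) (Metric.ball 0 1) := by
    intro z hz
    apply ContinuousAt.continuousWithinAt
    obtain ⟨s, ψ, hs, hψ, he⟩ := eventually_isFirstReturn hφ hR hu hz (hq z hz)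
    have hb : ∀ᶠ z' in 𝓝 z, z' ∈ Metric.ball (0 : ℂ) 1 := Metric.isOpen_ball.mem_nhds hz
    have heq : (fun z' => L (z', s z') - L (ψ z', 0)) =ᶠ[𝓝 z]
        fun z => L (z, (q z).1) - L ((q z).2, 0) := by
      filter_upwards [he, hb] with z' h1 h2
      obtain ⟨e1, e2⟩ := h1.unique hu.embedded (hq z' h2)
      rw [e1, e2]
    have hLc : ∀ z ∈ Metric.ball (0 : ℂ) 1, ∀ t : ℝ, ContinuousAt L (z, t) := fun z hz t =>
      hL.continuousAt ((Metric.isOpen_ball.prod isOpen_univ).mem_nhds ⟨hz, mem_univ _⟩)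
    have c1 : ContinuousAt (fun z' => L (z', s z')) z :=
      ContinuousAt.comp (g := L) (f := fun z' => (z', s z')) (hLc z hz _)
        (continuousAt_id.prodMk hs)
    have c2 : ContinuousAt (fun z' => L (ψ z', 0)) z :=
      ContinuousAt.comp (g := L) (f := fun z' => (ψ z', 0)) (hLc _ he.self_of_nhds.mem _)
        (hψ.prodMk continuousAt_const)
    exact (c1.sub c2).congr heq
  have hexp : ∀ z ∈ Metric.ball (0 : ℂ) 1,
      Complex.exp (L (z, (q z).1) - L ((q z).2, 0)) = 1 := by
    intro z hz
    have h := hq z hz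
    rw [Complex.exp_sub, ← hLe z hz, ← hLe _ h.mem, h.apply_eq,
      hφ.zero _ (hu.apply_mem_compl h.mem).1, div_self]
    rw [← h.apply_eq, hLe z hz]
    exact Complex.exp_ne_zero _
  have h0 : (0 : ℂ) ∈ Metric.ball (0 : ℂ) 1 := by simp
  refine ⟨_, hexp 0 h0, fun z hz t w h => ?_⟩
  obtain ⟨e1, e2⟩ := h.unique hu.embedded (hq z hz)
  rw [e1, e2]
  exact (convex_ball (0 : ℂ) 1).isPreconnected.exp_eq_one_const hcont hexp hz h0

/-- Cut the trajectory at its first return: the logarithm gains `c`, the elapsed time is at most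
`T₁`, and the rest has fewer hits. The second bound is the source of linear growth. -/
theorem exists_nat_log_sub {c : ℂ} (hc : ∀ z ∈ Metric.ball (0 : ℂ) 1,
    ∀ t w, IsFirstReturn φ u z t w → L (z, t) - L (w, 0) = c)
    {T₁ : ℝ} (hT₁ : ∀ z ∈ Metric.ball (0 : ℂ) 1, ∀ t w, IsFirstReturn φ u z t w → t ≤ T₁)
    {z w : ℂ} (hz : z ∈ Metric.ball (0 : ℂ) 1) (hw : w ∈ Metric.ball (0 : ℂ) 1) {s : ℝ}
    (hs : 0 ≤ s) (h : φ s (u z) = u w) :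
    ∃ N : ℕ, L (z, s) - L (w, 0) = N * c ∧ s ≤ N * T₁ := by
  induction hm : {t | t ∈ Ioc 0 s ∧ φ t (u z) ∈ disk u}.ncard using Nat.strong_induction_on
    generalizing z s with
  | _ m ih =>
    have hz' := hu.apply_mem_compl hz
    rcases hs.eq_or_lt with rfl | hs
    · rw [hφ.zero _ hz'.1] at h
      have := hu.embedded.injOn (Metric.ball_subset_closedBall hz)
        (Metric.ball_subset_closedBall hw) h
      subst this
      exact ⟨0, by simp, by simp⟩
    · obtain ⟨t, z₁, ht⟩ := exists_isFirstReturn hφ hR hp₀ hu hz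
      have hts : t ≤ s := by
        by_contra! hlt
        exact ht.not_mem s ⟨hs, hlt⟩
          (h ▸ mem_image_of_mem u (Metric.ball_subset_closedBall hw))
      have hsh : ∀ r, φ r (u z₁) = φ (r + t) (u z) := fun r => by
        rw [hφ.add hz'.1, ht.apply_eq]
      have h1 : φ (s - t) (u z₁) = u w := by rw [hsh, sub_add_cancel, h]
      have hlt : {r | r ∈ Ioc 0 (s - t) ∧ φ r (u z₁) ∈ disk u}.ncard < m := by
        rw [← hm]
        have hfin := finite_hits hφ hR hp₀ hu hz s
        rw [← ncard_image_of_injective _ (add_left_injective t)]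
        refine ncard_lt_ncard ⟨?_, fun hsub => ?_⟩ hfin
        · rintro _ ⟨r, ⟨hr, hd⟩, rfl⟩
          exact ⟨⟨by linarith [hr.1, ht.pos], by linarith [hr.2]⟩, by rw [← hsh]; exact hd⟩
        -- The first return `t` is a hit of the original trajectory but not a shifted hit of the
        -- remainder, because the intervals exclude zero.
        · obtain ⟨r, ⟨hr, -⟩, e⟩ := hsub (show t ∈ _ from ⟨⟨ht.pos, hts⟩, by
            rw [ht.apply_eq]; exact mem_image_of_mem u (Metric.ball_subset_closedBall ht.mem)⟩)
          simp only at e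
          linarith [hr.1]
      obtain ⟨N, hN, hNT⟩ := ih _ hlt ht.mem (sub_nonneg.2 hts) h1 rfl
      refine ⟨N + 1, ?_, ?_⟩
      · have h2 := log_sub_log hφ hu hL hLe hz ht.mem ht.apply_eq (s - t)
        rw [sub_add_cancel, hc z hz t z₁ ht] at h2
        push_cast
        linear_combination h2 + hN
      · push_cast
        linarith [hT₁ z hz t z₁ ht]

end Return

end

noncomputable section

/-! ### Coordinates near the boundary of the disk -/

section Boundary

variable {lam : E4 → E4 →L[ℝ] ℝ} {R : E4 → E4} {φ : ℝ → E4 → E4} {u : ℂ → E4} {p₀ : E4}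

theorem exists_normal_tangent (u : ℂ → E4) (z : ℂ) :
    ∃ e ∈ tangentS3 (u z), e ∉ range (fderiv ℝ u z) := by
  let N : E4 →ₗ[ℝ] (Fin 3 → ℝ) := LinearMap.pi
    ![(innerSL ℝ (u z) : E4 →ₗ[ℝ] ℝ), (innerSL ℝ (fderiv ℝ u z 1) : E4 →ₗ[ℝ] ℝ),
      (innerSL ℝ (fderiv ℝ u z Complex.I) : E4 →ₗ[ℝ] ℝ)]
  have hN := LinearMap.ker_ne_bot_of_finrank_lt (f := N) (by simp)
  obtain ⟨e, he, he0⟩ := Submodule.exists_mem_ne_zero_of_ne_bot hN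
  have he' : N e = 0 := he
  have e0 : inner ℝ (u z) e = 0 := congrFun he' 0
  have e1 : inner ℝ (fderiv ℝ u z 1) e = 0 := congrFun he' 1
  have e2 : inner ℝ (fderiv ℝ u z Complex.I) e = 0 := congrFun he' 2
  refine ⟨e, mem_tangentS3.2 e0, ?_⟩
  rintro ⟨a, ha⟩
  have h1 : fderiv ℝ u z a = a.re • fderiv ℝ u z 1 + a.im • fderiv ℝ u z Complex.I := by
    rw [← map_smul, ← map_smul, ← map_add]
    congr 1
    apply Complex.ext <;> simp
  refine he0 (inner_self_eq_zero (𝕜 := ℝ).1 ?_)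
  have h2 : inner ℝ e e = inner ℝ (a.re • fderiv ℝ u z 1 + a.im • fderiv ℝ u z Complex.I) e := by
    rw [← h1, ha]
  rw [h2, inner_add_left, inner_smul_left, inner_smul_left, e1, e2]
  simp

/-- At the boundary `R` is tangent to the disk and flow charts are unavailable. Instead one inverts
`(c, s, r) ↦ (1 + r) • u c + s • e`: `Z` is the coordinate along the extended disk, `h` the height
above it, and the last clause is the derivative of the inverse, with `r` the radial part. -/
theorem IsEmbeddedDisk.exists_coordinates (hu : IsEmbeddedDisk u) {z : ℂ}
    (hz : z ∈ Metric.closedBall (0 : ℂ) 1) :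
    ∃ (e : E4) (Z : E4 → ℂ) (h : E4 → ℝ), e ∈ tangentS3 (u z) ∧ e ∉ range (fderiv ℝ u z) ∧
      ContDiffAt ℝ 1 Z (u z) ∧ ContDiffAt ℝ 1 h (u z) ∧
      (∀ᶠ c in 𝓝 z, Z (u c) = c ∧ h (u c) = 0) ∧
      (∀ᶠ y in 𝓝 (u z), y ∈ S3 → h y = 0 → ‖Z y‖ < 1 → y ∈ disk u) ∧
      ∀ᶠ c in 𝓝 z, ∀ y, ∃ r : ℝ,
        fderiv ℝ u c (fderiv ℝ Z (u c) y) + fderiv ℝ h (u c) y • e + r • u c = y := by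
  obtain ⟨e, he, her⟩ := exists_normal_tangent u z
  have hS := hu.mem_S3 hz
  obtain ⟨D, hD⟩ := exists_equiv_of_normal (hu.immersion z hz) (S3_ne_zero hS)
    (fun a => mem_tangentS3.1 (hu.fderiv_mem_tangentS3 hz a)) (mem_tangentS3.1 he) her
  let G : ℂ × ℝ × ℝ → E4 := fun x => (1 + x.2.2) • u x.1 + x.2.1 • e
  have hG0 : ∀ c, G (c, 0, 0) = u c := fun c => by simp [G]
  have hGc : ContDiff ℝ ∞ G := by
    have h1 : ContDiff ℝ ∞ (fun x : ℂ × ℝ × ℝ => u x.1) := hu.smooth.comp contDiff_fst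
    exact ((contDiff_const.add contDiff_snd.snd).smul h1).add
      (contDiff_snd.fst.smul contDiff_const)
  have hGd : ∀ c x, fderiv ℝ G (c, 0, 0) x = fderiv ℝ u c x.1 + x.2.1 • e + x.2.2 • u c := by
    intro c x
    have h1 := (hu.hasFDerivAt c).comp (c, (0 : ℝ), (0 : ℝ))
      (ContinuousLinearMap.fst ℝ ℂ (ℝ × ℝ)).hasFDerivAt
    have h2 := ((((ContinuousLinearMap.snd ℝ ℝ ℝ).comp
      (ContinuousLinearMap.snd ℝ ℂ (ℝ × ℝ))).hasFDerivAt (x := (c, 0, 0))).const_add 1).smul h1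
    have h3 := h2.add ((((ContinuousLinearMap.fst ℝ ℝ ℝ).comp
      (ContinuousLinearMap.snd ℝ ℂ (ℝ × ℝ))).hasFDerivAt (x := (c, 0, 0))).smul_const e)
    have h4 : fderiv ℝ G (c, 0, 0) = _ := h3.fderiv
    rw [h4]
    simp
    abel
  have hGz : HasFDerivAt G (D : (ℂ × ℝ × ℝ) →L[ℝ] E4) (z, 0, 0) := by
    have h1 := (hGc.differentiable (by simp) (z, 0, 0)).hasFDerivAt
    refine h1.congr_fderiv (ContinuousLinearMap.ext fun x => ?_)
    rw [hGd, ContinuousLinearEquiv.coe_coe, hD]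
  have hs : HasStrictFDerivAt G (D : (ℂ × ℝ × ℝ) →L[ℝ] E4) (z, 0, 0) :=
    hGc.contDiffAt.hasStrictFDerivAt' hGz (by simp)
  have hgs : ContDiffAt ℝ 1 (hs.localInverse G D (z, 0, 0)) (G (z, 0, 0)) :=
    (hGc.contDiffAt.of_le (by exact_mod_cast le_top)).to_localInverse hGz (by simp)
  have hr := hs.eventually_right_inverse
  have hl := hs.eventually_left_inverse
  set g := hs.localInverse G D (z, 0, 0)
  rw [hG0] at hgs hr
  have hgz : ∀ᶠ c in 𝓝 z, g (u c) = (c, 0, 0) := by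
    have ht : Tendsto (fun c : ℂ => ((c, 0, 0) : ℂ × ℝ × ℝ)) (𝓝 z) (𝓝 (z, 0, 0)) :=
      Continuous.tendsto (by fun_prop) z
    filter_upwards [ht.eventually hl] with c hc
    rwa [hG0] at hc
  have huc : Tendsto u (𝓝 z) (𝓝 (u z)) := hu.smooth.continuous.tendsto z
  refine ⟨e, fun y => (g y).1, fun y => (g y).2.1, he, her, hgs.fst, hgs.snd.fst, ?_, ?_, ?_⟩
  · filter_upwards [hgz] with c hc
    simp [hc]
  · have c3 : ContinuousAt (fun y => (g y).2.2) (u z) := hgs.continuousAt.snd.snd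
    have e2 : ∀ᶠ y in 𝓝 (u z), (g y).2.2 ∈ Ioi (-1 : ℝ) :=
      c3.eventually_mem (isOpen_Ioi.mem_nhds (by simp [hgz.self_of_nhds]))
    filter_upwards [e2, hr] with y h2 h3 hy h0 h1
    have hm : (g y).1 ∈ Metric.closedBall (0 : ℂ) 1 := by
      rw [mem_closedBall_iff_norm, sub_zero]; exact h1.le
    have h4 : (1 + (g y).2.2) • u (g y).1 = y := by
      conv_rhs => rw [← h3]
      simp [G, h0]
    rw [← eq_of_norm_smul hy (hu.mem_S3 hm) h2 h4]
    exact mem_image_of_mem u hm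
  · have hd : ∀ᶠ y in 𝓝 (u z), DifferentiableAt ℝ g y :=
      (hgs.eventually (by simp)).mono fun y hy => hy.differentiableAt (by simp)
    filter_upwards [huc.eventually hd, huc.eventually hr.eventually_nhds, hgz] with c h1 h2 h3 y
    have h4 : HasFDerivAt (G ∘ g) ((fderiv ℝ G (c, 0, 0)).comp (fderiv ℝ g (u c))) (u c) := by
      refine HasFDerivAt.comp _ ?_ h1.hasFDerivAt
      rw [h3]
      exact (hGc.differentiable (by simp) _).hasFDerivAt
    have h5 : fderiv ℝ (G ∘ g) (u c) = ContinuousLinearMap.id ℝ E4 := by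
      have : G ∘ g =ᶠ[𝓝 (u c)] id := h2
      rw [this.fderiv_eq, fderiv_id]
    have h6 := congrArg (fun A => A y) (h4.fderiv.symm.trans h5)
    simp only [ContinuousLinearMap.comp_apply, hGd, ContinuousLinearMap.id_apply] at h6
    have hZ : fderiv ℝ (fun y => (g y).1) (u c) y = (fderiv ℝ g (u c) y).1 := by
      rw [(h1.hasFDerivAt.fst).fderiv]; rfl
    have hh : fderiv ℝ (fun y => (g y).2.1) (u c) y = (fderiv ℝ g (u c) y).2.1 := by
      rw [(h1.hasFDerivAt.snd.fst).fderiv]; rfl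
    exact ⟨_, by rw [hZ, hh]; exact h6⟩

end Boundary

end

noncomputable section

/-! ### The outward direction along the boundary of the disk -/

section Outward

variable {lam : E4 → E4 →L[ℝ] ℝ} {R : E4 → E4} {φ : ℝ → E4 → E4} {u : ℂ → E4} {p₀ : E4}

theorem mem_closedBall_of_norm {z : ℂ} (hz : ‖z‖ = 1) : z ∈ Metric.closedBall (0 : ℂ) 1 := by
  rw [mem_closedBall_iff_norm, sub_zero, hz]

theorem IsDiskGSS.apply_mem {K : Set E4} (hu : IsDiskGSS R φ K u) {z : ℂ} (hz : ‖z‖ = 1) :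
    u z ∈ K := by
  rw [← hu.boundary]
  exact ⟨z, by rwa [mem_sphere_iff_norm, sub_zero], rfl⟩

theorem IsDiskGSS.exists_boundary_param (hφ : IsFlowOf R φ) (hp₀ : p₀ ∈ S3)
    (hu : IsDiskGSS R φ (orbit φ p₀) u) {z : ℂ} (hz : ‖z‖ = 1) :
    ∃ c : ℝ → ℂ, c 0 = z ∧ Continuous c ∧ ∀ t, ‖c t‖ = 1 ∧ u (c t) = φ t (u z) := by
  have hS := hu.embedded.mem_S3 (mem_closedBall_of_norm hz)
  have hex : ∀ t, ∃ w : ℂ, ‖w‖ = 1 ∧ u w = φ t (u z) := by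
    intro t
    have h1 := flow_mem_orbit hφ hp₀ (hu.apply_mem hz) t
    rw [← hu.boundary] at h1
    obtain ⟨w, hw, e⟩ := h1
    exact ⟨w, by simpa using hw, e⟩
  choose c hc using hex
  refine ⟨c, ?_, ?_, hc⟩
  · refine hu.embedded.injOn (mem_closedBall_of_norm (hc 0).1) (mem_closedBall_of_norm hz) ?_
    rw [(hc 0).2, hφ.zero _ hS]
  · refine continuous_iff_continuousAt.2 fun t => ?_
    refine tendsto_def.2 fun s hs => ?_
    have h1 := hu.embedded.eventually_of_apply (mem_closedBall_of_norm (hc t).1) hs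
    rw [(hc t).2] at h1
    filter_upwards [(hφ.continuous_left hS).continuousAt.eventually h1] with t' h2
    exact h2 _ (mem_closedBall_of_norm (hc t').1) (hc t').2

variable (hlam : IsContactForm lam) (hR : IsReebField lam R) (hφ : IsFlowOf R φ) (hp₀ : p₀ ∈ S3)
  (hu : IsDiskGSS R φ (orbit φ p₀) u)

include hlam hR hφ hp₀ hu

omit hlam in
-- The orbit, read in the disk, is a curve on the unit circle; the chart `Z` shows that it is
-- differentiable. Its velocity is orthogonal to `z`, and nonzero because `lam (R (u z)) = 1`.
theorem exists_field_eq {z : ℂ} (hz : ‖z‖ = 1) :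
    ∃ α : ℝ, α ≠ 0 ∧ R (u z) = α • fderiv ℝ u z (Complex.I * z) := by
  have hcb := mem_closedBall_of_norm hz
  have hS := hu.embedded.mem_S3 hcb
  obtain ⟨c, hc0, hcc, hc⟩ := hu.exists_boundary_param hφ hp₀ hz
  obtain ⟨e, Z, h, -, -, hZ, -, hZu, -, -⟩ := hu.embedded.exists_coordinates hcb
  have hode : HasDerivAt (fun t => φ t (u z)) (R (u z)) 0 := by
    have := hφ.ode _ hS 0
    rwa [hφ.zero _ hS] at this
  have hd : HasDerivAt c (fderiv ℝ Z (u z) (R (u z))) 0 := by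
    have h1 : HasDerivAt (fun t => Z (φ t (u z))) (fderiv ℝ Z (u z) (R (u z))) 0 := by
      refine HasFDerivAt.comp_hasDerivAt (l := Z) (f := fun t => φ t (u z)) 0 ?_ hode
      rw [hφ.zero _ hS]
      exact (hZ.differentiableAt (by simp)).hasFDerivAt
    refine h1.congr_of_eventuallyEq ?_
    have h2 : Tendsto c (𝓝 0) (𝓝 z) := by
      rw [← hc0]; exact hcc.continuousAt
    filter_upwards [h2.eventually hZu] with t ht
    rw [← (hc t).2, ht.1]
  set b := fderiv ℝ Z (u z) (R (u z))
  have hb : R (u z) = fderiv ℝ u z b := by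
    have h1 : HasDerivAt (fun t => u (c t)) (fderiv ℝ u z b) 0 := by
      refine HasFDerivAt.comp_hasDerivAt (l := u) (f := c) 0 ?_ hd
      rw [hc0]
      exact hu.embedded.hasFDerivAt z
    have h2 : (fun t => u (c t)) = fun t => φ t (u z) := funext fun t => (hc t).2
    rw [h2] at h1
    exact hode.unique h1
  have hperp : inner ℝ z b = 0 := by
    have h1 := hd.norm_sq
    have h2 : (fun t => ‖c t‖ ^ 2) = fun _ => 1 := funext fun t => by rw [(hc t).1, one_pow]
    rw [h2, hc0] at h1
    have := h1.unique (hasDerivAt_const _ _)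
    linarith
  have hz0 : z ≠ 0 := by rintro rfl; simp at hz
  have hbα : b = ((b * (starRingEnd ℂ) z).im : ℂ) * (Complex.I * z) := by
    have h1 : b * (starRingEnd ℂ) z = ((b * (starRingEnd ℂ) z).im : ℂ) * Complex.I := by
      rw [Complex.inner] at hperp
      apply Complex.ext
      · have : (b * (starRingEnd ℂ) z).re = 0 := by
          rw [← hperp]
        rw [this]
        simp
      · simp
    have h2 : (starRingEnd ℂ) z * z = 1 := by
      rw [← Complex.normSq_eq_conj_mul_self, Complex.normSq_eq_norm_sq, hz]; simp
    linear_combination z * h1 - b * h2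
  refine ⟨(b * (starRingEnd ℂ) z).im, ?_, ?_⟩
  · intro h0
    rw [h0] at hbα
    rw [hbα] at hb
    have := hR.normalised _ hS
    rw [hb] at this
    simp at this
  · rw [← map_smul, Complex.real_smul, ← hbα, ← hb]

omit hlam hφ hp₀ in
theorem outward_mem {z : ℂ} (hz : ‖z‖ = 1) : outward lam R u z ∈ contactPlane lam (u z) := by
  have hcb := mem_closedBall_of_norm hz
  have hS := hu.embedded.mem_S3 hcb
  refine ⟨Submodule.sub_mem _ (hu.embedded.fderiv_mem_tangentS3 hcb _)
    (Submodule.smul_mem _ _ (hR.tangent _ hS)), ?_⟩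
  have : lam (u z) (outward lam R u z) = 0 := by
    rw [outward, map_sub, map_smul, hR.normalised _ hS]
    simp
  exact this

omit hlam in
-- At the boundary the tangent plane of the disk is spanned by the outward vector and `R`, and `R`
-- lies in the kernel of `d lam`.
theorem extD_outward_fderiv {z : ℂ} (hz : ‖z‖ = 1) (a : ℂ) :
    extD lam (u z) (outward lam R u z) (fderiv ℝ u z a) = 0 := by
  have hcb := mem_closedBall_of_norm hz
  have hS := hu.embedded.mem_S3 hcb
  obtain ⟨α, hα, hα'⟩ := exists_field_eq hR hφ hp₀ hu hz
  have ho := outward_mem (lam := lam) hR hu hz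
  have hz0 : z ≠ 0 := by rintro rfl; simp at hz
  have h1 : fderiv ℝ u z z = outward lam R u z + lam (u z) (fderiv ℝ u z z) • R (u z) := by
    simp [outward]
  have h2 : fderiv ℝ u z (Complex.I * z) = α⁻¹ • R (u z) := by
    rw [hα', smul_smul, inv_mul_cancel₀ hα, one_smul]
  have h3 : a = (a / z).re • z + (a / z).im • (Complex.I * z) := by
    rw [Complex.real_smul, Complex.real_smul]
    have := Complex.re_add_im (a / z)
    field_simp at this ⊢
    linear_combination -this
  have h4 : extD lam (u z) (outward lam R u z) (R (u z)) = 0 := by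
    rw [extD_swap, hR.kernel _ hS _ ho.1, neg_zero]
  rw [h3, map_add, map_smul, map_smul, h1, h2, extD_add_right, extD_smul_right, extD_smul_right,
    extD_add_right, extD_smul_right, extD_smul_right, extD_self, h4]
  ring

theorem extD_outward_ne_zero {z : ℂ} (hz : ‖z‖ = 1) {e : E4} (he : e ∈ tangentS3 (u z))
    (her : e ∉ range (fderiv ℝ u z)) : extD lam (u z) (outward lam R u z) e ≠ 0 := by
  have hcb := mem_closedBall_of_norm hz
  have hS := hu.embedded.mem_S3 hcb
  obtain ⟨α, hα, hα'⟩ := exists_field_eq hR hφ hp₀ hu hz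
  have ho := outward_mem (lam := lam) hR hu hz
  have hz0 : z ≠ 0 := by rintro rfl; simp at hz
  set μ := lam (u z) (fderiv ℝ u z z) with hμ
  have ho' : outward lam R u z = fderiv ℝ u z (z - (μ * α) • (Complex.I * z)) := by
    rw [outward, map_sub, map_smul, mul_smul, ← hα']
  have ho0 : outward lam R u z ≠ 0 := by
    rw [ho']
    intro h
    have h1 := hu.embedded.immersion z hcb (h.trans (map_zero _).symm)
    have h2 : z * (1 - (μ * α : ℝ) * Complex.I) = 0 := by
      rw [← h1, Complex.real_smul]; ring
    rcases mul_eq_zero.1 h2 with h3 | h3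
    · exact hz0 h3
    · have := congrArg Complex.re h3
      simp at this
  refine hlam.extD_ne_zero hR hS ho he (linearIndependent_three fun a b c h => ?_)
  have hc : c = 0 := by
    by_contra hc
    refine her ⟨-c⁻¹ • (a • (α • (Complex.I * z)) + b • (z - (μ * α) • (Complex.I * z))), ?_⟩
    have h1 : fderiv ℝ u z (a • (α • (Complex.I * z)) + b • (z - (μ * α) • (Complex.I * z))) =
        -(c • e) := by
      rw [map_add, map_smul, map_smul, map_smul, ← hα', ← ho']
      exact eq_neg_of_add_eq_zero_left h
    rw [map_smul, h1, smul_neg, neg_smul, neg_neg, smul_smul, inv_mul_cancel₀ hc, one_smul]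
  subst hc
  have ho1 : lam (u z) (outward lam R u z) = 0 := ho.2
  have ha : a = 0 := by
    have := congrArg (lam (u z)) h
    simpa [hR.normalised _ hS, ho1] using this
  subst ha
  exact ⟨rfl, by simpa [ho0] using h, rfl⟩

omit hR hφ hp₀ hu in
theorem continuousOn_extD {s : Set ℝ} {p v w : ℝ → E4} (hp : ContinuousOn p s)
    (hps : ∀ t ∈ s, p t ∈ S3) (hv : ContinuousOn v s) (hw : ContinuousOn w s) :
    ContinuousOn (fun t => extD lam (p t) (v t) (w t)) s := by
  have h1 : ContinuousOn (fun t => diffS3 lam (p t)) s :=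
    hlam.smooth.continuousOn_diffS3.comp hp hps
  exact ((h1.clm_apply hv).clm_apply hw).sub ((h1.clm_apply hw).clm_apply hv)

/-- The normal component of the linearised flow applied to the outward direction changes sign at
time zero. -/
theorem eventually_normal_mul_neg (hstrong : IsBoundaryStrong lam R φ u) {z : ℂ} (hz : ‖z‖ = 1)
    {e : E4} {Z : E4 → ℂ} {h : E4 → ℝ} (he : e ∈ tangentS3 (u z))
    (her : e ∉ range (fderiv ℝ u z))
    (hdec : ∀ᶠ c in 𝓝 z, ∀ y, ∃ r : ℝ,
        fderiv ℝ u c (fderiv ℝ Z (u c) y) + fderiv ℝ h (u c) y • e + r • u c = y) :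
    ∀ᶠ ε in 𝓝[>] (0 : ℝ),
      fderiv ℝ h (φ ε (u z)) (linFlow φ ε (u z) (outward lam R u z)) *
        fderiv ℝ h (φ (-ε) (u z)) (linFlow φ (-ε) (u z) (outward lam R u z)) < 0 := by
  have hcb := mem_closedBall_of_norm hz
  have hS := hu.embedded.mem_S3 hcb
  obtain ⟨c, hc0, hcc, hc⟩ := hu.exists_boundary_param hφ hp₀ hz
  set o := outward lam R u z with ho
  set D : ℝ → ℝ := fun t => extD lam (u (c t)) (outward lam R u (c t)) (linFlow φ t (u z) o) with hD
  -- The vector `e` is tangent to the sphere at time zero only, so its radial part at `u (c t)` is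
  -- subtracted.
  set β : ℝ → ℝ := fun t => extD lam (u (c t)) (outward lam R u (c t))
    (e - inner ℝ (u (c t)) e • u (c t)) with hβ
  have hder : deriv D 0 ≠ 0 := by
    have := hstrong.transverse c (fun t => ⟨(hc t).1, by rw [hc0]; exact (hc t).2⟩)
    rwa [hc0] at this
  -- Pairing with the outward vector kills the part tangent to the disk, so `D` is the normal
  -- component times `β`. As `D` has a simple zero at time zero and `β` does not vanish there, the
  -- normal component changes sign.
  have hDH : ∀ᶠ t in 𝓝 (0 : ℝ), D t = fderiv ℝ h (φ t (u z)) (linFlow φ t (u z) o) * β t := by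
    have h2 : Tendsto c (𝓝 0) (𝓝 z) := by
      rw [← hc0]; exact hcc.continuousAt
    filter_upwards [h2.eventually hdec] with t ht
    have hctS := hu.embedded.mem_S3 (mem_closedBall_of_norm (hc t).1)
    obtain ⟨r, hr⟩ := ht (linFlow φ t (u z) o)
    set H := fderiv ℝ h (u (c t)) (linFlow φ t (u z) o) with hH
    have ht1 := hφ.linFlow_mem_tangentS3 hS t o
    rw [← (hc t).2, mem_tangentS3] at ht1
    have hr' : r = -(H * inner ℝ (u (c t)) e) := by
      have h3 := congrArg (inner ℝ (u (c t))) hr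
      rw [ht1, inner_add_right, inner_add_right, inner_smul_right, inner_smul_right,
        real_inner_self_eq_norm_sq, mem_S3.1 hctS, mem_tangentS3.1
          (hu.embedded.fderiv_mem_tangentS3 (mem_closedBall_of_norm (hc t).1) _)] at h3
      linarith
    have h4 : linFlow φ t (u z) o = fderiv ℝ u (c t) (fderiv ℝ Z (u (c t))
        (linFlow φ t (u z) o)) + H • (e - inner ℝ (u (c t)) e • u (c t)) := by
      conv_lhs => rw [← hr, hr']
      rw [smul_sub, smul_smul, neg_smul]
      abel
    rw [← (hc t).2, ← hH]
    simp only [hD, hβ]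
    conv_lhs => rw [h4]
    rw [extD_add_right, extD_smul_right, extD_outward_fderiv hR hφ hp₀ hu (hc t).1, zero_add]
  have hβc : Continuous β := by
    rw [← continuousOn_univ]
    have h1 : Continuous fun t => u (c t) := hu.embedded.smooth.continuous.comp hcc
    have hm : ∀ t, u (c t) ∈ S3 := fun t =>
      hu.embedded.mem_S3 (mem_closedBall_of_norm (hc t).1)
    have h2 : Continuous fun t => fderiv ℝ u (c t) (c t) :=
      ((hu.embedded.smooth.continuous_fderiv (by simp)).comp hcc).clm_apply hcc
    have h3 : Continuous fun t => outward lam R u (c t) :=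
      h2.sub (((hlam.smooth.continuousOn.comp_continuous h1 hm).clm_apply h2).smul
        (hφ.smooth_field.continuousOn.comp_continuous h1 hm))
    have h4 : Continuous fun t => inner ℝ (u (c t)) e := h1.inner continuous_const
    have h5 : Continuous fun t => e - inner ℝ (u (c t)) e • u (c t) :=
      continuous_const.sub (h4.smul h1)
    exact continuousOn_extD hlam h1.continuousOn (fun t _ => hm t) h3.continuousOn h5.continuousOn
  have hβ0 : β 0 ≠ 0 := by
    have h1 := extD_outward_ne_zero hlam hR hφ hp₀ hu hz he her
    simp only [hβ, hc0]
    rwa [mem_tangentS3.1 he, zero_smul, sub_zero]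
  have hD0 : D 0 = 0 := by
    simp only [hD, hc0]
    rw [hφ.linFlow_zero hS (outward_mem hR hu hz).1, extD_self]
  have hslope : Tendsto (fun t => t⁻¹ * D t) (𝓝[≠] 0) (𝓝 (deriv D 0)) := by
    have h1 := (differentiableAt_of_deriv_ne_zero hder).hasDerivAt.tendsto_slope_zero
    simpa [hD0] using h1
  have ht1 : Tendsto (fun t : ℝ => t) (𝓝[>] 0) (𝓝[≠] 0) :=
    tendsto_id.mono_left (nhdsWithin_mono _ fun x (hx : 0 < x) => hx.ne')
  have ht2 : Tendsto (fun t : ℝ => -t) (𝓝[>] 0) (𝓝[≠] 0) := by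
    refine tendsto_nhdsWithin_iff.2 ⟨?_, ?_⟩
    · exact (Continuous.tendsto' (by fun_prop) (0 : ℝ) 0 (by simp)).mono_left nhdsWithin_le_nhds
    · filter_upwards [self_mem_nhdsWithin] with x hx
      exact neg_ne_zero.2 (ne_of_gt hx)
  have hprod := (hslope.comp ht1).mul (hslope.comp ht2)
  have hpos : ∀ᶠ ε in 𝓝[>] (0 : ℝ), 0 < (ε⁻¹ * D ε) * ((-ε)⁻¹ * D (-ε)) :=
    hprod.eventually (lt_mem_nhds (mul_self_pos.2 hder))
  have hβpos : ∀ᶠ ε in 𝓝[>] (0 : ℝ), 0 < β ε * β (-ε) := by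
    have h1 : Tendsto (fun ε => β ε * β (-ε)) (𝓝[>] 0) (𝓝 (β 0 * β 0)) :=
      (Continuous.tendsto' (by fun_prop) _ _ (by simp)).mono_left nhdsWithin_le_nhds
    exact h1.eventually (lt_mem_nhds (mul_self_pos.2 hβ0))
  filter_upwards [hpos, hβpos, self_mem_nhdsWithin, ht1.eventually (nhdsWithin_le_nhds hDH),
    ht2.eventually (nhdsWithin_le_nhds hDH)] with ε h1 h2 hε h3 h4
  have hε : 0 < ε := hε
  have h5 : (ε⁻¹ * D ε) * ((-ε)⁻¹ * D (-ε)) = -(D ε * D (-ε)) * (ε⁻¹ * ε⁻¹) := by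
    rw [inv_neg]; ring
  rw [h5] at h1
  have h6 : 0 < -(D ε * D (-ε)) := (mul_pos_iff_of_pos_right (by positivity)).1 h1
  rw [h3, h4] at h6
  by_contra! h7
  nlinarith [mul_nonneg h7 h2.le]

end Outward

end

noncomputable section

/-! ### Hitting times of the disk are bounded -/

/-- Strict differentiability is what allows both points of the difference quotient to move. -/
theorem HasStrictFDerivAt.tendsto_direction {ι : Type*} {l : Filter ι} {F : E4 → ℝ}
    {F' : E4 →L[ℝ] ℝ} {p w : E4} {x q : ι → E4} (hF : HasStrictFDerivAt F F' p)
    (hx : Tendsto x l (𝓝 p)) (hq : Tendsto q l (𝓝 p))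
    (hw : Tendsto (fun n => ‖x n - q n‖⁻¹ • (x n - q n)) l (𝓝 w)) :
    Tendsto (fun n => ‖x n - q n‖⁻¹ * (F (x n) - F (q n))) l (𝓝 (F' w)) := by
  have h1 := hF.isLittleO.comp_tendsto (hx.prodMk_nhds hq)
  have h2 := (F'.continuous.tendsto w).comp hw
  have h3 : Tendsto (fun n => ‖x n - q n‖⁻¹ * (F (x n) - F (q n) - F' (x n - q n))) l (𝓝 0) := by
    have h4 := h1.norm_right.tendsto_div_nhds_zero
    refine h4.congr fun n => ?_
    simp only [Function.comp]
    rw [div_eq_inv_mul]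
  have h5 := h3.add h2
  rw [zero_add] at h5
  refine h5.congr fun n => ?_
  simp only [Function.comp, map_smul, smul_eq_mul]
  ring

/-- Strict differentiability in the pair of time and point yields one `ε` that serves all times near
`t₀` at once. -/
theorem HasStrictFDerivAt.eventually_lt_of_direction {ι : Type*} {l : Filter ι}
    {F : ℝ × E4 → ℝ} {F' : ℝ × E4 →L[ℝ] ℝ} {t₀ : ℝ} {p w : E4} {x q : ι → E4}
    (hF : HasStrictFDerivAt F F' (t₀, p)) (hx : Tendsto x l (𝓝 p)) (hq : Tendsto q l (𝓝 p))
    (hne : ∀ n, x n ≠ q n)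
    (hw : Tendsto (fun n => ‖x n - q n‖⁻¹ • (x n - q n)) l (𝓝 w)) (hneg : F' (0, w) < 0) :
    ∃ ε > 0, ∀ᶠ n in l, ∀ t, |t - t₀| < ε → F (t, x n) < F (t, q n) := by
  set η := -F' (0, w) / 3 with hη
  have hη0 : 0 < η := by linarith
  have h1 := hF.isLittleO.def hη0
  obtain ⟨ε, hε, h2⟩ := Metric.eventually_nhds_iff.1 h1
  refine ⟨ε, hε, ?_⟩
  have h3 : ∀ᶠ n in l, F' (0, ‖x n - q n‖⁻¹ • (x n - q n)) < -2 * η := by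
    have h4 : Tendsto (fun n => F' (0, ‖x n - q n‖⁻¹ • (x n - q n))) l (𝓝 (F' (0, w))) :=
      (Continuous.tendsto (f := fun v : E4 => F' (0, v)) (by fun_prop) w).comp hw
    exact h4.eventually (gt_mem_nhds (by linarith))
  filter_upwards [h3, Metric.tendsto_nhds.1 hx ε hε, Metric.tendsto_nhds.1 hq ε hε] with
    n h4 h5 h6 t ht
  have hδ : 0 < ‖x n - q n‖ := norm_pos_iff.2 (sub_ne_zero.2 (hne n))
  have h7 := h2 (y := ((t, x n), (t, q n))) (by
    simp only [Prod.dist_eq, max_lt_iff]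
    exact ⟨⟨by simpa [Real.dist_eq] using ht, h5⟩, by simpa [Real.dist_eq] using ht, h6⟩)
  simp only [Prod.mk_sub_mk, sub_self, Prod.norm_mk, norm_zero, Real.norm_eq_abs] at h7
  rw [max_eq_right (norm_nonneg _)] at h7
  have h8 : F' (0, x n - q n) = ‖x n - q n‖ * F' (0, ‖x n - q n‖⁻¹ • (x n - q n)) := by
    rw [← smul_eq_mul, ← map_smul, Prod.smul_mk, smul_zero, smul_smul, mul_inv_cancel₀ hδ.ne',
      one_smul]
  have h9 := (abs_le.1 h7).2
  rw [h8] at h9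
  nlinarith

section Bounded

variable {lam : E4 → E4 →L[ℝ] ℝ} {R : E4 → E4} {φ : ℝ → E4 → E4} {u : ℂ → E4} {p₀ : E4}

/-- Off the orbit the hit is in the interior of the disk, where transversality makes it persist for
nearby points with a nearby time. -/
theorem IsDiskGSS.eventually_hit (hφ : IsFlowOf R φ) (hR : ∀ p ∈ S3, R p ∈ tangentS3 p)
    (hp₀ : p₀ ∈ S3) (hu : IsDiskGSS R φ (orbit φ p₀) u) {q : E4} (hq : q ∈ S3 \ orbit φ p₀) :
    ∃ T : ℝ, ∀ᶠ y in 𝓝 q, y ∈ S3 → ∃ t ∈ Ioc 0 T, φ t y ∈ disk u := by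
  obtain ⟨t₀, ht₀, hd⟩ := hu.hits_pos q hq.1
  obtain ⟨z, hz, e⟩ := hu.mem_diskInterior (flow_mem_compl_orbit hφ hp₀ hq t₀).2 hd
  obtain ⟨Z, T, hZ, hT, hZ1, hT1, hr, -⟩ := hu.exists_section hφ hR hz
  have hc : ContinuousAt (fun y => flowExt φ (t₀, y)) q :=
    ContinuousAt.comp (g := flowExt φ) (f := fun y => (t₀, y))
      (hφ.contDiffAt (q := (t₀, q)) (S3_ne_zero hq.1)).continuousAt (by fun_prop)
  have hc' : Tendsto (fun y => flowExt φ (t₀, y)) (𝓝 q) (𝓝 (u z)) := by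
    have : flowExt φ (t₀, q) = u z := by rw [flowExt_of_mem hq.1, e]
    rw [← this]; exact hc
  have e1 : ∀ᶠ y in 𝓝 (u z), T y ∈ Ioo (-1) t₀ :=
    hT.eventually_mem (isOpen_Ioo.mem_nhds (by rw [hT1]; exact ⟨by norm_num, ht₀⟩))
  have e2 : ∀ᶠ y in 𝓝 (u z), Z y ∈ Metric.ball (0 : ℂ) 1 :=
    hZ.eventually_mem (Metric.isOpen_ball.mem_nhds (by rwa [hZ1]))
  refine ⟨t₀ + 1, ?_⟩
  filter_upwards [hc'.eventually (e1.and (e2.and hr))] with y hy hyS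
  rw [flowExt_of_mem hyS] at hy
  obtain ⟨h1, h2, h3⟩ := hy
  have hm := hu.embedded.mapsTo (Metric.ball_subset_closedBall h2)
  refine ⟨t₀ - T (φ t₀ y), ⟨by linarith [h1.2], by linarith [h1.1]⟩, ?_⟩
  have h4 := hφ.neg_cancel hm (T (φ t₀ y))
  rw [h3 (hφ.mapsTo _ hyS)] at h4
  rw [sub_eq_neg_add, hφ.add hyS, h4]
  exact mem_image_of_mem u (Metric.ball_subset_closedBall h2)

variable (hlam : IsContactForm lam) (hR : IsReebField lam R) (hφ : IsFlowOf R φ) (hp₀ : p₀ ∈ S3)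
  (hu : IsDiskGSS R φ (orbit φ p₀) u) (hstrong : IsBoundaryStrong lam R φ u)

include hlam hR hφ hp₀ hu hstrong

/-- Points that approach the boundary of the disk in a direction transverse to the Reeb field hit
the disk in bounded time. -/
theorem eventually_hit_of_direction {ι : Type*} {l : Filter ι} {x q : ι → E4} {z : ℂ} {w : E4}
    (hz : ‖z‖ = 1) (hx : Tendsto x l (𝓝 (u z))) (hq : Tendsto q l (𝓝 (u z)))
    (hxS : ∀ n, x n ∈ S3) (hqK : ∀ n, q n ∈ orbit φ p₀) (hne : ∀ n, x n ≠ q n)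
    (hw : Tendsto (fun n => ‖x n - q n‖⁻¹ • (x n - q n)) l (𝓝 w))
    (hwT : w ∈ tangentS3 (u z)) (hv : w - lam (u z) w • R (u z) ≠ 0) :
    ∃ T : ℝ, ∀ᶠ n in l, ∃ t ∈ Ioc 0 T, φ t (x n) ∈ disk u := by
  have hS := hu.embedded.mem_S3 (mem_closedBall_of_norm hz)
  have hS0 := S3_ne_zero hS
  set κ := lam (u z) w with hκ
  have hvξ : w - κ • R (u z) ∈ contactPlane lam (u z) := by
    refine ⟨Submodule.sub_mem _ hwT (Submodule.smul_mem _ _ (hR.tangent _ hS)), ?_⟩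
    have : lam (u z) (w - κ • R (u z)) = 0 := by
      rw [map_sub, map_smul, hR.normalised _ hS, smul_eq_mul, mul_one, sub_self]
    exact this
  -- The sign matters: at time `t₀` the negative of the direction of approach points outward, so the
  -- direction itself points into the disk.
  obtain ⟨t₀, ht₀, z', hz', hzz', r, hr, hlin⟩ := hstrong.hits_pos z hz _
    (Submodule.neg_mem _ hvξ) (neg_ne_zero.2 hv)
  have hcb' := mem_closedBall_of_norm hz'
  have hS' := hu.embedded.mem_S3 hcb'
  have hlinw : linFlow φ t₀ (u z) w = (-r) • outward lam R u z' + κ • R (u z') := by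
    have h1 : linFlow φ t₀ (u z) w = -linFlow φ t₀ (u z) (-(w - κ • R (u z))) +
        κ • linFlow φ t₀ (u z) (R (u z)) := by
      simp only [linFlow, map_neg, map_sub, map_smul]
      abel
    rw [h1, hlin, hφ.linFlow_field hS, hzz', neg_smul]
  obtain ⟨e, Z, h, he, her, hZ, hh, hZu, hdisk, hdec⟩ := hu.embedded.exists_coordinates hcb'
  obtain ⟨α, hα, hRα⟩ := exists_field_eq hR hφ hp₀ hu hz'
  have hflow0 : flowExt φ (t₀, u z) = u z' := by rw [flowExt_of_mem hS, hzz']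
  have hK : ∀ᶠ y in 𝓝 (u z'), y ∈ orbit φ p₀ → ‖Z y‖ = 1 ∧ h y = 0 := by
    filter_upwards [hu.embedded.eventually_of_apply hcb' hZu] with y hy hyK
    rw [← hu.boundary] at hyK
    obtain ⟨c, hc, rfl⟩ := hyK
    have hc1 : ‖c‖ = 1 := by simpa using hc
    obtain ⟨h1, h2⟩ := hy c (mem_closedBall_of_norm hc1) rfl
    exact ⟨by rw [h1, hc1], h2⟩
  have hgood := hdisk.and ((hh.eventually (by simp)).and hK)
  have hft : Tendsto (flowExt φ) (𝓝 (t₀, u z)) (𝓝 (u z')) := by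
    rw [← hflow0]
    exact (hφ.contDiffAt (q := (t₀, u z)) hS0).continuousAt
  have hgood' := hft.eventually hgood.eventually_nhds
  rw [nhds_prod_eq, eventually_prod_iff] at hgood'
  obtain ⟨P, hP, Q, hQ, hPQ⟩ := hgood'
  obtain ⟨ε₀, hε₀, hP'⟩ := Metric.eventually_nhds_iff.1 hP
  have hQz : Q (u z) := hQ.self_of_nhds
  have hFZ : ContDiffAt ℝ 1 (fun a : ℝ × E4 => ‖Z (flowExt φ a)‖ ^ 2) (t₀, u z) := by
    have h1 : ContDiffAt ℝ 1 (flowExt φ) (t₀, u z) :=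
      (hφ.contDiffAt (q := (t₀, u z)) hS0).of_le (by exact_mod_cast le_top)
    exact (ContDiffAt.comp (g := Z) _ (by rw [hflow0]; exact hZ) h1).norm_sq ℝ
  have hFZ' := hFZ.hasStrictFDerivAt (by simp)
  -- The derivative is `-2 * r`: motion along `R` is tangent to the circle and does not contribute.
  -- Since `‖Z‖ = 1` along the orbit, this will put the nearby trajectories over the open disk.
  have hneg : fderiv ℝ (fun a : ℝ × E4 => ‖Z (flowExt φ a)‖ ^ 2) (t₀, u z) (0, w) < 0 := by
    have h1 : HasFDerivAt (fun a : ℝ × E4 => Z (flowExt φ a))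
        ((fderiv ℝ Z (u z')).comp (fderiv ℝ (flowExt φ) (t₀, u z))) (t₀, u z) := by
      refine HasFDerivAt.comp (g := Z) _ ?_ (hφ.hasFDerivAt (q := (t₀, u z)) hS0)
      rw [hflow0]
      exact (hZ.differentiableAt (by simp)).hasFDerivAt
    have hZd : ∀ a, fderiv ℝ Z (u z') (fderiv ℝ u z' a) = a := by
      intro a
      have h3 : HasFDerivAt (fun c => Z (u c)) ((fderiv ℝ Z (u z')).comp (fderiv ℝ u z')) z' :=
        HasFDerivAt.comp (g := Z) _ (hZ.differentiableAt (by simp)).hasFDerivAt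
          (hu.embedded.hasFDerivAt z')
      have h4 : (fun c => Z (u c)) =ᶠ[𝓝 z'] id := hZu.mono fun c hc => hc.1
      have h5 := h3.fderiv
      rw [h4.fderiv_eq, fderiv_id] at h5
      exact (congrArg (fun A => A a) h5).symm
    rw [h1.norm_sq.fderiv]
    have h6 : linFlow φ t₀ (u z) w = fderiv ℝ u z'
        ((-r) • z' + ((r * lam (u z') (fderiv ℝ u z' z') + κ) * α) • (Complex.I * z')) := by
      rw [hlinw, map_add, map_smul, map_smul, mul_smul, ← hRα, outward, smul_sub, smul_smul,
        add_smul, neg_mul, neg_smul, neg_smul]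
      abel
    have h7 : inner ℝ z' (Complex.I * z') = 0 := by
      rw [Complex.inner]
      simp
      ring
    simp only [smul_apply, ContinuousLinearMap.comp_apply, innerSL_apply_apply,
      hflow0, ← hφ.linFlow_eq hS0, h6, hZd, hZu.self_of_nhds.1]
    rw [inner_add_right, inner_smul_right, inner_smul_right, h7, real_inner_self_eq_norm_sq, hz']
    simp
    linarith
  obtain ⟨ε₁, hε₁, hlt⟩ := hFZ'.eventually_lt_of_direction hx hq hne hw hneg
  have hsign := eventually_normal_mul_neg hlam hR hφ hp₀ hu hstrong hz' he her hdec
  have hsmall : ∀ᶠ ε in 𝓝[>] (0 : ℝ), ε ∈ Ioo 0 (min (min ε₀ ε₁) t₀) :=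
    Ioo_mem_nhdsGT (lt_min (lt_min hε₀ hε₁) ht₀)
  -- The three bounds on `ε` keep the charts valid, keep the comparison of `‖Z‖` valid, and keep the
  -- hitting time positive.
  obtain ⟨ε, hsε, hε0, hε⟩ := (hsign.and hsmall).exists
  have hεε₀ : ε < ε₀ := hε.trans_le ((min_le_left _ _).trans (min_le_left _ _))
  have hεε₁ : ε < ε₁ := hε.trans_le ((min_le_left _ _).trans (min_le_right _ _))
  have hεt : ε < t₀ := hε.trans_le (min_le_right _ _)
  -- To first order the height at time `t₀ + s` is the normal component of the linearised flow. The
  -- part along `R` drops out because `h` vanishes on the orbit. At `s = ±ε` the limits have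
  -- opposite signs.
  have hder : ∀ s : ℝ, |s| < ε₀ → Tendsto
      (fun n => ‖x n - q n‖⁻¹ * h (flowExt φ (t₀ + s, x n))) l
      (𝓝 (-r * fderiv ℝ h (φ s (u z')) (linFlow φ s (u z') (outward lam R u z')))) := by
    intro s hs
    have hPs : P (t₀ + s) := hP' (by simpa [Real.dist_eq] using hs)
    have hb : flowExt φ (t₀ + s, u z) = φ s (u z') := by
      rw [flowExt_of_mem hS, add_comm, hφ.add hS, hzz']
    have hgs := hPQ hPs hQz
    rw [hb] at hgs
    have hhs : ContDiffAt ℝ 1 h (φ s (u z')) := hgs.self_of_nhds.2.1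
    have hFs : ContDiffAt ℝ 1 (fun y => h (flowExt φ (t₀ + s, y))) (u z) := by
      have h1 : ContDiffAt ℝ 1 (fun y => flowExt φ (t₀ + s, y)) (u z) :=
        ContDiffAt.comp (g := flowExt φ) (f := fun y => (t₀ + s, y)) _
          ((hφ.contDiffAt (q := (t₀ + s, u z)) hS0).of_le (by exact_mod_cast le_top))
          (by fun_prop)
      exact ContDiffAt.comp (g := h) _ (by rw [hb]; exact hhs) h1
    have hlim := (hFs.hasStrictFDerivAt (by simp)).tendsto_direction hx hq hw
    have hval : fderiv ℝ (fun y => h (flowExt φ (t₀ + s, y))) (u z) w =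
        -r * fderiv ℝ h (φ s (u z')) (linFlow φ s (u z') (outward lam R u z')) := by
      have h1 : HasFDerivAt (fun y => flowExt φ (t₀ + s, y))
          (fderiv ℝ (fun y => flowExt φ (t₀ + s, y)) (u z)) (u z) :=
        ((hφ.hasFDerivAt (q := (t₀ + s, u z)) hS0).differentiableAt.comp (u z)
          (f := fun y => (t₀ + s, y)) (by fun_prop)).hasFDerivAt
      have h2 : HasFDerivAt (fun y => h (flowExt φ (t₀ + s, y))) _ (u z) :=
        HasFDerivAt.comp (g := h) (u z) (by
          rw [hb]; exact (hhs.differentiableAt (by simp)).hasFDerivAt) h1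
      have h3 : fderiv ℝ (fun y => flowExt φ (t₀ + s, y)) (u z) w = linFlow φ (t₀ + s) (u z) w :=
        rfl
      have h4 : fderiv ℝ h (φ s (u z')) (R (φ s (u z'))) = 0 := by
        have h5 : HasDerivAt (fun t => h (φ t (u z')))
            (fderiv ℝ h (φ s (u z')) (R (φ s (u z')))) s :=
          HasFDerivAt.comp_hasDerivAt (l := h) (f := fun t => φ t (u z')) s
            (hhs.differentiableAt (by simp)).hasFDerivAt (hφ.ode _ hS' s)
        have h6 : (fun t => h (φ t (u z'))) =ᶠ[𝓝 s] fun _ => 0 := by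
          filter_upwards [(hφ.continuous_left hS').continuousAt.eventually hgs] with t ht
          exact (ht.2.2 (flow_mem_orbit hφ hp₀ (hu.apply_mem hz') t)).2
        exact (h5.congr_of_eventuallyEq h6.symm).unique (hasDerivAt_const s 0)
      rw [h2.fderiv, ContinuousLinearMap.comp_apply, h3, add_comm t₀ s, hφ.linFlow_add hS, hzz',
        hlinw]
      have h7 : linFlow φ s (u z') ((-r) • outward lam R u z' + κ • R (u z')) =
          (-r) • linFlow φ s (u z') (outward lam R u z') + κ • R (φ s (u z')) := by
        rw [← hφ.linFlow_field hS']
        simp only [linFlow, map_add, map_smul]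
      rw [h7, map_add, map_smul, map_smul, h4, smul_zero, add_zero, smul_eq_mul]
    rw [hval] at hlim
    refine hlim.congr' ?_
    filter_upwards [hq.eventually hQ] with n hn
    have h8 := (hPQ hPs hn).self_of_nhds.2.2 ?_
    · rw [h8.2, sub_zero]
    · rw [flowExt_of_mem (orbit_subset_S3 hφ hp₀ (hqK n))]
      exact flow_mem_orbit hφ hp₀ (hqK n) _
  have hprod := (hder ε (by rwa [abs_of_pos hε0])).mul
    (hder (-ε) (by rwa [abs_neg, abs_of_pos hε0]))
  have hprodneg := hprod.eventually_lt_const (u := 0)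
    (by linarith [mul_neg_of_pos_of_neg (mul_pos hr hr) hsε])
  refine ⟨t₀ + ε, ?_⟩
  filter_upwards [hprodneg, hlt, hx.eventually hQ, hq.eventually hQ] with n h1 h2 h3 h4
  have hδ : 0 < ‖x n - q n‖ := norm_pos_iff.2 (sub_ne_zero.2 (hne n))
  have hin : ∀ t ∈ Icc (t₀ + -ε) (t₀ + ε), |t - t₀| ≤ ε := fun t ht =>
    abs_le.2 ⟨by linarith [ht.1], by linarith [ht.2]⟩
  have hcont : ContinuousOn (fun t => h (flowExt φ (t, x n))) (Icc (t₀ + -ε) (t₀ + ε)) := by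
    intro t ht
    have hPt : P t := hP' (by rw [Real.dist_eq]; exact (hin t ht).trans_lt hεε₀)
    have h5 : ContinuousAt h (flowExt φ (t, x n)) := (hPQ hPt h3).self_of_nhds.2.1.continuousAt
    have h6 : ContinuousAt (fun t => flowExt φ (t, x n)) t :=
      ContinuousAt.comp (g := flowExt φ) (f := fun t => (t, x n))
        (hφ.contDiffAt (q := (t, x n)) (S3_ne_zero (hxS n))).continuousAt (by fun_prop)
    exact (ContinuousAt.comp (g := h) (f := fun t => flowExt φ (t, x n)) h5 h6).continuousWithinAt
  have h7 : h (flowExt φ (t₀ + ε, x n)) * h (flowExt φ (t₀ + -ε, x n)) < 0 := by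
    have h8 : (‖x n - q n‖⁻¹ * ‖x n - q n‖⁻¹) *
        (h (flowExt φ (t₀ + ε, x n)) * h (flowExt φ (t₀ + -ε, x n))) < 0 := by
      linarith
    by_contra! hc
    exact absurd (mul_nonneg (by positivity) hc) (not_le.2 h8)
  have h0 : (0 : ℝ) ∈ uIcc (h (flowExt φ (t₀ + -ε, x n))) (h (flowExt φ (t₀ + ε, x n))) := by
    rw [mem_uIcc]
    rcases mul_neg_iff.1 h7 with ⟨a, b⟩ | ⟨a, b⟩
    · exact Or.inl ⟨b.le, a.le⟩
    · exact Or.inr ⟨a.le, b.le⟩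
  have hle : t₀ + -ε ≤ t₀ + ε := by linarith
  -- The height vanishes at some intermediate time, and `‖Z‖ < 1` there, so the point is on the
  -- disk.
  obtain ⟨t, ht, ht0⟩ := intermediate_value_uIcc
    (f := fun t => h (flowExt φ (t, x n))) (by rwa [uIcc_of_le hle]) h0
  rw [uIcc_of_le hle] at ht
  have hPt : P t := hP' (by rw [Real.dist_eq]; exact (hin t ht).trans_lt hεε₀)
  refine ⟨t, ⟨by linarith [ht.1], ht.2⟩, ?_⟩
  have h9 := h2 t ((hin t ht).trans_lt hεε₁)
  have h10 := ((hPQ hPt h4).self_of_nhds.2.2 (by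
    rw [flowExt_of_mem (orbit_subset_S3 hφ hp₀ (hqK n))]
    exact flow_mem_orbit hφ hp₀ (hqK n) _)).1
  simp only [h10] at h9
  have h11 : ‖Z (flowExt φ (t, x n))‖ < 1 := by nlinarith [norm_nonneg (Z (flowExt φ (t, x n)))]
  have h12 := (hPQ hPt h3).self_of_nhds.1 (hφ.flowExt_mem (S3_ne_zero (hxS n))) ht0 h11
  rwa [flowExt_of_mem (hxS n)] at h12

/-- Otherwise points `x n` tending to the orbit stay off the disk for longer and longer times.
Taking `q n` to be a nearest point of the orbit makes `x n - q n` orthogonal to `R`, so a limit of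
the unit directions is nonzero modulo `R`, and the previous lemma contradicts this along a
subsequence. -/
theorem eventually_hit_boundary {z : ℂ} (hz : ‖z‖ = 1) :
    ∃ T : ℝ, ∀ᶠ y in 𝓝 (u z), y ∈ S3 \ orbit φ p₀ → ∃ t ∈ Ioc 0 T, φ t y ∈ disk u := by
  have hS := hu.embedded.mem_S3 (mem_closedBall_of_norm hz)
  by_contra hcon
  push Not at hcon
  have hex : ∀ n : ℕ, ∃ y, dist y (u z) < 1 / ((n : ℝ) + 1) ∧ y ∈ S3 \ orbit φ p₀ ∧
      ∀ t ∈ Ioc (0 : ℝ) n, φ t y ∉ disk u := by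
    intro n
    have h1 := (hcon n).and_eventually (Metric.ball_mem_nhds (u z)
      (show (0 : ℝ) < 1 / ((n : ℝ) + 1) by positivity))
    obtain ⟨y, ⟨h2, h3⟩, h4⟩ := h1.exists
    exact ⟨y, h4, h2, h3⟩
  choose x hxd hxS hxn using hex
  have hKc : IsCompact (orbit φ p₀) := by
    rw [← hu.boundary]
    exact (isCompact_sphere _ _).image hu.embedded.smooth.continuous
  have hzK := hu.apply_mem hz
  have hnear : ∀ n, ∃ q ∈ orbit φ p₀, ∀ q' ∈ orbit φ p₀, dist (x n) q ≤ dist (x n) q' := by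
    intro n
    exact hKc.exists_isMinOn ⟨_, hzK⟩ (f := fun q => dist (x n) q) (by fun_prop)
  choose q hqK hqmin using hnear
  have hne : ∀ n, x n ≠ q n := fun n h => (hxS n).2 (h ▸ hqK n)
  have hx : Tendsto x atTop (𝓝 (u z)) := tendsto_iff_dist_tendsto_zero.2
    (squeeze_zero (fun _ => dist_nonneg) (fun n => (hxd n).le)
      tendsto_one_div_add_atTop_nhds_zero_nat)
  have hq : Tendsto q atTop (𝓝 (u z)) := by
    refine tendsto_iff_dist_tendsto_zero.2 (squeeze_zero (fun _ => dist_nonneg)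
      (g := fun n => dist (x n) (u z) + dist (x n) (u z)) (fun n => ?_) ?_)
    · have h1 := dist_triangle (q n) (x n) (u z)
      rw [dist_comm (q n) (x n)] at h1
      linarith [hqmin n _ hzK]
    · have := tendsto_iff_dist_tendsto_zero.1 hx
      simpa using this.add this
  have hwS : ∀ n, ‖x n - q n‖⁻¹ • (x n - q n) ∈ S3 := fun n => radial_mem (sub_ne_zero.2 (hne n))
  obtain ⟨w, hw, g, hg, hgw⟩ := isCompact_S3.tendsto_subseq hwS
  have hwT : w ∈ tangentS3 (u z) := by
    -- Chords of the sphere are orthogonal to the sum of their end points; in the limit this gives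
    -- tangency.
    have h1 : ∀ n, inner ℝ (x n + q n) (‖x n - q n‖⁻¹ • (x n - q n)) = 0 := by
      intro n
      rw [inner_smul_right, real_inner_add_sub_eq_zero_iff _ _ |>.2, mul_zero]
      rw [mem_S3.1 (hxS n).1, mem_S3.1 (orbit_subset_S3 hφ hp₀ (hqK n))]
    have h2 := (((hx.add hq).comp hg.tendsto_atTop).inner hgw (𝕜 := ℝ))
    have h3 : (fun n => inner ℝ (((fun n => x n + q n) ∘ g) n)
        (((fun n => ‖x n - q n‖⁻¹ • (x n - q n)) ∘ g) n)) = fun _ => (0 : ℝ) :=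
      funext fun n => h1 (g n)
    rw [h3] at h2
    have h4 := tendsto_nhds_unique tendsto_const_nhds h2
    rw [← two_smul ℝ, inner_smul_left] at h4
    rw [mem_tangentS3]
    simpa using h4.symm
  have hwR : inner ℝ (R (u z)) w = 0 := by
    have h1 : ∀ n, inner ℝ (R (q n)) (‖x n - q n‖⁻¹ • (x n - q n)) = 0 := by
      intro n
      have hqS := orbit_subset_S3 hφ hp₀ (hqK n)
      have h2 : HasDerivAt (fun t => x n - φ t (q n)) (-R (q n)) 0 := by
        have := (hφ.ode _ hqS 0).const_sub (x n)
        rwa [hφ.zero _ hqS] at this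
      have h3 := h2.norm_sq
      rw [hφ.zero _ hqS] at h3
      have h4 : IsLocalMin (fun t => ‖x n - φ t (q n)‖ ^ 2) 0 := by
        refine Eventually.of_forall fun t => ?_
        have h5 := hqmin n _ (flow_mem_orbit hφ hp₀ (hqK n) t)
        rw [dist_eq_norm, dist_eq_norm] at h5
        simp only [hφ.zero _ hqS]
        gcongr
      have h6 := h4.hasDerivAt_eq_zero h3
      rw [inner_neg_right, real_inner_comm] at h6
      rw [inner_smul_right]
      have h7 : inner ℝ (R (q n)) (x n - q n) = 0 := by linarith
      rw [h7, mul_zero]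
    have hRc : Tendsto (fun n => R (q n)) atTop (𝓝 (R (u z))) :=
      (hφ.smooth_field.continuousOn _ hS).tendsto.comp (tendsto_nhdsWithin_iff.2
        ⟨hq, Eventually.of_forall fun n => orbit_subset_S3 hφ hp₀ (hqK n)⟩)
    have h2 := ((hRc.comp hg.tendsto_atTop).inner hgw (𝕜 := ℝ))
    have h3 : (fun n => inner ℝ (((fun n => R (q n)) ∘ g) n)
        (((fun n => ‖x n - q n‖⁻¹ • (x n - q n)) ∘ g) n)) = fun _ => (0 : ℝ) :=
      funext fun n => h1 (g n)
    rw [h3] at h2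
    exact (tendsto_nhds_unique tendsto_const_nhds h2).symm
  have hv : w - lam (u z) w • R (u z) ≠ 0 := by
    intro h
    have h1 := congrArg (inner ℝ w) h
    rw [inner_sub_right, inner_smul_right, real_inner_comm, real_inner_comm (R (u z)), hwR,
      mul_zero, sub_zero, inner_zero_right, inner_self_eq_zero] at h1
    exact S3_ne_zero hw h1
  obtain ⟨T, hT⟩ := eventually_hit_of_direction hlam hR hφ hp₀ hu hstrong hz
    (hx.comp hg.tendsto_atTop) (hq.comp hg.tendsto_atTop) (fun n => (hxS (g n)).1)
    (fun n => hqK (g n)) (fun n => hne (g n)) hgw hwT hv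
  have hgT : ∀ᶠ n in atTop, T ≤ (g n : ℝ) :=
    (tendsto_natCast_atTop_atTop.comp hg.tendsto_atTop).eventually_ge_atTop T
  obtain ⟨n, ⟨t, ht, hd⟩, hn⟩ := (hT.and hgT).exists
  exact hxn (g n) t ⟨ht.1, ht.2.trans hn⟩ hd

/-- Every trajectory in the complement of the boundary orbit hits the disk in uniformly bounded
time. -/
theorem exists_hit_bound :
    ∃ T : ℝ, ∀ y ∈ S3 \ orbit φ p₀, ∃ t ∈ Ioc 0 T, φ t y ∈ disk u := by
  have h := isCompact_S3.induction_on
    (p := fun A => ∃ T : ℝ, ∀ y ∈ A, y ∈ S3 \ orbit φ p₀ → ∃ t ∈ Ioc 0 T, φ t y ∈ disk u)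
    ⟨0, by simp⟩ (fun A B hAB ⟨T, hT⟩ => ⟨T, fun y hy => hT y (hAB hy)⟩)
    (fun A B ⟨T, hT⟩ ⟨T', hT'⟩ => ⟨max T T', fun y hy hyS => ?_⟩) (fun q hq => ?_)
  · obtain ⟨T, hT⟩ := h
    exact ⟨T, fun y hy => hT y hy.1 hy⟩
  · rcases hy with hy | hy
    · obtain ⟨t, ht, hd⟩ := hT y hy hyS
      exact ⟨t, ⟨ht.1, ht.2.trans (le_max_left _ _)⟩, hd⟩
    · obtain ⟨t, ht, hd⟩ := hT' y hy hyS
      exact ⟨t, ⟨ht.1, ht.2.trans (le_max_right _ _)⟩, hd⟩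
  · by_cases hK : q ∈ orbit φ p₀
    · rw [← hu.boundary] at hK
      obtain ⟨z, hz, rfl⟩ := hK
      obtain ⟨T, hT⟩ := eventually_hit_boundary hlam hR hφ hp₀ hu hstrong (by simpa using hz)
      exact ⟨_, mem_nhdsWithin_of_mem_nhds hT, T, fun y hy => hy⟩
    · obtain ⟨T, hT⟩ := hu.eventually_hit hφ hR.tangent hp₀ ⟨hq, hK⟩
      exact ⟨_, mem_nhdsWithin_of_mem_nhds hT, T, fun y hy hyS => hy hyS.1⟩

end Bounded

end

noncomputable section

/-! ### Meridians of the boundary orbit -/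

section Meridian

variable {lam : E4 → E4 →L[ℝ] ℝ} {R : E4 → E4} {φ : ℝ → E4 → E4} {p₀ : E4} {T₀ : ℝ}

/-- Near `p₀`, the periodic orbit through `p₀` meets the kernel of `lam` only in `p₀`. -/
theorem eventually_eq_of_mem_orbit (hR : IsReebField lam R) (hφ : IsFlowOf R φ)
    (hγ : IsPeriodicOrbit φ p₀ T₀) :
    ∀ᶠ y in 𝓝 p₀, y ∈ orbit φ p₀ → lam p₀ (y - inner ℝ p₀ y • p₀) = 0 → y = p₀ := by
  have hS := hγ.mem
  have hper : Function.Periodic (fun t => φ t p₀) T₀ := fun t => by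
    simp only
    rw [hφ.add hS, hγ.closes]
  have hder : ∀ t₁, φ t₁ p₀ = p₀ → ∀ᶠ t in 𝓝 t₁,
      lam p₀ (φ t p₀ - inner ℝ p₀ (φ t p₀) • p₀) = 0 → t = t₁ := by
    intro t₁ ht₁
    have h1 := hφ.ode _ hS t₁
    have h2 : HasDerivAt (fun t => φ t p₀ - inner ℝ p₀ (φ t p₀) • p₀) (R p₀) t₁ := by
      have h3 := h1.sub (((innerSL ℝ p₀).hasFDerivAt.comp_hasDerivAt t₁ h1).smul_const p₀)
      rw [ht₁] at h3
      have h4 : innerSL ℝ p₀ (R p₀) = 0 := mem_tangentS3.1 (hR.tangent _ hS)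
      rw [h4, zero_smul, sub_zero] at h3
      exact h3
    have h5 := (lam p₀).hasFDerivAt.comp_hasDerivAt t₁ h2
    have h6 := h5.eventually_ne (c := 0) (by rw [hR.normalised _ hS]; exact one_ne_zero)
    rw [eventually_nhdsWithin_iff] at h6
    filter_upwards [h6] with t ht h7
    by_contra hne
    exact ht hne h7
  -- Compactness over one period. At times when the orbit is at `p₀`, the function has derivative
  -- `lam p₀ (R p₀) = 1`, so its zero is isolated; at other times the orbit stays away from `p₀`.
  have key : ∀ t₁ ∈ Icc 0 T₀, ∀ᶠ q : E4 × ℝ in 𝓝 (p₀, t₁), φ q.2 p₀ = q.1 →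
      lam p₀ (q.1 - inner ℝ p₀ q.1 • p₀) = 0 → q.1 = p₀ := by
    intro t₁ ht₁
    by_cases hp : φ t₁ p₀ = p₀
    · filter_upwards [continuousAt_snd.eventually (hder t₁ hp)] with q hq e h0
      rw [← e] at h0 ⊢
      rw [hq h0, hp]
    · have hc : ContinuousAt (fun q : E4 × ℝ => φ q.2 p₀ - q.1) (p₀, t₁) :=
        (((hφ.continuous_left hS).comp continuous_snd).sub continuous_fst).continuousAt
      filter_upwards [hc.eventually_ne (sub_ne_zero.2 hp)] with q hq e
      exact (hq (sub_eq_zero.2 e)).elim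
  have h := isCompact_Icc.eventually_forall_of_forall_eventually (P := fun y t => φ t p₀ = y →
    lam p₀ (y - inner ℝ p₀ y • p₀) = 0 → y = p₀) key
  filter_upwards [h] with y hy hyK
  obtain ⟨t, rfl⟩ := hyK
  obtain ⟨s, hs, e⟩ := hper.exists_mem_Ico₀ hγ.pos t
  exact hy s ⟨hs.1, hs.2.le⟩ e.symm

/-- A small meridian lies, up to the radial factor, in the contact plane at `p₀`, a slice that the
orbit meets near `p₀` only in `p₀` itself; and the meridian misses `p₀` because `e₁, e₂` are
independent. -/
theorem eventually_meridian_mem (hR : IsReebField lam R) (hφ : IsFlowOf R φ)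
    (hγ : IsPeriodicOrbit φ p₀ T₀) {e₁ e₂ : E4} (he₁ : e₁ ∈ contactPlane lam p₀)
    (he₂ : e₂ ∈ contactPlane lam p₀) (h12 : extD lam p₀ e₁ e₂ ≠ 0) :
    ∀ᶠ ε in 𝓝[>] (0 : ℝ), ∀ s ∈ Icc (0 : ℝ) (2 * Real.pi),
      p₀ + ε • (Real.cos s • e₁ + Real.sin s • e₂) ≠ 0 ∧
      radial (p₀ + ε • (Real.cos s • e₁ + Real.sin s • e₂)) ∈ S3 \ orbit φ p₀ := by
  have hS := hγ.mem
  have hS0 := S3_ne_zero hS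
  set γ : ℝ × ℝ → E4 := fun q => p₀ + q.1 • (Real.cos q.2 • e₁ + Real.sin q.2 • e₂) with hγdef
  have hγc : Continuous γ := by fun_prop
  have hγ0 : ∀ s, γ (0, s) = p₀ := fun s => by simp [γ]
  have key : ∀ s ∈ Icc (0 : ℝ) (2 * Real.pi), ∀ᶠ q : ℝ × ℝ in 𝓝 (0, s), γ q ≠ 0 ∧
      (radial (γ q) ∈ orbit φ p₀ →
        lam p₀ (radial (γ q) - inner ℝ p₀ (radial (γ q)) • p₀) = 0 → radial (γ q) = p₀) := by
    intro s _
    have h1 : ContinuousAt (fun q => radial (γ q)) (0, s) := by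
      refine ContinuousAt.comp (g := radial) ?_ hγc.continuousAt
      rw [hγ0]
      exact continuousOn_radial.continuousAt (isOpen_compl_singleton.mem_nhds hS0)
    have h2 : Tendsto (fun q => radial (γ q)) (𝓝 (0, s)) (𝓝 p₀) := by
      have := h1.tendsto
      rwa [hγ0, radial_of_mem hS] at this
    exact (hγc.continuousAt.eventually_ne (by rwa [hγ0])).and
      (h2.eventually (eventually_eq_of_mem_orbit hR hφ hγ))
  have h := isCompact_Icc.eventually_forall_of_forall_eventually (P := fun ε s => γ (ε, s) ≠ 0 ∧
      (radial (γ (ε, s)) ∈ orbit φ p₀ →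
        lam p₀ (radial (γ (ε, s)) - inner ℝ p₀ (radial (γ (ε, s))) • p₀) = 0 →
        radial (γ (ε, s)) = p₀)) key
  filter_upwards [nhdsWithin_le_nhds h, self_mem_nhdsWithin] with ε hε hpos s hs
  have hpos : 0 < ε := hpos
  obtain ⟨h1, h2⟩ := hε s hs
  refine ⟨h1, radial_mem h1, fun hK => ?_⟩
  set w := Real.cos s • e₁ + Real.sin s • e₂ with hw
  have hwξ : w ∈ contactPlane lam p₀ :=
    Submodule.add_mem _ (Submodule.smul_mem _ _ he₁) (Submodule.smul_mem _ _ he₂)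
  obtain ⟨hw1, hw2⟩ := mem_contactPlane.1 hwξ
  have hrad : radial (γ (ε, s)) = ‖γ (ε, s)‖⁻¹ • (p₀ + ε • w) := rfl
  have hinner : inner ℝ p₀ (radial (γ (ε, s))) = ‖γ (ε, s)‖⁻¹ := by
    rw [hrad, inner_smul_right, inner_add_right, inner_smul_right, hw1,
      real_inner_self_eq_norm_sq, mem_S3.1 hS]
    ring
  have hsub : radial (γ (ε, s)) - inner ℝ p₀ (radial (γ (ε, s))) • p₀ =
      (‖γ (ε, s)‖⁻¹ * ε) • w := by
    rw [hinner, hrad, smul_add, smul_smul]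
    abel
  have h3 := h2 hK (by rw [hsub, map_smul, hw2, smul_zero])
  rw [hsub.symm.trans (by rw [h3, real_inner_self_eq_norm_sq, mem_S3.1 hS]; simp) |>
    smul_eq_zero.1 |>.resolve_left (mul_ne_zero (inv_ne_zero (norm_ne_zero_iff.2 h1)) hpos.ne')]
    at hw
  have h4 : Real.sin s * extD lam p₀ e₁ e₂ = 0 := by
    have : extD lam p₀ e₁ (Real.cos s • e₁ + Real.sin s • e₂) = 0 := by
      rw [← hw]; simp [extD]
    rwa [extD_add_right, extD_smul_right, extD_smul_right, extD_self, mul_zero, zero_add] at this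
  have h5 : Real.cos s * extD lam p₀ e₁ e₂ = 0 := by
    have : extD lam p₀ e₂ (Real.cos s • e₁ + Real.sin s • e₂) = 0 := by
      rw [← hw]; simp [extD]
    rw [extD_add_right, extD_smul_right, extD_smul_right, extD_self, mul_zero, add_zero,
      extD_swap] at this
    linarith
  have h6 := (mul_eq_zero.1 h4).resolve_right h12
  have h7 := (mul_eq_zero.1 h5).resolve_right h12
  have := Real.sin_sq_add_cos_sq s
  rw [h6, h7] at this
  norm_num at this

end Meridian

/-! ### Linking numbers of closed trajectories -/

section Linking

variable {lam : E4 → E4 →L[ℝ] ℝ} {R : E4 → E4} {φ : ℝ → E4 → E4} {u : ℂ → E4} {p₀ : E4} {T₀ : ℝ}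
  {σ : E4 → E4 →L[ℝ] ℂ}

/-- A linking class has no continuous logarithm. -/
theorem not_exists_log (hlam : IsContactForm lam) (hR : IsReebField lam R) (hφ : IsFlowOf R φ)
    (hγ : IsPeriodicOrbit φ p₀ T₀) (hσ : IsSymplecticTrivialisation lam σ) {f : E4 → ℂ}
    (hf : IsLinkingClass lam (orbit φ p₀) f) {F : E4 → ℂ}
    (hF : ContinuousOn F (S3 \ orbit φ p₀))
    (hFe : ∀ x ∈ S3 \ orbit φ p₀, f x = Complex.exp (F x)) : False := by
  have hS := hγ.mem
  obtain ⟨m1, s1⟩ := hσ.trivInv_spec hlam hR hS 1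
  obtain ⟨mI, sI⟩ := hσ.trivInv_spec hlam hR hS Complex.I
  have h12 : extD lam p₀ (trivInv lam σ p₀ 1) (trivInv lam σ p₀ Complex.I) = 1 := by
    rw [← hσ.symplectic p₀ hS _ m1 _ mI, s1, sI]
    simp
  have hK : p₀ ∈ orbit φ p₀ := ⟨0, hφ.zero _ hS⟩
  -- Along a small closed meridian a logarithm would return to its initial value, against a
  -- variation of `2π`.
  obtain ⟨ε, h1, h2⟩ := ((hf.meridian p₀ hK _ m1 _ mI (by rw [h12]; exact one_pos)).and
    (eventually_meridian_mem hR hφ hγ m1 mI (by rw [h12]; exact one_ne_zero))).exists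
  have hpi := Real.pi_pos
  rw [angleVariation_eq_of_exp (F := fun s => F (radial (p₀ + ε •
    (Real.cos s • trivInv lam σ p₀ 1 + Real.sin s • trivInv lam σ p₀ Complex.I))))
    (by positivity)] at h1
  · simp at h1
  · refine hF.comp ?_ (fun s hs => (h2 s hs).2)
    exact continuousOn_radial.comp (by fun_prop) (fun s hs => (h2 s hs).1)
  · exact fun s hs => hFe _ (h2 s hs).2

variable (hlam : IsContactForm lam) (hR : IsReebField lam R) (hφ : IsFlowOf R φ) (hp₀ : p₀ ∈ S3)
  (hu : IsDiskGSS R φ (orbit φ p₀) u) (hstrong : IsBoundaryStrong lam R φ u)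

include hlam hR hφ hp₀ hu hstrong in
theorem exists_return_bound : ∃ T₁ : ℝ, ∀ z ∈ Metric.ball (0 : ℂ) 1, ∀ t w,
    IsFirstReturn φ u z t w → t ≤ T₁ := by
  obtain ⟨T₁, hT₁⟩ := exists_hit_bound hlam hR hφ hp₀ hu hstrong
  refine ⟨T₁, fun z hz t w h => ?_⟩
  obtain ⟨s, hs, hd⟩ := hT₁ _ (hu.apply_mem_compl hz)
  by_contra! hlt
  exact h.not_mem s ⟨hs.1, hs.2.trans_lt hlt⟩ hd

include hR hφ hp₀ hu in
/-- If the logarithm of `f` along trajectories does not increase at returns to the disk, then `f`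
has a continuous logarithm. -/
theorem exists_log_of_increment_zero {f : E4 → ℂ} {L : ℂ × ℝ → ℂ}
    (hL : ContinuousOn L (Metric.ball 0 1 ×ˢ univ))
    (hLe : ∀ z ∈ Metric.ball (0 : ℂ) 1, ∀ t, f (φ t (u z)) = Complex.exp (L (z, t)))
    (hc : ∀ z ∈ Metric.ball (0 : ℂ) 1, ∀ t w, IsFirstReturn φ u z t w → L (z, t) - L (w, 0) = 0)
    {T₁ : ℝ} (hT₁ : ∀ z ∈ Metric.ball (0 : ℂ) 1, ∀ t w, IsFirstReturn φ u z t w → t ≤ T₁) :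
    ∃ F : E4 → ℂ, ContinuousOn F (S3 \ orbit φ p₀) ∧
      ∀ x ∈ S3 \ orbit φ p₀, f x = Complex.exp (F x) := by
  have hT := hR.tangent
  have haux : ∀ z ∈ Metric.ball (0 : ℂ) 1, ∀ w ∈ Metric.ball (0 : ℂ) 1, ∀ t t' : ℝ, t' ≤ t →
      φ t (u z) = φ t' (u w) → L (z, t) = L (w, t') := by
    intro z hz w hw t t' htt h
    have hzS := (hu.apply_mem_compl hz).1
    have h1 : φ (t - t') (u z) = u w := by
      rw [sub_eq_neg_add, hφ.add hzS, h, hφ.neg_cancel (hu.apply_mem_compl hw).1]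
    obtain ⟨N, hN, -⟩ := exists_nat_log_sub hφ hT hp₀ hu hL hLe hc hT₁ hz hw (sub_nonneg.2 htt) h1
    have h2 := log_sub_log hφ hu hL hLe hz hw h1 t'
    rw [hN, mul_zero, add_sub_cancel, sub_eq_zero] at h2
    exact h2
  -- `L` takes the same value at all pairs representing the same point of the sphere. Hence the
  -- arbitrary choice `q` below does not affect `F`, and continuity may be checked in a flow chart.
  have hwell : ∀ z ∈ Metric.ball (0 : ℂ) 1, ∀ w ∈ Metric.ball (0 : ℂ) 1, ∀ t t' : ℝ,
      φ t (u z) = φ t' (u w) → L (z, t) = L (w, t') := by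
    intro z hz w hw t t' h
    rcases le_total t' t with h' | h'
    · exact haux z hz w hw t t' h' h
    · exact (haux w hw z hz t' t h' h.symm).symm
  have hex : ∀ y : E4, ∃ q : ℂ × ℝ, y ∈ S3 \ orbit φ p₀ →
      q.1 ∈ Metric.ball (0 : ℂ) 1 ∧ φ q.2 (u q.1) = y := by
    intro y
    by_cases hy : y ∈ S3 \ orbit φ p₀
    · obtain ⟨t, -, hd⟩ := hu.hits_pos y hy.1
      obtain ⟨z, hz, e⟩ := hu.mem_diskInterior (flow_mem_compl_orbit hφ hp₀ hy t).2 hd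
      exact ⟨(z, -t), fun _ => ⟨hz, by simp only [e]; exact hφ.neg_cancel hy.1 t⟩⟩
    · exact ⟨0, fun h => (hy h).elim⟩
  choose q hq using hex
  refine ⟨fun y => L (q y), fun y hy => ?_, fun y hy => ?_⟩
  · obtain ⟨hz, e⟩ := hq y hy
    have hzS := (hu.apply_mem_compl hz).1
    obtain ⟨Z, T, hZ, hTc, hZ1, hT1, hr, -⟩ := hu.exists_section hφ hT hz
    have hback : flowExt φ (-(q y).2, y) = u (q y).1 := by
      rw [flowExt_of_mem hy.1]
      have h := hφ.neg_cancel hzS (q y).2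
      rwa [e] at h
    have h1 : ContinuousAt (fun y' => flowExt φ (-(q y).2, y')) y :=
      ContinuousAt.comp (g := flowExt φ) (f := fun y' => (-(q y).2, y'))
        (hφ.contDiffAt (q := (-(q y).2, y)) (S3_ne_zero hy.1)).continuousAt (by fun_prop)
    have hZ' : ContinuousAt (fun y' => Z (flowExt φ (-(q y).2, y'))) y :=
      ContinuousAt.comp (g := Z) (f := fun y' => flowExt φ (-(q y).2, y'))
        (by rw [hback]; exact hZ) h1
    have hT' : ContinuousAt (fun y' => T (flowExt φ (-(q y).2, y')) + (q y).2) y :=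
      (ContinuousAt.comp (g := T) (f := fun y' => flowExt φ (-(q y).2, y'))
        (by rw [hback]; exact hTc) h1).add continuousAt_const
    have hLc : ContinuousAt L ((q y).1, (q y).2) :=
      hL.continuousAt ((Metric.isOpen_ball.prod isOpen_univ).mem_nhds ⟨hz, mem_univ _⟩)
    have hcomp : ContinuousAt (fun y' => L (Z (flowExt φ (-(q y).2, y')),
        T (flowExt φ (-(q y).2, y')) + (q y).2)) y := by
      refine ContinuousAt.comp (g := L) (f := fun y' => (Z (flowExt φ (-(q y).2, y')),
        T (flowExt φ (-(q y).2, y')) + (q y).2)) ?_ (hZ'.prodMk hT')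
      simp only [hback, hZ1, hT1, zero_add]
      exact hLc
    have htend : Tendsto (fun y' => flowExt φ (-(q y).2, y')) (𝓝 y) (𝓝 (u (q y).1)) := by
      rw [← hback]; exact h1
    have hZb : ∀ᶠ y' in 𝓝 y, Z (flowExt φ (-(q y).2, y')) ∈ Metric.ball (0 : ℂ) 1 :=
      hZ'.eventually_mem (Metric.isOpen_ball.mem_nhds (by rw [hback, hZ1]; exact hz))
    refine hcomp.continuousWithinAt.congr_of_eventuallyEq_of_mem ?_ hy
    filter_upwards [nhdsWithin_le_nhds (htend.eventually hr), nhdsWithin_le_nhds hZb,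
      self_mem_nhdsWithin] with y' h2 h3 hy'
    obtain ⟨hz', e'⟩ := hq y' hy'
    have hZS := (hu.apply_mem_compl h3).1
    refine hwell _ hz' _ h3 _ _ ?_
    rw [e', add_comm, hφ.add hZS, h2 (hφ.flowExt_mem (S3_ne_zero hy'.1)), flowExt_of_mem hy'.1,
      hφ.cancel_neg hy'.1]
  · obtain ⟨hz, e⟩ := hq y hy
    conv_lhs => rw [← e]
    exact hLe _ hz _

include hφ hu in
/-- The variation of the argument of `f` along a closed trajectory. -/
theorem angleVariation_closedTrajectory {f : E4 → ℂ} {L : ℂ × ℝ → ℂ}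
    (hL : ContinuousOn L (Metric.ball 0 1 ×ˢ univ))
    (hLe : ∀ z ∈ Metric.ball (0 : ℂ) 1, ∀ t, f (φ t (u z)) = Complex.exp (L (z, t)))
    {T : ℝ} {x : E4} (hx : x ∈ S3) {c : ℝ → E4} (hc : IsClosingPath φ u T x c)
    (hle : tMinus φ u x ≤ tEnd φ u T x) {z₀ z₁ : ℂ} (hz₀ : z₀ ∈ Metric.ball (0 : ℂ) 1)
    (hz₁ : z₁ ∈ Metric.ball (0 : ℂ) 1) (e₀ : φ (tMinus φ u x) x = u z₀)
    (e₁ : φ (tEnd φ u T x) x = u z₁) :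
    angleVariation (fun s => f (closedTrajectory φ u T x c s)) (tMinus φ u x)
        (tEnd φ u T x + 1) =
      (L (z₀, tEnd φ u T x - tMinus φ u x) - L (z₁, 0)).im := by
  set a := tMinus φ u x
  set b := tEnd φ u T x
  have hcb := fun {z : ℂ} (hz : z ∈ Metric.ball (0 : ℂ) 1) => Metric.ball_subset_closedBall hz
  have hex : ∀ s, ∃ w : ℂ, s ∈ Icc (0 : ℝ) 1 → w ∈ Metric.ball (0 : ℂ) 1 ∧ u w = c s := by
    intro s
    by_cases hs : s ∈ Icc (0 : ℝ) 1
    · obtain ⟨w, hw, e⟩ := hc.mapsTo hs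
      exact ⟨w, fun _ => ⟨hw, e⟩⟩
    · exact ⟨0, fun h => (hs h).elim⟩
  choose C hC using hex
  have h0 : (0 : ℝ) ∈ Icc (0 : ℝ) 1 := ⟨le_rfl, zero_le_one⟩
  have h1 : (1 : ℝ) ∈ Icc (0 : ℝ) 1 := ⟨zero_le_one, le_rfl⟩
  have hC0 : C 0 = z₁ := hu.embedded.injOn (hcb (hC 0 h0).1) (hcb hz₁) (by
    rw [(hC 0 h0).2, hc.source, e₁])
  have hC1 : C 1 = z₀ := hu.embedded.injOn (hcb (hC 1 h1).1) (hcb hz₀) (by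
    rw [(hC 1 h1).2, hc.target, e₀])
  have hCc : ContinuousOn C (Icc 0 1) := by
    intro s hs
    refine tendsto_def.2 fun V hV => ?_
    have h2 := hu.embedded.eventually_of_apply (hcb (hC s hs).1) hV
    rw [(hC s hs).2] at h2
    filter_upwards [(hc.continuousOn s hs).eventually h2, self_mem_nhdsWithin] with s' h3 hs'
    exact h3 _ (hcb (hC s' hs').1) (hC s' hs').2
  set d := L (z₀, b - a) - L (z₁, 0) with hd
  -- A logarithm of `f` along the whole loop. The constant `d` lies in `2πiℤ` and makes the two
  -- pieces agree at `b`; as the path ends at `z₀`, the total variation is `d`.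
  set G : ℝ → ℂ := fun s => if s ≤ b then L (z₀, s - a) else L (C (s - b), 0) + d with hG
  have hG1 : ∀ s ∈ Icc a b, G s = L (z₀, s - a) := fun s hs => if_pos hs.2
  have hG2 : ∀ s ∈ Icc b (b + 1), G s = L (C (s - b), 0) + d := by
    intro s hs
    rcases hs.1.eq_or_lt with rfl | hlt
    · simp only [hG, le_refl, if_true, sub_self, hC0, hd]
      ring
    · exact if_neg (not_le.2 hlt)
  have hsb : ∀ s ∈ Icc b (b + 1), s - b ∈ Icc (0 : ℝ) 1 := fun s hs =>
    ⟨by linarith [hs.1], by linarith [hs.2]⟩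
  have hunion : Icc a (b + 1) = Icc a b ∪ Icc b (b + 1) :=
    (Icc_union_Icc_eq_Icc hle (by linarith)).symm
  rw [angleVariation_eq_of_exp (F := G) (by linarith)]
  · rw [hG2 (b + 1) ⟨by linarith, le_rfl⟩, hG1 a ⟨le_rfl, hle⟩, add_sub_cancel_left, hC1, sub_self,
      Complex.add_im]
    ring
  · rw [hunion]
    refine ContinuousOn.union_of_isClosed ?_ ?_ isClosed_Icc isClosed_Icc
    · refine ContinuousOn.congr ?_ hG1
      exact hL.comp (f := fun s => (z₀, s - a)) (by fun_prop) fun s _ => ⟨hz₀, mem_univ _⟩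
    · refine ContinuousOn.congr ?_ hG2
      refine ContinuousOn.add ?_ continuousOn_const
      exact hL.comp (f := fun s => (C (s - b), (0 : ℝ)))
        ((hCc.comp (by fun_prop) hsb).prodMk continuousOn_const)
        fun s hs => ⟨(hC _ (hsb s hs)).1, mem_univ _⟩
  · intro s hs
    by_cases hsle : s ≤ b
    · rw [hG1 s ⟨hs.1, hsle⟩, ← hLe _ hz₀, ← e₀, ← hφ.add hx, sub_add_cancel, closedTrajectory,
        if_pos hsle]
    · have hs' : s ∈ Icc b (b + 1) := ⟨(not_le.1 hsle).le, hs.2⟩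
      obtain ⟨hw, e⟩ := hC _ (hsb s hs')
      have hd1 : Complex.exp d = 1 := by
        rw [hd, Complex.exp_sub, ← hLe _ hz₀, ← hLe _ hz₁, ← e₀, ← hφ.add hx, sub_add_cancel, e₁,
          hφ.zero _ (hu.apply_mem_compl hz₁).1, div_self]
        rw [← hφ.zero _ (hu.apply_mem_compl hz₁).1, hLe _ hz₁]
        exact Complex.exp_ne_zero _
      rw [hG2 s hs', Complex.exp_add, hd1, mul_one, ← hLe _ hw,
        hφ.zero _ (hu.apply_mem_compl hw).1, e, closedTrajectory, if_neg hsle]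

include hlam hR hφ hu hstrong in
omit hp₀ in
/-- The linking numbers of the closed trajectories do not depend on the closing paths, and grow at
least linearly. -/
theorem exists_linkingNumber_bound (hγ : IsPeriodicOrbit φ p₀ T₀)
    (hσ : IsSymplecticTrivialisation lam σ)
    (hex : ∃ f, IsLinkingClass lam (orbit φ p₀) f) :
    ∃ M : ℝ, ∀ T > 0, ∀ x ∈ S3 \ orbit φ p₀, ∀ c c' : ℝ → E4, IsClosingPath φ u T x c →
      IsClosingPath φ u T x c' →
      linkingNumber lam (orbit φ p₀) (closedTrajectory φ u T x c) (tMinus φ u x)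
          (tEnd φ u T x + 1) =
        linkingNumber lam (orbit φ p₀) (closedTrajectory φ u T x c') (tMinus φ u x)
          (tEnd φ u T x + 1) ∧
      T ≤ M * |linkingNumber lam (orbit φ p₀) (closedTrajectory φ u T x c) (tMinus φ u x)
          (tEnd φ u T x + 1)| := by
  have hp₀ := hγ.mem
  have hT := hR.tangent
  have hf := hex.choose_spec
  obtain ⟨L, hL, hLe⟩ := exists_log_flow hφ hp₀ hu hf.continuousOn hf.ne_zero
  obtain ⟨T₁, hT₁⟩ := exists_return_bound hlam hR hφ hp₀ hu hstrong
  obtain ⟨k, hk1, hk⟩ := exists_log_increment hφ hT hp₀ hu hL hLe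
  have hk0 : k ≠ 0 := by
    rintro rfl
    obtain ⟨F, hF, hFe⟩ := exists_log_of_increment_zero hR hφ hp₀ hu hL hLe hk hT₁
    exact not_exists_log hlam hR hφ hγ hσ hf hF hFe
  have hkim : k.im ≠ 0 := by
    intro h
    obtain ⟨n, hn⟩ := Complex.exp_eq_one_iff.1 hk1
    apply hk0
    have h1 : k.re = 0 := by rw [hn]; simp
    exact Complex.ext h1 h
  have hpi := Real.pi_pos
  -- The linking number is `N * k.im / (2 * π)` and the trajectory has length at most `N * T₁`. The
  -- sign and size of `k.im` are immaterial, only that it is nonzero.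
  refine ⟨T₁ * (2 * Real.pi) / |k.im|, fun T hTpos x hx c c' hc hc' => ?_⟩
  obtain ⟨z₁, hz₁, e₁⟩ := hc.mapsTo (left_mem_Icc.2 zero_le_one)
  obtain ⟨z₀, hz₀, e₀⟩ := hc.mapsTo (right_mem_Icc.2 zero_le_one)
  rw [hc.source] at e₁
  rw [hc.target] at e₀
  have ha : tMinus φ u x ≤ 0 := Real.sSup_nonpos fun t ht => ht.1
  have hb : T ≤ tEnd φ u T x := by
    have : 0 ≤ tPlus φ u (φ T x) := Real.sInf_nonneg fun t ht => ht.1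
    rw [tEnd]
    linarith
  have hle : tMinus φ u x ≤ tEnd φ u T x := by linarith
  obtain ⟨N, hN, hNT⟩ := exists_nat_log_sub hφ hT hp₀ hu hL hLe hk hT₁ hz₀ hz₁ (sub_nonneg.2 hle)
    (by rw [e₀, ← hφ.add hx.1, sub_add_cancel, e₁])
  have hlink : ∀ c, IsClosingPath φ u T x c →
      linkingNumber lam (orbit φ p₀) (closedTrajectory φ u T x c) (tMinus φ u x)
        (tEnd φ u T x + 1) = N * k.im / (2 * Real.pi) := by
    intro c hc
    rw [linkingNumber, dif_pos hex, angleVariation_closedTrajectory hφ hu hL hLe hx.1 hc hle hz₀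
      hz₁ e₀.symm e₁.symm, hN]
    simp
  refine ⟨by rw [hlink c hc, hlink c' hc'], ?_⟩
  rw [hlink c hc, abs_div, abs_mul, Nat.abs_cast, abs_of_pos (by positivity : 0 < 2 * Real.pi)]
  have h2 : T₁ * (2 * Real.pi) / |k.im| * (N * |k.im| / (2 * Real.pi)) = N * T₁ := by
    have := abs_ne_zero.2 hkim
    field_simp
  rw [h2]
  linarith

end Linking

end
noncomputable section

/-! ### Comparison of the lower limits -/

/-- Two lower limits of infima agree if the quotients differ by `C * M / T` at most. -/
lemma liminf_iInf_div_le {K : Set E4} {P : E4 → Submodule ℝ E4} {A A' : ℝ → E4 → E4 → ℝ}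
    {l l' : ℝ → E4 → ℝ} {C M : ℝ}
    (hA : ∀ T, 0 ≤ T → ∀ x ∈ K, ∀ v ∈ P x, v ≠ 0 → |A T x v - A' T x v| ≤ C)
    (hl : ∀ T > 0, ∀ x ∈ K, l T x = l' T x ∧ T ≤ M * |l T x|) :
    liminf (fun T : ℝ => ⨅ x ∈ K, ⨅ v ∈ P x, ⨅ _ : v ≠ 0, ((A T x v / l T x : ℝ) : EReal)) atTop ≤
      liminf (fun T : ℝ => ⨅ x ∈ K, ⨅ v ∈ P x, ⨅ _ : v ≠ 0,
        ((A' T x v / l' T x : ℝ) : EReal)) atTop := by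
  set b : ℝ → EReal := fun T => ⨅ x ∈ K, ⨅ v ∈ P x, ⨅ _ : v ≠ 0,
    ((A' T x v / l' T x : ℝ) : EReal)
  have key : ∀ ε : ℝ, 0 < ε → ∀ᶠ T in atTop,
      -- Holds once `T ≥ |C| * |M| / ε`: then `|C| ≤ ε * |l T x|`, since `T ≤ |M| * |l T x|`.
      (⨅ x ∈ K, ⨅ v ∈ P x, ⨅ _ : v ≠ 0, ((A T x v / l T x : ℝ) : EReal)) ≤ b T + ε := by
    intro ε hε
    filter_upwards [eventually_gt_atTop 0, eventually_ge_atTop (|C| * |M| / ε)] with T hT hTε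
    have hb : (⨅ x ∈ K, ⨅ v ∈ P x, ⨅ _ : v ≠ 0, ((A T x v / l T x : ℝ) : EReal)) - ε ≤ b T := by
      refine le_iInf₂ fun x hx => le_iInf₂ fun v hv => le_iInf fun h0 => ?_
      rw [EReal.sub_le_iff_le_add (Or.inl (EReal.coe_ne_bot _)) (Or.inl (EReal.coe_ne_top _))]
      refine (iInf₂_le x hx).trans <| (iInf₂_le v hv).trans <| (iInf_le _ h0).trans ?_
      rw [← EReal.coe_add, EReal.coe_le_coe_iff]
      obtain ⟨hll, hlM⟩ := hl T hT x hx
      rw [← hll, ← sub_le_iff_le_add', ← sub_div]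
      have hlM' : T ≤ |M| * |l T x| :=
        hlM.trans (mul_le_mul_of_nonneg_right (le_abs_self M) (abs_nonneg _))
      have hl0 : 0 < |l T x| := by
        rcases (abs_nonneg (l T x)).eq_or_lt with h | h
        · rw [← h, mul_zero] at hlM'
          linarith
        · exact h
      refine (le_abs_self _).trans ?_
      rw [abs_div, div_le_iff₀ hl0]
      refine ((hA T hT.le x hx v hv h0).trans (le_abs_self C)).trans ?_
      rw [div_le_iff₀ hε] at hTε
      have hM0 : 0 < |M| := by
        rcases (abs_nonneg M).eq_or_lt with h | h
        · rw [← h, zero_mul] at hlM'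
          linarith
        · exact h
      refine le_of_mul_le_mul_right ?_ hM0
      nlinarith
    rwa [EReal.sub_le_iff_le_add (Or.inl (EReal.coe_ne_bot _)) (Or.inl (EReal.coe_ne_top _))] at hb
  -- The lower limit may be infinite, so the error is absorbed by real numbers `w < z` above it and
  -- `ε = z - w`.
  refine EReal.le_of_forall_lt_iff_le.1 fun z hz => ?_
  obtain ⟨w, hw, hwz⟩ := EReal.lt_iff_exists_real_btwn.1 hz
  have hwz' : w < z := EReal.coe_lt_coe_iff.1 hwz
  have hfreq : ∃ᶠ T in atTop, b T < w := frequently_lt_of_liminf_lt (by isBoundedDefault) hw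
  refine liminf_le_of_frequently_le ?_ (by isBoundedDefault)
  refine (hfreq.and_eventually (key (z - w) (sub_pos.2 hwz'))).mono fun T hT => hT.2.trans ?_
  refine (add_le_add_left hT.1.le _).trans ?_
  rw [← EReal.coe_add, EReal.coe_le_coe_iff]
  linarith

end

/-! ### Independence of the trivialisation -/

theorem mainTheorem8
    (lam : E4 → E4 →L[ℝ] ℝ) (hlam : IsContactForm lam)
    (R : E4 → E4) (hR : IsReebField lam R)
    (φ : ℝ → E4 → E4) (hφ : IsFlowOf R φ)
    (p₀ : E4) (T₀ : ℝ) (hγ : IsPeriodicOrbit φ p₀ T₀)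
    (hunknot : IsUnknotted (orbit φ p₀))
    (hsl : HasSelfLinkingNumber lam φ p₀ T₀ (-1))
    (u : ℂ → E4) (hu : IsDiskGSS R φ (orbit φ p₀) u)
    (hstrong : IsBoundaryStrong lam R φ u)
    (σ₁ σ₂ : E4 → E4 →L[ℝ] ℂ)
    (hσ₁ : IsSymplecticTrivialisation lam σ₁) (hσ₂ : IsSymplecticTrivialisation lam σ₂)
    (c₁ c₂ : ℝ → E4 → ℝ → E4)
    (hc₁ : ∀ T > 0, ∀ x ∈ S3 \ orbit φ p₀, IsClosingPath φ u T x (c₁ T x))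
    (hc₂ : ∀ T > 0, ∀ x ∈ S3 \ orbit φ p₀, IsClosingPath φ u T x (c₂ T x)) :
    kappa lam φ (orbit φ p₀) u σ₁ c₁ = kappa lam φ (orbit φ p₀) u σ₂ c₂ := by
  by_cases hex : ∃ f, IsLinkingClass lam (orbit φ p₀) f
  · obtain ⟨C, hC⟩ := exists_angleVariation_sub_le hlam hR hφ hσ₁ hσ₂
    obtain ⟨M, hM⟩ := exists_linkingNumber_bound hlam hR hφ hu hstrong hγ hσ₁ hex
    refine le_antisymm (liminf_iInf_div_le (C := C) (M := M) (P := contactPlane lam) ?_ ?_)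
      (liminf_iInf_div_le (C := C) (M := M) (P := contactPlane lam) ?_ ?_)
    · exact fun T hT x hx => hC T hT x hx.1
    · exact fun T hT x hx => hM T hT x hx _ _ (hc₁ T hT x hx) (hc₂ T hT x hx)
    · intro T hT x hx v hv h0
      rw [abs_sub_comm]
      exact hC T hT x hx.1 v hv h0
    · exact fun T hT x hx => hM T hT x hx _ _ (hc₂ T hT x hx) (hc₁ T hT x hx)
  -- Without a linking class every linking number has the default value zero, so all quotients on
  -- both sides are zero by convention.
  · simp only [kappa, linkingNumber, dif_neg hex, div_zero]
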